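/- Let $n\ge 2$, let $V=\mathbb C^n$, let $\Lambda(n)=\Lambda^\bullet(V)$, and let $\mathfrak g=W(n)$ be the Lie superalgebra of all superderivations of $\Lambda(n)$ with the supercommutator bracket. It carries the $\mathbb Z$-grading $\mathfrak g=\bigoplus_{k=-1}^{n-1}\mathfrak g_k$, where $\mathfrak g_k$ consists of the superderivations $D$ of parity $k \bmod 2$ with $D(\Lambda^j(V))\subseteq\Lambda^{j+k}(V)$ for all $j$. Let $G_0=\mathrm{GL}(n,\mathbb C)$ act on $\mathfrak g$ by $A\cdot D=\Lambda(A)\,D\,\Lambda(A)^{-1}$; this differentiates to the adjoint action of $\mathfrak g_0\cong\mathfrak{gl}(n)$. For $p\ge0$ let $C^p(\mathfrak g,\mathfrak g_0;\mathbb C)=\operatorname{Hom}_{\mathfrak g_0}(\Lambda_s^p(\mathfrak g/\mathfrak g_0),\mathbb C)$ be the space of $\mathfrak g_0$-invariant super-alternating $p$-linear forms on $\mathfrak g$ which vanish as soon as one argument lies in $\mathfrak g_0$. Let $d^p:C^p\to C^{p+1}$ be given on homogeneous $x_1,\dots,x_{p+1}$, of parities $\bar x_i$, by $$d^p\phi(x_1,\dots,x_{p+1})=\sum_{i<j}(-1)^{\sigma_{i,j}}\,\phi([x_i,x_j],x_1,\dots,\widehat{x_i},\dots,\widehat{x_j},\dots,x_{p+1}),$$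 $$\sigma_{i,j}=i+j+\bar x_i(\bar x_1+\dots+\bar x_{i-1})+\bar x_j(\bar x_1+\dots+\bar x_{j-1}+\bar x_i).$$ Let $H^p(\mathfrak g,\mathfrak g_0;\mathbb C)=\operatorname{Ker}d^p/\operatorname{Im}d^{p-1}$ and $H^\bullet(\mathfrak g,\mathfrak g_0;\mathbb C)=\bigoplus_p H^p(\mathfrak g,\mathfrak g_0;\mathbb C)$, with the product induced by the cup product of cochains (the signed sum over all $(p,q)$-shuffles). Let $S=S((\mathfrak g_{-1}\oplus\mathfrak g_1)^*)$ be the symmetric algebra on the dual space of $\mathfrak g_{-1}\oplus\mathfrak g_1$, on which $\mathfrak g_0$ acts by derivations and $G_0$ by algebra automorphisms, extending the contragredient of the adjoint action. Then: 1. $d^p=0$ on $C^p(\mathfrak g,\mathfrak g_0;\mathbb C)$ for all $p\ge0$. 2. Every $\phi\in C^p(\mathfrak g,\mathfrak g_0;\mathbb C)$ vanishes as soon as one of its arguments lies in $\mathfrak g_k$ with $k\ne\pm1$. 3. The cup product of relative cocycles is a relative cocycle, and there is an isomorphism of graded $\mathbb C$-algebras $$H^\bullet(\mathfrak g,\mathfrak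 g_0;\mathbb C)\;\cong\;S\big((\mathfrak g_{-1}\oplus\mathfrak g_1)^*\big)^{\mathfrak g_0}$$ which sends $H^p$ into $S^p\big((\mathfrak g_{-1}\oplus\mathfrak g_1)^*\big)$ and the class of the $0$-cochain $1$ to $1$. 4. $S\big((\mathfrak g_{-1}\oplus\mathfrak g_1)^*\big)^{\mathfrak g_0}=S\big((\mathfrak g_{-1}\oplus\mathfrak g_1)^*\big)^{G_0}$. -/

import Mathlib

open scoped DirectSum

noncomputable section

/-! ### Super vector spaces and Lie superalgebras over `ℂ` -/

/-- The sign `(-1)^a` for `a ∈ ℤ/2`. -/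
def superSign (a : ZMod 2) : ℂ := if a = 0 then 1 else -1

/-- The projection of `L = L₀ ⊕ L₁` onto `L_a`. -/
def parityProj {L : Type*} [AddCommGroup L] [Module ℂ L] (part : ZMod 2 → Submodule ℂ L)
    (h : IsCompl (part 0) (part 1)) (a : ZMod 2) : L →ₗ[ℂ] L :=
  if a = 0 then (part 0).projection (part 1) h else (part 1).projection (part 0) h.symm

theorem zmod2_cases (a : ZMod 2) : a = 0 ∨ a = 1 := by
  revert a; decide

theorem zmod2_one_add_one : (1 : ZMod 2) + 1 = 0 := by
  decide

theorem superSign_zero : superSign 0 = 1 := by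
  simp [superSign]

theorem superSign_one : superSign 1 = -1 := by
  simp [superSign]

theorem parityProj_of_mem {L : Type*} [AddCommGroup L] [Module ℂ L]
    {part : ZMod 2 → Submodule ℂ L} (h : IsCompl (part 0) (part 1)) {a : ZMod 2} {x : L}
    (hx : x ∈ part a) (b : ZMod 2) : parityProj part h b x = if b = a then x else 0 := by
  rcases zmod2_cases a with rfl | rfl <;> rcases zmod2_cases b with rfl | rfl <;>
    simp [parityProj, Submodule.projection_apply_of_mem_left,
      Submodule.projection_apply_of_mem_right, hx]

theorem parityProj_mem {L : Type*} [AddCommGroup L] [Module ℂ L]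
    {part : ZMod 2 → Submodule ℂ L} (h : IsCompl (part 0) (part 1)) (a : ZMod 2) (x : L) :
    parityProj part h a x ∈ part a := by
  rcases zmod2_cases a with rfl | rfl
  · simp [parityProj]
  · simp [parityProj]

/-- A Lie superalgebra structure on a complex vector space `L`. -/
structure LieSuperalgebra (L : Type*) [AddCommGroup L] [Module ℂ L] where
  /-- the even part `part 0` and the odd part `part 1` -/
  part : ZMod 2 → Submodule ℂ L
  isCompl : IsCompl (part 0) (part 1)
  bracket : L →ₗ[ℂ] L →ₗ[ℂ] L
  bracket_mem : ∀ {a b : ZMod 2} {x y : L}, x ∈ part a → y ∈ part b → bracket x y ∈ part (a + b)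
  bracket_skew : ∀ {a b : ZMod 2} {x y : L}, x ∈ part a → y ∈ part b →
    bracket x y = -(superSign (a * b) • bracket y x)
  jacobi : ∀ {a b c : ZMod 2} {x y z : L}, x ∈ part a → y ∈ part b → z ∈ part c →
    bracket x (bracket y z) =
      bracket (bracket x y) z + superSign (a * b) • bracket y (bracket x z)

namespace LieSuperalgebra

variable {L : Type*} [AddCommGroup L] [Module ℂ L]

/-- The projection of `L` onto its part of parity `a`. -/
def proj (𝔤 : LieSuperalgebra L) (a : ZMod 2) : L →ₗ[ℂ] L := parityProj 𝔤.part 𝔤.isCompl a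

/-- A Lie subsuperalgebra: a graded subspace closed under the bracket. -/
structure Sub (𝔤 : LieSuperalgebra L) where
  carrier : Submodule ℂ L
  proj_mem : ∀ (a : ZMod 2) {x : L}, x ∈ carrier → 𝔤.proj a x ∈ carrier
  bracket_mem : ∀ {x y : L}, x ∈ carrier → y ∈ carrier → 𝔤.bracket x y ∈ carrier

/-! ### Relative cohomology with trivial coefficients -/

/-- `ℂ`-valued `p`-linear forms on `L`, i.e. `Hom(L^{⊗p}, ℂ)`. -/
abbrev Form (L : Type*) [AddCommGroup L] [Module ℂ L] (p : ℕ) : Type _ :=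
  MultilinearMap ℂ (fun _ : Fin p => L) ℂ

/-- The form `(x₁, …, x_p) ↦ φ (x₁^{(e₁)}, …, x_p^{(e_p)})`, where `x^{(a)}` is the component of
parity `a`. -/
def homPart (𝔤 : LieSuperalgebra L) {p : ℕ} (e : Fin p → ZMod 2) :
    Form L p →ₗ[ℂ] Form L p :=
  MultilinearMap.compLinearMapₗ fun i => 𝔤.proj (e i)

/-- For `i < j`, the form
`(x₀, …, x_{q+1}) ↦ φ ([x_i, x_j], x₀, …, x̂_i, …, x̂_j, …, x_{q+1})`.
As `i < j`, deleting first the `j`-th and then the `i`-th entry deletes `x_j` and `x_i`. -/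
def bracketTerm (𝔤 : LieSuperalgebra L) {q : ℕ} (i : Fin (q + 1)) (j : Fin (q + 2)) :
    Form L (q + 1) →ₗ[ℂ] Form L (q + 2) where
  toFun φ := LinearMap.uncurryMid j
    { toFun := fun y => LinearMap.uncurryMid i (φ.curryLeft ∘ₗ 𝔤.bracket.flip y)
      map_add' := fun y y' => by ext; simp
      map_smul' := fun c y => by ext; simp }
  map_add' φ ψ := by ext; simp
  map_smul' c φ := by ext; simp

theorem bracketTerm_apply (𝔤 : LieSuperalgebra L) {q : ℕ} (i : Fin (q + 1)) (j : Fin (q + 2))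
    (φ : Form L (q + 1)) (x : Fin (q + 2) → L) :
    𝔤.bracketTerm i j φ x =
      φ (Fin.cons (𝔤.bracket (x (j.succAbove i)) (x j)) (i.removeNth (j.removeNth x))) := by
  rfl

/-- The exponent (mod 2) of the sign of the `(i, j)`-term in the differential, for arguments of
parities `e`. -/
def diffExponent {m : ℕ} (e : Fin m → ZMod 2) (i j : Fin m) : ZMod 2 :=
  (i.val : ZMod 2) + (j.val : ZMod 2) + e i * (∑ k ∈ Finset.univ.filter (· < i), e k) +
    e j * ((∑ k ∈ Finset.univ.filter (· < j), e k) + e i)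

/-- The differential `d^p` for the trivial module `ℂ`. For homogeneous `x₀, …, x_p` of parities
`e` only the summand with that `e` contributes, and
`(dφ)(x₀, …, x_p) = ∑_{i < j} (-1)^{σ_{i,j}} φ([x_i, x_j], x₀, …, x̂_i, …, x̂_j, …, x_p)`,
see `d_apply`; the sum over `e` is the multilinear extension to all arguments. -/
def d (𝔤 : LieSuperalgebra L) : (p : ℕ) → Form L p →ₗ[ℂ] Form L (p + 1)
  | 0 => 0
  | q + 1 => ∑ e : Fin (q + 2) → ZMod 2, 𝔤.homPart e ∘ₗ
      ∑ j : Fin (q + 2), ∑ i ∈ Finset.univ.filter (fun i : Fin (q + 1) => i.castSucc < j),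
        superSign (diffExponent e i.castSucc j) • 𝔤.bracketTerm i j

theorem homPart_apply_of_mem (𝔤 : LieSuperalgebra L) {p : ℕ} (φ : Form L p) {x : Fin p → L}
    {e : Fin p → ZMod 2} (hx : ∀ i, x i ∈ 𝔤.part (e i)) (e' : Fin p → ZMod 2) :
    𝔤.homPart e' φ x = if e' = e then φ x else 0 := by
  have h : ∀ i, 𝔤.proj (e' i) (x i) = if e' i = e i then x i else 0 :=
    fun i => parityProj_of_mem 𝔤.isCompl (hx i) (e' i)
  simp only [homPart, MultilinearMap.compLinearMapₗ_apply, MultilinearMap.compLinearMap_apply, h]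
  split_ifs with he
  · subst he; simp
  · obtain ⟨i, hi⟩ := Function.ne_iff.1 he
    exact φ.map_coord_zero i (by simp [hi])

theorem d_apply (𝔤 : LieSuperalgebra L) {q : ℕ} (φ : Form L (q + 1)) {x : Fin (q + 2) → L}
    {e : Fin (q + 2) → ZMod 2} (hx : ∀ i, x i ∈ 𝔤.part (e i)) :
    𝔤.d (q + 1) φ x =
      ∑ j : Fin (q + 2), ∑ i ∈ Finset.univ.filter (fun i : Fin (q + 1) => i.castSucc < j),
        superSign (diffExponent e i.castSucc j) *
          φ (Fin.cons (𝔤.bracket (x i.castSucc) (x j)) (i.removeNth (j.removeNth x))) := by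
  simp only [d, LinearMap.sum_apply, LinearMap.comp_apply, sum_apply,
    𝔤.homPart_apply_of_mem _ hx]
  rw [Finset.sum_ite_eq' Finset.univ e, if_pos (Finset.mem_univ _)]
  simp only [LinearMap.smul_apply, smul_apply,
    smul_eq_mul]
  refine Finset.sum_congr rfl fun j _ => Finset.sum_congr rfl fun i hi => ?_
  rw [bracketTerm_apply, Fin.succAbove_of_castSucc_lt _ _ (Finset.mem_filter.1 hi).2]

/-- The relative cochains `C^p(𝔤, 𝔱; ℂ) = Hom_𝔱(Λ_s^p(𝔤/𝔱), ℂ)`: the `p`-linear forms which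
* are super-alternating, i.e. factor through the super wedge power;
* vanish as soon as one argument lies in `𝔱`;
* are `𝔱`-invariant. -/
def relCochain (𝔤 : LieSuperalgebra L) (𝔱 : 𝔤.Sub) (p : ℕ) : Submodule ℂ (Form L p) where
  carrier := {φ |
    (∀ (e : Fin p → ZMod 2) (x : Fin p → L), (∀ i, x i ∈ 𝔤.part (e i)) →
      ∀ i j : Fin p, j.val = i.val + 1 →
        φ x = -(superSign (e i * e j) * φ (x ∘ Equiv.swap i j))) ∧
    (∀ x : Fin p → L, (∃ i, x i ∈ 𝔱.carrier) → φ x = 0) ∧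
    (∀ (a : ZMod 2) (z : L), z ∈ 𝔱.carrier → z ∈ 𝔤.part a →
      ∀ (e : Fin p → ZMod 2) (x : Fin p → L), (∀ i, x i ∈ 𝔤.part (e i)) →
        ∑ i : Fin p, superSign (a * ∑ k ∈ Finset.univ.filter (· < i), e k) *
          φ (Function.update x i (𝔤.bracket z (x i))) = 0)}
  add_mem' := by
    rintro φ ψ ⟨h1, h2, h3⟩ ⟨k1, k2, k3⟩
    refine ⟨fun e x hx i j hij => ?_, fun x hx => ?_, fun a z hz hza e x hx => ?_⟩
    · rw [add_apply, add_apply, h1 e x hx i j hij,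
        k1 e x hx i j hij]
      ring
    · rw [add_apply, h2 x hx, k2 x hx, add_zero]
    · simp only [add_apply, mul_add, Finset.sum_add_distrib]
      rw [h3 a z hz hza e x hx, k3 a z hz hza e x hx, add_zero]
  zero_mem' := by simp
  smul_mem' := by
    rintro c φ ⟨h1, h2, h3⟩
    refine ⟨fun e x hx i j hij => ?_, fun x hx => ?_, fun a z hz hza e x hx => ?_⟩
    · rw [smul_apply, smul_apply, h1 e x hx i j hij, smul_eq_mul,
        smul_eq_mul]
      ring
    · rw [smul_apply, h2 x hx, smul_zero]
    · rw [← mul_zero c, ← h3 a z hz hza e x hx, Finset.mul_sum]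
      refine Finset.sum_congr rfl fun i _ => ?_
      rw [smul_apply, smul_eq_mul, mul_left_comm]

/-- The relative `p`-cocycles, `Ker d^p` on `C^p(𝔤, 𝔱; ℂ)`. -/
def relCocycle (𝔤 : LieSuperalgebra L) (𝔱 : 𝔤.Sub) (p : ℕ) : Submodule ℂ (Form L p) :=
  𝔤.relCochain 𝔱 p ⊓ LinearMap.ker (𝔤.d p)

/-- The relative `p`-coboundaries, the image of `d^{p-1}` on `C^{p-1}(𝔤, 𝔱; ℂ)`. -/
def relCoboundary (𝔤 : LieSuperalgebra L) (𝔱 : 𝔤.Sub) : (p : ℕ) → Submodule ℂ (Form L p)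
  | 0 => ⊥
  | p + 1 => (𝔤.relCochain 𝔱 p).map (𝔤.d p)

/-- `H^p(𝔤, 𝔱; ℂ) = Ker d^p / Im d^{p-1}` (the quotient of `Ker d^p` by the coboundaries in it). -/
abbrev RelCohomology (𝔤 : LieSuperalgebra L) (𝔱 : 𝔤.Sub) (p : ℕ) : Type _ :=
  ↥(𝔤.relCocycle 𝔱 p) ⧸ (𝔤.relCoboundary 𝔱 p).submoduleOf (𝔤.relCocycle 𝔱 p)

/-- The class `[φ] ∈ H^p(𝔤, 𝔱; ℂ)`, as an element of `H^•(𝔤, 𝔱; ℂ) = ⨁_p H^p(𝔤, 𝔱; ℂ)`. -/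
def cohomClass (𝔤 : LieSuperalgebra L) (𝔱 : 𝔤.Sub) {p : ℕ} (φ : Form L p)
    (hφ : φ ∈ 𝔤.relCocycle 𝔱 p) : ⨁ p, 𝔤.RelCohomology 𝔱 p :=
  DirectSum.lof ℂ ℕ (fun p => 𝔤.RelCohomology 𝔱 p) p (Submodule.Quotient.mk ⟨φ, hφ⟩)

/-- The exponent (mod 2) of the sign of the shuffle which moves the arguments with positions in
`S` to the front (keeping the order inside `S` and inside its complement), for arguments of
parities `e`: each transposition of `x` and `y` contributes `-(-1)^{|x||y|}`. -/
def shuffleExponent {m : ℕ} (e : Fin m → ZMod 2) (S : Finset (Fin m)) : ZMod 2 :=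
  ∑ s ∈ S, ∑ t ∈ Sᶜ.filter (· < s), (1 + e s * e t)

theorem card_compl_of_card {p q : ℕ} {S : Finset (Fin (p + q))} (hS : S.card = p) :
    Sᶜ.card = q := by
  rw [Finset.card_compl, Fintype.card_fin, hS, Nat.add_sub_cancel_left]

/-- The form `x ↦ φ (x_s : s ∈ S) * ψ (x_t : t ∉ S)`, arguments in increasing order of position. -/
def splitTerm {p q : ℕ} (φ : Form L p) (ψ : Form L q) (S : Finset (Fin (p + q)))
    (hS : S.card = p) : Form L (p + q) :=
  ((LinearMap.mul' ℂ ℂ).compMultilinearMap (φ.domCoprod ψ)).domDomCongr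
    (finSumEquivOfFinset hS (card_compl_of_card hS))

theorem splitTerm_apply {p q : ℕ} (φ : Form L p) (ψ : Form L q) (S : Finset (Fin (p + q)))
    (hS : S.card = p) (x : Fin (p + q) → L) :
    splitTerm φ ψ S hS x = φ (fun k => x (S.orderEmbOfFin hS k)) *
      ψ (fun k => x (Sᶜ.orderEmbOfFin (card_compl_of_card hS) k)) := by
  rfl

/-- The cup product of cochains: the product of `Hom(Λ_s^•(𝔤), ℂ)` dual to the coproduct of
`Λ_s^•(𝔤)`, i.e. the signed sum over all `(p, q)`-shuffles. As for `d`, only the summand for the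
parities of the arguments contributes on homogeneous arguments, see `cup_apply`. -/
def cup (𝔤 : LieSuperalgebra L) {p q : ℕ} (φ : Form L p) (ψ : Form L q) : Form L (p + q) :=
  ∑ e : Fin (p + q) → ZMod 2, 𝔤.homPart e
    (∑ S : {S : Finset (Fin (p + q)) // S.card = p},
      superSign (shuffleExponent e S.1) • splitTerm φ ψ S.1 S.2)

theorem cup_apply (𝔤 : LieSuperalgebra L) {p q : ℕ} (φ : Form L p) (ψ : Form L q)
    {x : Fin (p + q) → L} {e : Fin (p + q) → ZMod 2} (hx : ∀ i, x i ∈ 𝔤.part (e i)) :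
    𝔤.cup φ ψ x = ∑ S : {S : Finset (Fin (p + q)) // S.card = p},
      superSign (shuffleExponent e S.1) * (φ (fun k => x (S.1.orderEmbOfFin S.2 k)) *
        ψ (fun k => x (S.1ᶜ.orderEmbOfFin (card_compl_of_card S.2) k))) := by
  simp only [cup, sum_apply, 𝔤.homPart_apply_of_mem _ hx]
  rw [Finset.sum_ite_eq' Finset.univ e, if_pos (Finset.mem_univ _)]
  simp only [smul_apply, smul_eq_mul, splitTerm_apply]

/-- The `0`-cochain `1`, the unit of the cup product. -/
def oneForm (L : Type*) [AddCommGroup L] [Module ℂ L] : Form L 0 :=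
  MultilinearMap.constOfIsEmpty ℂ (fun _ : Fin 0 => L) 1

theorem oneForm_mem (𝔤 : LieSuperalgebra L) (𝔱 : 𝔤.Sub) : oneForm L ∈ 𝔤.relCocycle 𝔱 0 := by
  refine ⟨⟨fun e x hx i => i.elim0, fun x ⟨i, _⟩ => i.elim0, fun a z _ _ e x _ => by simp⟩, ?_⟩
  simp [d]

end LieSuperalgebra

/-! ### The Lie superalgebra `W(n)` -/

/-- The exterior algebra `Λ(n)` of `V = ℂⁿ`. -/
abbrev Lam (n : ℕ) : Type := ExteriorAlgebra ℂ (Fin n → ℂ)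

/-- The homogeneous part `Λ^k(n)` for `k ∈ ℤ` (zero for `k < 0`). -/
def lamDeg (n : ℕ) : ℤ → Submodule ℂ (Lam n)
  | Int.ofNat k => ⋀[ℂ]^k (Fin n → ℂ)
  | Int.negSucc _ => ⊥

/-- The part `Λ(n)_a = ⨁_{k ≡ a mod 2} Λ^k(n)` for `a ∈ ℤ/2`. -/
def lamPart (n : ℕ) (a : ZMod 2) : Submodule ℂ (Lam n) :=
  ⨆ k : {k : ℕ // (k : ZMod 2) = a}, ⋀[ℂ]^(k : ℕ) (Fin n → ℂ)

theorem lamPart_eq (n : ℕ) (a : ZMod 2) :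
    lamPart n a = CliffordAlgebra.evenOdd (0 : QuadraticForm ℂ (Fin n → ℂ)) a := rfl

theorem lamPart_isCompl (n : ℕ) : IsCompl (lamPart n 0) (lamPart n 1) :=
  CliffordAlgebra.evenOdd_isCompl _

theorem lamPart_mul {n : ℕ} {a b : ZMod 2} {x y : Lam n} (hx : x ∈ lamPart n a)
    (hy : y ∈ lamPart n b) : x * y ∈ lamPart n (a + b) :=
  CliffordAlgebra.evenOdd_mul_le _ a b (Submodule.mul_mem_mul hx hy)

theorem exists_lamPart_add {n : ℕ} (x : Lam n) :
    ∃ y ∈ lamPart n 0, ∃ z ∈ lamPart n 1, y + z = x :=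
  Submodule.mem_sup.1 ((lamPart_isCompl n).sup_eq_top ▸ Submodule.mem_top)

/-- The superderivations of `Λ(n)` of parity `a`: the linear maps `D` with
`D(Λ(n)_b) ⊆ Λ(n)_{a+b}` and `D(xy) = D(x)y + (-1)^{a|x|} x D(y)` for homogeneous `x`, `y`. -/
def superDer (n : ℕ) (a : ZMod 2) : Submodule ℂ (Module.End ℂ (Lam n)) where
  carrier := {D | (∀ b, ∀ x ∈ lamPart n b, D x ∈ lamPart n (a + b)) ∧
    ∀ b, ∀ x ∈ lamPart n b, ∀ c, ∀ y ∈ lamPart n c,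
      D (x * y) = D x * y + superSign (a * b) • (x * D y)}
  add_mem' := by
    rintro D E ⟨h1, h2⟩ ⟨k1, k2⟩
    refine ⟨fun b x hx => add_mem (h1 b x hx) (k1 b x hx), fun b x hx c y hy => ?_⟩
    simp only [LinearMap.add_apply, h2 b x hx c y hy, k2 b x hx c y hy, add_mul, mul_add, smul_add]
    abel
  zero_mem' := by simp
  smul_mem' := by
    rintro r D ⟨h1, h2⟩
    refine ⟨fun b x hx => Submodule.smul_mem _ _ (h1 b x hx), fun b x hx c y hy => ?_⟩
    simp only [LinearMap.smul_apply, h2 b x hx c y hy, smul_add, smul_mul_assoc, mul_smul_comm]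
    rw [smul_comm r]

/-- The space `W(n)` of all superderivations of `Λ(n)`: the sums of an even and an odd one. -/
def W (n : ℕ) : Submodule ℂ (Module.End ℂ (Lam n)) := superDer n 0 ⊔ superDer n 1

theorem superDer_le_W (n : ℕ) (a : ZMod 2) : superDer n a ≤ W n := by
  rcases zmod2_cases a with rfl | rfl
  · exact le_sup_left
  · exact le_sup_right

namespace W

/-- The part `W(n)_a` of parity `a ∈ ℤ/2`. -/
def part (n : ℕ) (a : ZMod 2) : Submodule ℂ (W n) := (superDer n a).submoduleOf (W n)

theorem part_isCompl (n : ℕ) : IsCompl (part n 0) (part n 1) := by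
  refine IsCompl.of_eq ?_ ?_
  · refine (Submodule.eq_bot_iff _).2 fun D hD => Subtype.ext (LinearMap.ext fun x => ?_)
    obtain ⟨h0, h1⟩ : D.1 ∈ superDer n 0 ∧ D.1 ∈ superDer n 1 := hD
    have key : ∀ b, ∀ x ∈ lamPart n b, D.1 x = 0 := fun b x hx => by
      have e0 := h0.1 b x hx
      have e1 := h1.1 b x hx
      have := Submodule.disjoint_def.1 (lamPart_isCompl n).disjoint (D.1 x)
      rcases zmod2_cases b with rfl | rfl
      · exact this (by simpa using e0) (by simpa using e1)
      · exact this (by simpa [zmod2_one_add_one] using e1) (by simpa using e0)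
    obtain ⟨y, hy, z, hz, rfl⟩ := exists_lamPart_add x
    simp [key 0 y hy, key 1 z hz]
  · refine (Submodule.eq_top_iff').2 fun D => ?_
    obtain ⟨D0, h0, D1, h1, h⟩ := Submodule.mem_sup.1 D.2
    exact Submodule.mem_sup.2 ⟨⟨D0, superDer_le_W n 0 h0⟩, h0, ⟨D1, superDer_le_W n 1 h1⟩, h1,
      Subtype.ext h⟩

theorem superCommutator_mem {n : ℕ} {a b : ZMod 2} {D E : Module.End ℂ (Lam n)}
    (hD : D ∈ superDer n a) (hE : E ∈ superDer n b) :
    D * E - superSign (a * b) • (E * D) ∈ superDer n (a + b) := by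
  refine ⟨fun c x hx => ?_, fun c x hx c' y hy => ?_⟩
  · refine sub_mem ?_ (Submodule.smul_mem _ _ ?_)
    · rw [add_assoc]
      exact hD.1 _ _ (hE.1 _ _ hx)
    · rw [add_comm a b, add_assoc]
      exact hE.1 _ _ (hD.1 _ _ hx)
  · simp only [LinearMap.sub_apply, LinearMap.smul_apply, Module.End.mul_apply,
      hD.2 c x hx c' y hy, hE.2 c x hx c' y hy, map_add, map_smul,
      hD.2 _ _ (hE.1 c x hx) c' y hy, hE.2 _ _ (hD.1 c x hx) c' y hy,
      hD.2 c x hx _ _ (hE.1 c' y hy), hE.2 c x hx _ _ (hD.1 c' y hy)]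
    rcases zmod2_cases a with rfl | rfl <;> rcases zmod2_cases b with rfl | rfl <;>
      rcases zmod2_cases c with rfl | rfl <;>
      simp only [superSign_zero, superSign_one, zmod2_one_add_one, mul_zero, mul_one,
        add_zero, zero_add, sub_mul, mul_sub, smul_mul_assoc, mul_smul_comm, smul_add, smul_sub] <;>
      module

/-- The supercommutator `[D, E] = ∑_{a,b} (D_a E_b - (-1)^{ab} E_b D_a)`. -/
def bracket (n : ℕ) : W n →ₗ[ℂ] W n →ₗ[ℂ] W n :=
  LinearMap.mk₂ ℂ
    (fun D E => ⟨∑ a : ZMod 2, ∑ b : ZMod 2,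
      ((parityProj (part n) (part_isCompl n) a D).1 * (parityProj (part n) (part_isCompl n) b E).1 -
        superSign (a * b) • ((parityProj (part n) (part_isCompl n) b E).1 *
          (parityProj (part n) (part_isCompl n) a D).1)),
      sum_mem fun a _ => sum_mem fun b _ => superDer_le_W n (a + b)
        (superCommutator_mem (parityProj_mem (part_isCompl n) a D)
          (parityProj_mem (part_isCompl n) b E))⟩)
    (fun D D' E => Subtype.ext (by
      simp only [map_add, Submodule.coe_add, add_mul, mul_add, smul_add,
        ← Finset.sum_add_distrib]
      exact Finset.sum_congr rfl fun a _ => Finset.sum_congr rfl fun b _ => by abel))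
    (fun r D E => Subtype.ext (by
      simp only [map_smul, Submodule.coe_smul, smul_mul_assoc, mul_smul_comm, Finset.smul_sum,
        smul_sub]
      exact Finset.sum_congr rfl fun a _ => Finset.sum_congr rfl fun b _ => by
        rw [smul_comm r]))
    (fun D E E' => Subtype.ext (by
      simp only [map_add, Submodule.coe_add, add_mul, mul_add, smul_add,
        ← Finset.sum_add_distrib]
      exact Finset.sum_congr rfl fun a _ => Finset.sum_congr rfl fun b _ => by abel))
    (fun r D E => Subtype.ext (by
      simp only [map_smul, Submodule.coe_smul, smul_mul_assoc, mul_smul_comm, Finset.smul_sum,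
        smul_sub]
      exact Finset.sum_congr rfl fun a _ => Finset.sum_congr rfl fun b _ => by
        rw [smul_comm r]))

theorem bracket_of_mem {n : ℕ} {a b : ZMod 2} {D E : W n} (hD : D ∈ part n a)
    (hE : E ∈ part n b) :
    (bracket n D E).1 = D.1 * E.1 - superSign (a * b) • (E.1 * D.1) := by
  have h : (bracket n D E).1 = ∑ a : ZMod 2, ∑ b : ZMod 2,
      ((parityProj (part n) (part_isCompl n) a D).1 * (parityProj (part n) (part_isCompl n) b E).1 -
        superSign (a * b) • ((parityProj (part n) (part_isCompl n) b E).1 *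
          (parityProj (part n) (part_isCompl n) a D).1)) := rfl
  have hD' := parityProj_of_mem (L := W n) (part := part n) (part_isCompl n) (a := a) (x := D) hD
  have hE' := parityProj_of_mem (L := W n) (part := part n) (part_isCompl n) (a := b) (x := E) hE
  rw [h, Finset.sum_eq_single a, Finset.sum_eq_single b]
  · rw [hD', hE', if_pos rfl, if_pos rfl]
  · intro c _ hc
    rw [hE', if_neg hc, Submodule.coe_zero, mul_zero, zero_mul, smul_zero, sub_zero]
  · exact fun hb => absurd (Finset.mem_univ _) hb
  · intro c _ hc
    refine Finset.sum_eq_zero fun c' _ => ?_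
    rw [hD', if_neg hc, Submodule.coe_zero, mul_zero, zero_mul, smul_zero, sub_zero]
  · exact fun hb => absurd (Finset.mem_univ _) hb

theorem bracket_mem_part {n : ℕ} {a b : ZMod 2} {D E : W n} (hD : D ∈ part n a)
    (hE : E ∈ part n b) : bracket n D E ∈ part n (a + b) := by
  change (bracket n D E).1 ∈ superDer n (a + b)
  rw [bracket_of_mem hD hE]
  exact superCommutator_mem hD hE

/-- `W(n)` as a Lie superalgebra. -/
def lieSuperalgebra (n : ℕ) : LieSuperalgebra (W n) where
  part := part n
  isCompl := part_isCompl n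
  bracket := bracket n
  bracket_mem := bracket_mem_part
  bracket_skew := fun {a b x y} hx hy => Subtype.ext (by
    rw [Submodule.coe_neg, Submodule.coe_smul, bracket_of_mem hx hy, bracket_of_mem hy hx]
    rcases zmod2_cases a with rfl | rfl <;> rcases zmod2_cases b with rfl | rfl <;>
      simp only [superSign_zero, superSign_one, mul_zero, mul_one] <;> module)
  jacobi := fun {a b c x y z} hx hy hz => Subtype.ext (by
    rw [Submodule.coe_add, Submodule.coe_smul, bracket_of_mem hx (bracket_mem_part hy hz),
      bracket_of_mem hy hz, bracket_of_mem (bracket_mem_part hx hy) hz, bracket_of_mem hx hy,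
      bracket_of_mem hy (bracket_mem_part hx hz), bracket_of_mem hx hz]
    rcases zmod2_cases a with rfl | rfl <;> rcases zmod2_cases b with rfl | rfl <;>
      rcases zmod2_cases c with rfl | rfl <;>
      simp only [superSign_zero, superSign_one, zmod2_one_add_one, mul_zero, mul_one,
        add_zero, zero_add, sub_mul, mul_sub, smul_mul_assoc, mul_smul_comm, smul_sub,
        mul_assoc] <;>
      module)

/-- The homogeneous part `W(n)_k`, `k ∈ ℤ`: the superderivations `D` (of parity `k mod 2`) with
`D(Λ^j(n)) ⊆ Λ^{k+j}(n)` for all `j`. -/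
def deg (n : ℕ) (k : ℤ) : Submodule ℂ (W n) where
  carrier := {D | D ∈ part n (k : ZMod 2) ∧ ∀ j : ℤ, ∀ x ∈ lamDeg n j, D.1 x ∈ lamDeg n (k + j)}
  add_mem' := fun h h' =>
    ⟨add_mem h.1 h'.1, fun j x hx => add_mem (h.2 j x hx) (h'.2 j x hx)⟩
  zero_mem' := ⟨zero_mem _, fun _ _ _ => zero_mem _⟩
  smul_mem' := fun r _ h =>
    ⟨Submodule.smul_mem _ r h.1, fun j x hx => Submodule.smul_mem _ r (h.2 j x hx)⟩

theorem bracket_mem_deg {n : ℕ} {k l : ℤ} {D E : W n} (hD : D ∈ deg n k) (hE : E ∈ deg n l) :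
    bracket n D E ∈ deg n (k + l) := by
  refine ⟨by rw [Int.cast_add]; exact bracket_mem_part hD.1 hE.1, fun j x hx => ?_⟩
  rw [bracket_of_mem hD.1 hE.1]
  refine sub_mem ?_ (Submodule.smul_mem _ _ ?_)
  · rw [add_assoc]
    exact hD.2 _ _ (hE.2 _ _ hx)
  · rw [add_comm k l, add_assoc]
    exact hE.2 _ _ (hD.2 _ _ hx)

/-- The subalgebra `𝔤₀ = W(n)₀` of `𝔤 = W(n)`, the part of `ℤ`-degree zero. -/
def degZero (n : ℕ) : (lieSuperalgebra n).Sub where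
  carrier := deg n 0
  proj_mem := fun a x hx => by
    have h : (lieSuperalgebra n).proj a x = if a = ((0 : ℤ) : ZMod 2) then x else 0 :=
      parityProj_of_mem (part_isCompl n) hx.1 a
    rw [h]
    split_ifs
    · exact hx
    · exact zero_mem _
  bracket_mem := fun hx hy => by
    have h := bracket_mem_deg hx hy
    rw [add_zero] at h
    exact h

/-- The space `𝔤₋₁ ⊕ 𝔤₁`. -/
def degPM (n : ℕ) : Submodule ℂ (W n) := deg n (-1) ⊔ deg n 1

/-! ### The actions of `𝔤₀` and `G₀ = GL(n)` on `S((𝔤₋₁ ⊕ 𝔤₁)^*)` -/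

theorem bracket_mem_degPM {n : ℕ} {z x : W n} (hz : z ∈ deg n 0) (hx : x ∈ degPM n) :
    bracket n z x ∈ degPM n := by
  obtain ⟨y, hy, y', hy', rfl⟩ := Submodule.mem_sup.1 hx
  rw [map_add]
  exact Submodule.add_mem_sup (by simpa using bracket_mem_deg hz hy)
    (by simpa using bracket_mem_deg hz hy')

/-- The adjoint action of `z ∈ 𝔤₀` on `𝔤₋₁ ⊕ 𝔤₁`. -/
def adPM (n : ℕ) (z : deg n 0) : degPM n →ₗ[ℂ] degPM n :=
  (bracket n z.1).restrict fun _ hx => bracket_mem_degPM z.2 hx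

/-- The automorphism `Λ(A)` of `Λ(n)` induced by `A ∈ GL(n)`. -/
def lamMap {n : ℕ} (A : LinearMap.GeneralLinearGroup ℂ (Fin n → ℂ)) : Module.End ℂ (Lam n) :=
  (ExteriorAlgebra.map (A : (Fin n → ℂ) →ₗ[ℂ] (Fin n → ℂ))).toLinearMap

theorem lamMap_mul {n : ℕ} (A : LinearMap.GeneralLinearGroup ℂ (Fin n → ℂ)) (x y : Lam n) :
    lamMap A (x * y) = lamMap A x * lamMap A y :=
  map_mul (ExteriorAlgebra.map (A : (Fin n → ℂ) →ₗ[ℂ] (Fin n → ℂ))) x y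

theorem lamMap_lamMap_inv {n : ℕ} (A : LinearMap.GeneralLinearGroup ℂ (Fin n → ℂ)) (x : Lam n) :
    lamMap A (lamMap A⁻¹ x) = x := by
  have h : (A : (Fin n → ℂ) →ₗ[ℂ] (Fin n → ℂ)) ∘ₗ
      (A⁻¹ : LinearMap.GeneralLinearGroup ℂ (Fin n → ℂ)) = LinearMap.id := A.mul_inv
  have := congrArg (fun f => f x) (ExteriorAlgebra.map_comp_map
    ((A⁻¹ : LinearMap.GeneralLinearGroup ℂ (Fin n → ℂ)) : (Fin n → ℂ) →ₗ[ℂ] (Fin n → ℂ))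
    (A : (Fin n → ℂ) →ₗ[ℂ] (Fin n → ℂ)))
  rw [h, ExteriorAlgebra.map_id] at this
  exact this

theorem lamMap_mem_pow {n : ℕ} (A : LinearMap.GeneralLinearGroup ℂ (Fin n → ℂ)) {k : ℕ}
    {x : Lam n} (hx : x ∈ ⋀[ℂ]^k (Fin n → ℂ)) : lamMap A x ∈ ⋀[ℂ]^k (Fin n → ℂ) := by
  have h : (⋀[ℂ]^k (Fin n → ℂ)).map (lamMap A) ≤ ⋀[ℂ]^k (Fin n → ℂ) := by
    change Submodule.map _ (LinearMap.range (ExteriorAlgebra.ι ℂ) ^ k) ≤ _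
    rw [lamMap, Submodule.map_pow]
    refine pow_le_pow_left' ?_ k
    rintro _ ⟨_, ⟨v, rfl⟩, rfl⟩
    exact ⟨(A : (Fin n → ℂ) →ₗ[ℂ] (Fin n → ℂ)) v, (ExteriorAlgebra.map_apply_ι _ v).symm⟩
  exact h ⟨x, hx, rfl⟩

theorem lamMap_mem_lamDeg {n : ℕ} (A : LinearMap.GeneralLinearGroup ℂ (Fin n → ℂ)) {k : ℤ}
    {x : Lam n} (hx : x ∈ lamDeg n k) : lamMap A x ∈ lamDeg n k := by
  cases k with
  | ofNat k => exact lamMap_mem_pow A hx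
  | negSucc k =>
    have h0 : x = 0 := hx
    rw [h0, map_zero]
    exact zero_mem _

theorem lamMap_mem_lamPart {n : ℕ} (A : LinearMap.GeneralLinearGroup ℂ (Fin n → ℂ)) {a : ZMod 2}
    {x : Lam n} (hx : x ∈ lamPart n a) : lamMap A x ∈ lamPart n a := by
  have h : lamPart n a ≤ (lamPart n a).comap (lamMap A) :=
    iSup_le fun k y hy => Submodule.mem_iSup_of_mem k (lamMap_mem_pow A hy)
  exact h hx

theorem conj_mem_superDer {n : ℕ} (A : LinearMap.GeneralLinearGroup ℂ (Fin n → ℂ)) {a : ZMod 2}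
    {D : Module.End ℂ (Lam n)} (hD : D ∈ superDer n a) :
    lamMap A * D * lamMap A⁻¹ ∈ superDer n a := by
  refine ⟨fun b x hx => lamMap_mem_lamPart A (hD.1 b _ (lamMap_mem_lamPart A⁻¹ hx)),
    fun b x hx c y hy => ?_⟩
  simp only [Module.End.mul_apply, lamMap_mul,
    hD.2 b _ (lamMap_mem_lamPart A⁻¹ hx) c _ (lamMap_mem_lamPart A⁻¹ hy), map_add, map_smul,
    lamMap_lamMap_inv]

theorem conj_mem_W {n : ℕ} (A : LinearMap.GeneralLinearGroup ℂ (Fin n → ℂ))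
    {D : Module.End ℂ (Lam n)} (hD : D ∈ W n) : lamMap A * D * lamMap A⁻¹ ∈ W n := by
  obtain ⟨E, hE, F, hF, rfl⟩ := Submodule.mem_sup.1 hD
  rw [mul_add, add_mul]
  exact Submodule.add_mem_sup (conj_mem_superDer A hE) (conj_mem_superDer A hF)

/-- The adjoint action of `A ∈ G₀ = GL(n)` on `W(n)`: `D ↦ Λ(A) D Λ(A)⁻¹`. Its differential is
the adjoint action of `𝔤₀ = 𝔤𝔩(n)`. -/
def Ad {n : ℕ} (A : LinearMap.GeneralLinearGroup ℂ (Fin n → ℂ)) : W n →ₗ[ℂ] W n where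
  toFun D := ⟨lamMap A * D.1 * lamMap A⁻¹, conj_mem_W A D.2⟩
  map_add' D E := Subtype.ext (by simp [mul_add, add_mul])
  map_smul' r D := Subtype.ext (by simp)

theorem Ad_mem_deg {n : ℕ} (A : LinearMap.GeneralLinearGroup ℂ (Fin n → ℂ)) {k : ℤ} {D : W n}
    (hD : D ∈ deg n k) : Ad A D ∈ deg n k :=
  ⟨conj_mem_superDer A hD.1, fun j _ hx =>
    lamMap_mem_lamDeg A (hD.2 j _ (lamMap_mem_lamDeg A⁻¹ hx))⟩

theorem Ad_mem_degPM {n : ℕ} (A : LinearMap.GeneralLinearGroup ℂ (Fin n → ℂ)) {D : W n}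
    (hD : D ∈ degPM n) : Ad A D ∈ degPM n := by
  obtain ⟨y, hy, y', hy', rfl⟩ := Submodule.mem_sup.1 hD
  rw [map_add]
  exact Submodule.add_mem_sup (Ad_mem_deg A hy) (Ad_mem_deg A hy')

/-- The adjoint action of `A ∈ G₀` on `𝔤₋₁ ⊕ 𝔤₁`. -/
def AdPM {n : ℕ} (A : LinearMap.GeneralLinearGroup ℂ (Fin n → ℂ)) : degPM n →ₗ[ℂ] degPM n :=
  (Ad A).restrict fun _ hx => Ad_mem_degPM A hx

end W

section SymmetricAlgebra

variable {M : Type*} [AddCommGroup M] [Module ℂ M]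

/-- The algebra endomorphism of `S(M)` extending `f : M → M`. -/
def symMap (f : M →ₗ[ℂ] M) : SymmetricAlgebra ℂ M →ₐ[ℂ] SymmetricAlgebra ℂ M :=
  SymmetricAlgebra.lift (SymmetricAlgebra.ι ℂ M ∘ₗ f)

/-- The algebra map `S(M) → S(M)[ε]`, `ε² = 0`, with `m ↦ m + ε f(m)` for `m ∈ M`. -/
def symDual (f : M →ₗ[ℂ] M) :
    SymmetricAlgebra ℂ M →ₐ[ℂ] TrivSqZeroExt (SymmetricAlgebra ℂ M) (SymmetricAlgebra ℂ M) :=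
  SymmetricAlgebra.lift
    ((TrivSqZeroExt.inlAlgHom ℂ (SymmetricAlgebra ℂ M) (SymmetricAlgebra ℂ M)).toLinearMap ∘ₗ
        SymmetricAlgebra.ι ℂ M +
      (TrivSqZeroExt.inrHom (SymmetricAlgebra ℂ M) (SymmetricAlgebra ℂ M)).restrictScalars ℂ ∘ₗ
        SymmetricAlgebra.ι ℂ M ∘ₗ f)

theorem symDual_fst (f : M →ₗ[ℂ] M) (x : SymmetricAlgebra ℂ M) : (symDual f x).fst = x := by
  have h : (TrivSqZeroExt.fstHom ℂ (SymmetricAlgebra ℂ M) (SymmetricAlgebra ℂ M)).comp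
      (symDual f) = AlgHom.id ℂ _ := by
    refine SymmetricAlgebra.algHom_ext (LinearMap.ext fun m => ?_)
    simp [symDual]
  exact congrArg (fun g => g x) h

/-- The derivation of `S(M)` extending `f : M → M` (see `symDer_ι`). -/
def symDer (f : M →ₗ[ℂ] M) :
    Derivation ℂ (SymmetricAlgebra ℂ M) (SymmetricAlgebra ℂ M) where
  toFun x := (symDual f x).snd
  map_add' x y := by simp
  map_smul' c x := by simp
  map_one_eq_zero' := by simp
  leibniz' x y := by simp [symDual_fst, mul_comm]

theorem symDer_ι (f : M →ₗ[ℂ] M) (m : M) :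
    symDer f (SymmetricAlgebra.ι ℂ M m) = SymmetricAlgebra.ι ℂ M (f m) := by
  change (symDual f (SymmetricAlgebra.ι ℂ M m)).snd = _
  simp [symDual]

/-- The elements of `S(M)` killed by the derivations extending the maps `f i : M → M`. -/
def symDerInvariants {I : Type*} (f : I → M →ₗ[ℂ] M) : Subalgebra ℂ (SymmetricAlgebra ℂ M) where
  carrier := {s | ∀ i, symDer (f i) s = 0}
  mul_mem' := fun hs ht i => by simp [hs i, ht i]
  add_mem' := fun hs ht i => by simp [hs i, ht i]
  algebraMap_mem' := fun r i => by simp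

/-- The elements of `S(M)` fixed by the algebra maps extending the maps `f i : M → M`. -/
def symMapInvariants {I : Type*} (f : I → M →ₗ[ℂ] M) : Subalgebra ℂ (SymmetricAlgebra ℂ M) where
  carrier := {s | ∀ i, symMap (f i) s = s}
  mul_mem' := fun hs ht i => by rw [map_mul, hs i, ht i]
  add_mem' := fun hs ht i => by rw [map_add, hs i, ht i]
  algebraMap_mem' := fun r i => by simp

end SymmetricAlgebra

namespace W

/-- The algebra `S((𝔤₋₁ ⊕ 𝔤₁)^*)`. -/
abbrev SymPM (n : ℕ) : Type := SymmetricAlgebra ℂ (Module.Dual ℂ (degPM n))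

/-- The homogeneous part `S^p((𝔤₋₁ ⊕ 𝔤₁)^*)`, spanned by the products of `p` linear forms. -/
def symDeg (n p : ℕ) : Submodule ℂ (SymPM n) :=
  LinearMap.range (SymmetricAlgebra.ι ℂ (Module.Dual ℂ (degPM n))) ^ p

/-- `S((𝔤₋₁ ⊕ 𝔤₁)^*)^{𝔤₀}`, where `z ∈ 𝔤₀` acts on the dual space by `(z·f)(x) = -f([z, x])` and on
the symmetric algebra by the derivation extending this. -/
def lieInvariants (n : ℕ) : Subalgebra ℂ (SymPM n) :=
  symDerInvariants fun z : deg n 0 => -(adPM n z).dualMap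

/-- `S((𝔤₋₁ ⊕ 𝔤₁)^*)^{G₀}`, where `A ∈ G₀ = GL(n)` acts on the dual space by
`(A·f)(x) = f(A⁻¹·x)` and on the symmetric algebra by the algebra map extending this. -/
def groupInvariants (n : ℕ) : Subalgebra ℂ (SymPM n) :=
  symMapInvariants fun A : LinearMap.GeneralLinearGroup ℂ (Fin n → ℂ) => (AdPM A⁻¹).dualMap

end W

end

/-!
Why the theorem is true. Let `E` be the Euler field, whose adjoint eigenspaces are the `𝔤_k`, and
for `v(u) = 1` let `H = u · contr v`, a rank one idempotent of `𝔤₀ = 𝔤𝔩(n)`. Its adjoint action has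
the weights `1`, `-1`, `0`, and so `T = H - E` acts on `𝔤_k` with weights at most `1 - k`. The
arguments of a nonvanishing value of a `𝔤₀`-invariant cochain `φ` on weight vectors have weights
with sum `0`.

*Support of the cochains.* A super-alternating form is symmetric in its odd arguments, so by
polarization all arguments of degree `-1` may be assumed equal to one element `y`. As `y` is a
multiple of a contraction, some `T` as above kills `y`. All other arguments of a relative cochain
have degree at least `1`, hence weight at most `0`, and negative weight if the degree exceeds `1`.
So `φ` is determined by its restriction to `𝔤₋₁ ⊕ 𝔤₁` (`W.relCochain_eq_zero`). This restriction is
a symmetric invariant form, and conversely every symmetric invariant form on `𝔤₋₁ ⊕ 𝔤₁` extends by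
zero to a relative cochain (`W.extend_mem_relCochain`).

*The differential.* A term `φ([x_i, x_j], …)` can only be nonzero if a single argument `D` has a
degree different from `±1`, namely `0` or `2`, and `D` enters the bracket. Up to a common sign, `dφ`
is then the action of `[·, D]` on a symmetric form. It vanishes by invariance in degree `0`. In
degree `2` it vanishes on the diagonal, again by weights: if `T` kills the degree `-1` part of `u`,
then `u` has weights at most `0` and `[u, D]` has weights at most `-1` (`W.d_eq_zero`).

*The ring.* Thus cohomology classes are the same as relative cochains, i.e. symmetric invariant
forms on `U = 𝔤₋₁ ⊕ 𝔤₁`. Elements of `S(U^*)` are determined by their values as polynomial functions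
(`symEval_injective`), and `F ↦ (u ↦ F(u, …, u) / p!)` identifies symmetric `p`-forms with `S^p(U^*)`
(`symOfForm`), equivariantly (`symDer_symOfForm`). On odd arguments there are no signs in the cup
product, and the factorials turn the sum over shuffles into the product (`symOfForm_shuffle`).

*The group.* For `t ≠ 0` the element `A_t = 1 + (t - 1) u ⊗ v` of `GL(n)` acts as `t ^ w` on vectors
of weight `w` for `H`. Hence an element of `S(U^*)` killed by `H` is fixed by all `A_t`, and one fixed
by `A_2` is killed by `H`, as the numbers `2 ^ w` are distinct. The elements `A_t` generate `GL(n)`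
(`GL_induction`), and the idempotents `H` span `𝔤₀` (`W.mem_span_rankOne`).
-/

/-! ### Symmetric multilinear forms and polarization -/

section Polarization

variable {ι : Type*} {U : Type*} [AddCommMonoid U] [Module ℂ U]

/-- A multilinear form is symmetric if it is unchanged by permutations of its arguments. -/
def IsSymmForm (F : MultilinearMap ℂ (fun _ : ι => U) ℂ) : Prop :=
  ∀ (σ : Equiv.Perm ι) (x : ι → U), F (x ∘ σ) = F x

theorem isSymmForm_of_swap [Finite ι] [DecidableEq ι] {F : MultilinearMap ℂ (fun _ : ι => U) ℂ}
    (h : ∀ (i j : ι) (x : ι → U), F (x ∘ Equiv.swap i j) = F x) : IsSymmForm F := by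
  intro σ
  induction σ using Equiv.Perm.swap_induction_on with
  | one => intro x; rfl
  | swap_mul f a b _ ih =>
    intro x
    rw [Equiv.Perm.coe_mul, ← Function.comp_assoc, ih, h]

/-- The alternating sum over all subsets `{j | ε j}` of the indicators that the subset contains
the range of `r`: only the full set contributes if `r` is onto. -/
theorem sum_sign_prod_ite [Fintype ι] [DecidableEq ι] (r : ι → ι) :
    ∑ ε : ι → Bool, (∏ j, if ε j then (1 : ℂ) else -1) * ∏ i, (if ε (r i) then (1 : ℂ) else 0) =
      if Function.Bijective r then 1 else 0 := by
  split_ifs with hr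
  · have h : ∀ ε : ι → Bool, ∏ i, (if ε (r i) then (1 : ℂ) else 0) =
        ∏ i, (if ε i then (1 : ℂ) else 0) :=
      fun ε => (Equiv.ofBijective r hr).prod_comp fun i => if ε i then (1 : ℂ) else 0
    simp only [h, ← Finset.prod_mul_distrib]
    rw [Finset.sum_eq_single fun _ => true]
    · simp
    · intro ε _ hε
      obtain ⟨j, hj⟩ := Function.ne_iff.1 hε
      exact Finset.prod_eq_zero (Finset.mem_univ j) (by simp at hj; simp [hj])
    · simp
  · have hs : ¬ Function.Surjective r := fun h =>
      hr (Finite.injective_iff_surjective.2 h).bijective_of_finite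
    simp only [Function.Surjective, not_forall, not_exists] at hs
    obtain ⟨j, hj⟩ := hs
    -- flipping the membership of an element outside the range of `r` changes the sign
    refine Finset.sum_involution (fun ε _ => Function.update ε j (!ε j)) ?_ ?_ ?_ ?_
    · intro ε _
      have h1 : ∏ i, (if Function.update ε j (!ε j) (r i) then (1 : ℂ) else 0) =
          ∏ i, (if ε (r i) then (1 : ℂ) else 0) :=
        Finset.prod_congr rfl fun i _ => by rw [Function.update_of_ne (hj i)]
      have h2 : ∏ i, (if Function.update ε j (!ε j) i then (1 : ℂ) else -1) =
          -∏ i, (if ε i then (1 : ℂ) else -1) := by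
        rw [← Finset.mul_prod_erase _ _ (Finset.mem_univ j),
          ← Finset.mul_prod_erase _ (fun i => if ε i then (1 : ℂ) else -1) (Finset.mem_univ j),
          ← neg_mul]
        congr 1
        · cases ε j <;> simp
        · exact Finset.prod_congr rfl fun i hi => by
            rw [Function.update_of_ne (Finset.ne_of_mem_erase hi)]
      rw [h1, h2]; ring
    · intro ε _ _ h
      have := congrFun h j
      simp at this
    · intro ε _; exact Finset.mem_univ _
    · intro ε _; simp

/-- Polarization: a symmetric form which vanishes on the diagonal is zero. -/
theorem IsSymmForm.eq_zero_of_diag [Fintype ι] {F : MultilinearMap ℂ (fun _ : ι => U) ℂ}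
    (hF : IsSymmForm F) (h : ∀ u, F (fun _ => u) = 0) : F = 0 := by
  classical
  ext x
  -- the alternating sum of `F` on the diagonal at all partial sums of the `x j`; expanding it, only
  -- the terms in which every `x j` occurs survive
  have key : ∑ ε : ι → Bool, (∏ j, if ε j then (1 : ℂ) else -1) *
      F (fun _ => ∑ j, (if ε j then (1 : ℂ) else 0) • x j) =
      ∑ r : ι → ι, (if Function.Bijective r then F x else 0) := by
    simp only [F.map_sum, F.map_smul_univ, Finset.mul_sum]
    rw [Finset.sum_comm]
    refine Finset.sum_congr rfl fun r _ => ?_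
    simp only [smul_eq_mul, ← mul_assoc, ← Finset.sum_mul]
    rw [sum_sign_prod_ite]
    split_ifs with hr
    · rw [one_mul]; exact hF (Equiv.ofBijective r hr) x
    · rw [zero_mul]
  simp only [h, mul_zero, Finset.sum_const_zero] at key
  rw [← Finset.sum_filter, Finset.sum_const, nsmul_eq_mul] at key
  have hc : ((Finset.univ.filter fun r : ι → ι => Function.Bijective r).card : ℂ) ≠ 0 :=
    Nat.cast_ne_zero.2 (Finset.card_ne_zero_of_mem
      (Finset.mem_filter.2 ⟨Finset.mem_univ id, Function.bijective_id⟩))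
  exact (mul_eq_zero.1 key.symm).resolve_left hc

/-- The action of an endomorphism `A` on forms by derivations,
`x ↦ ∑ i, F (x₁, …, A x_i, …, x_p)`. -/
noncomputable def formDer [Fintype ι] [DecidableEq ι] (A : U →ₗ[ℂ] U)
    (F : MultilinearMap ℂ (fun _ : ι => U) ℂ) : MultilinearMap ℂ (fun _ : ι => U) ℂ :=
  ∑ i, F.compLinearMap (Function.update (fun _ => LinearMap.id) i A)

theorem formDer_apply [Fintype ι] [DecidableEq ι] (A : U →ₗ[ℂ] U)
    (F : MultilinearMap ℂ (fun _ : ι => U) ℂ) (x : ι → U) :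
    formDer A F x = ∑ i, F (Function.update x i (A (x i))) := by
  simp only [formDer, sum_apply, MultilinearMap.compLinearMap_apply]
  refine Finset.sum_congr rfl fun i _ => congrArg F (funext fun j => ?_)
  rcases eq_or_ne j i with rfl | h
  · simp
  · simp [h]

theorem IsSymmForm.formDer [Fintype ι] [DecidableEq ι]
    {F : MultilinearMap ℂ (fun _ : ι => U) ℂ} (hF : IsSymmForm F) (A : U →ₗ[ℂ] U) :
    IsSymmForm (formDer A F) := by
  intro σ x
  rw [formDer_apply, formDer_apply, ← Equiv.sum_comp σ fun i => F (Function.update x i (A (x i)))]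
  refine Finset.sum_congr rfl fun i _ => ?_
  rw [← hF σ (Function.update x (σ i) _)]
  congr 1
  funext j
  rcases eq_or_ne j i with rfl | h
  · simp
  · simp [h]

/-- A multilinear form which vanishes on tuples from `S i` vanishes on tuples from their spans. -/
theorem MultilinearMap.eq_zero_of_mem_span [Fintype ι] (F : MultilinearMap ℂ (fun _ : ι => U) ℂ)
    (S : ι → Set U) (h : ∀ x, (∀ i, x i ∈ S i) → F x = 0) (x : ι → U)
    (hx : ∀ i, x i ∈ Submodule.span ℂ (S i)) : F x = 0 := by
  classical
  have key : ∀ (A : Finset ι) (x : ι → U), (∀ i ∈ A, x i ∈ Submodule.span ℂ (S i)) →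
      (∀ i ∉ A, x i ∈ S i) → F x = 0 := by
    intro A
    induction A using Finset.induction_on with
    | empty => exact fun x _ hx => h x fun i => hx i (by simp)
    | insert a A ha ih =>
      intro x h1 h2
      have h3 : ∀ y ∈ Submodule.span ℂ (S a), F (Function.update x a y) = 0 := by
        intro y hy
        induction hy using Submodule.span_induction with
        | mem y hy =>
          refine ih _ (fun i hi => ?_) fun i hi => ?_
          · have : i ≠ a := fun e => ha (e ▸ hi)
            simpa [this] using h1 i (Finset.mem_insert_of_mem hi)
          · rcases eq_or_ne i a with rfl | e
            · simpa using hy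
            · simpa [e] using h2 i (by simp [e, hi])
        | zero => exact F.map_coord_zero a (by simp)
        | add y z _ _ hy hz => rw [F.map_update_add, hy, hz, add_zero]
        | smul c y _ hy => rw [F.map_update_smul, hy, smul_zero]
      simpa using h3 (x a) (h1 a (Finset.mem_insert_self a A))
  exact key Finset.univ x (fun i _ => hx i) (fun i hi => absurd (Finset.mem_univ i) hi)

end Polarization

/-! ### The symmetric algebra of a dual space and polynomial functions -/

section SymDual

variable {U : Type*} [AddCommMonoid U] [Module ℂ U]

/-- The value of an element of `S(U^*)`, viewed as a polynomial function, at the point `u`. -/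
noncomputable def symEval (u : U) : SymmetricAlgebra ℂ (Module.Dual ℂ U) →ₐ[ℂ] ℂ :=
  SymmetricAlgebra.lift (Module.Dual.eval ℂ U u)

@[simp] theorem symEval_ι (u : U) (f : Module.Dual ℂ U) :
    symEval u (SymmetricAlgebra.ι ℂ _ f) = f u := by
  simp [symEval]

/-- The degree `p` part of `S(M)`, spanned by the products of `p` elements of `M`. -/
noncomputable def symPow (M : Type*) [AddCommGroup M] [Module ℂ M] (p : ℕ) :
    Submodule ℂ (SymmetricAlgebra ℂ M) := LinearMap.range (SymmetricAlgebra.ι ℂ M) ^ p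

theorem prod_mem_symPow {M : Type*} [AddCommGroup M] [Module ℂ M] {p : ℕ} (f : Fin p → M) :
    ∏ j, SymmetricAlgebra.ι ℂ M (f j) ∈ symPow M p := by
  induction p with
  | zero => simp [symPow, Submodule.one_eq_span]
  | succ p ih =>
    rw [Fin.prod_univ_succ, symPow, pow_succ']
    exact Submodule.mul_mem_mul ⟨f 0, rfl⟩ (ih fun j => f j.succ)

/-- `S^p(M)` is spanned by the products of `p` elements of `M`. -/
theorem symPow_induction {M : Type*} [AddCommGroup M] [Module ℂ M] {p : ℕ}
    {P : SymmetricAlgebra ℂ M → Prop}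
    (hprod : ∀ f : Fin p → M, P (∏ j, SymmetricAlgebra.ι ℂ M (f j)))
    (hzero : P 0) (hadd : ∀ s t, P s → P t → P (s + t)) (hsmul : ∀ (c : ℂ) s, P s → P (c • s))
    {s : SymmetricAlgebra ℂ M} (hs : s ∈ symPow M p) : P s := by
  have h : symPow M p ≤ Submodule.span ℂ
      (Set.range fun f : Fin p → M => ∏ j, SymmetricAlgebra.ι ℂ M (f j)) := by
    clear hs hprod hzero hadd hsmul
    induction p with
    | zero =>
      rw [symPow, pow_zero, Submodule.one_eq_span]
      exact Submodule.span_mono (by rintro _ rfl; exact ⟨Fin.elim0, by simp⟩)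
    | succ p ih =>
      rw [symPow, pow_succ']
      refine Submodule.mul_le.2 ?_
      rintro _ ⟨m, rfl⟩ t ht
      have := ih ht
      clear ht
      induction this using Submodule.span_induction with
      | mem t ht =>
        obtain ⟨f, rfl⟩ := ht
        exact Submodule.subset_span ⟨Fin.cons m f, by simp [Fin.prod_univ_succ]⟩
      | zero => simp
      | add s t _ _ hs ht => rw [mul_add]; exact add_mem hs ht
      | smul c s _ hs => rw [mul_smul_comm]; exact Submodule.smul_mem _ _ hs
  have := h hs
  clear hs
  induction this using Submodule.span_induction with
  | mem t ht => obtain ⟨f, rfl⟩ := ht; exact hprod f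
  | zero => exact hzero
  | add s t _ _ hs ht => exact hadd _ _ hs ht
  | smul c s _ hs => exact hsmul _ _ hs

/-- `S(M)` is the sum of its homogeneous parts; for directness see `symPow_eq_zero_of_sum`. -/
theorem exists_sum_symPow {M : Type*} [AddCommGroup M] [Module ℂ M] (s : SymmetricAlgebra ℂ M) :
    s ∈ ⨆ p, symPow M p := by
  induction s using SymmetricAlgebra.induction with
  | algebraMap r =>
    exact Submodule.mem_iSup_of_mem 0 (by
      rw [symPow, pow_zero]; exact Submodule.algebraMap_mem r)
  | ι m => exact Submodule.mem_iSup_of_mem 1 (by rw [symPow, pow_one]; exact ⟨m, rfl⟩)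
  | add s t hs ht => exact add_mem hs ht
  | mul s t hs ht =>
    have := Submodule.mul_mem_mul hs ht
    rw [Submodule.iSup_mul] at this
    simp only [Submodule.mul_iSup] at this
    refine SetLike.le_def.1 (iSup_le fun p => iSup_le fun q => ?_) this
    rw [symPow, symPow, ← pow_add]
    exact le_iSup (fun p => symPow M p) (p + q)

variable [Module.Finite ℂ U] [Module.Free ℂ U]

/-- As `ℂ` is infinite, an element of `S(U^*)` is determined by its values. -/
theorem symEval_injective {s t : SymmetricAlgebra ℂ (Module.Dual ℂ U)}
    (h : ∀ u, symEval u s = symEval u t) : s = t := by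
  let b := Module.finBasis ℂ U
  let e := SymmetricAlgebra.equivMvPolynomial b.dualBasis
  have he : ∀ (c : Fin (Module.finrank ℂ U) → ℂ) (s : SymmetricAlgebra ℂ (Module.Dual ℂ U)),
      MvPolynomial.eval c (e s) = symEval (b.equivFun.symm c) s := by
    intro c s
    have : (MvPolynomial.aeval c).comp (e : SymmetricAlgebra ℂ (Module.Dual ℂ U) →ₐ[ℂ] _) =
        symEval (b.equivFun.symm c) := by
      refine SymmetricAlgebra.algHom_ext (b.dualBasis.ext fun i => ?_)
      change MvPolynomial.aeval c (e (SymmetricAlgebra.ι ℂ _ (b.dualBasis i))) =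
        symEval _ (SymmetricAlgebra.ι ℂ _ (b.dualBasis i))
      rw [SymmetricAlgebra.equivMvPolynomial_ι_apply, MvPolynomial.aeval_X, symEval_ι]
      simp [Finsupp.single_apply]
    simpa using congrArg (fun g => g s) this
  exact e.injective (MvPolynomial.funext fun c => by rw [he, he, h])

/-- The element of `S^p(U^*)` whose polynomial function is `u ↦ F (u, …, u) / p!`. -/
noncomputable def symOfForm (p : ℕ) : MultilinearMap ℂ (fun _ : Fin p => U) ℂ →ₗ[ℂ]
    SymmetricAlgebra ℂ (Module.Dual ℂ U) where
  toFun F := (p.factorial : ℂ)⁻¹ • ∑ I : Fin p → Fin (Module.finrank ℂ U),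
    F (fun j => Module.finBasis ℂ U (I j)) •
      ∏ j, SymmetricAlgebra.ι ℂ (Module.Dual ℂ U) ((Module.finBasis ℂ U).coord (I j))
  map_add' F G := by simp [add_smul, Finset.sum_add_distrib]
  map_smul' c F := by
    simp only [smul_apply, smul_eq_mul, mul_smul, RingHom.id_apply]
    rw [← Finset.smul_sum, smul_comm]

theorem symOfForm_mem (p : ℕ) (F : MultilinearMap ℂ (fun _ : Fin p => U) ℂ) :
    symOfForm p F ∈ symPow (Module.Dual ℂ U) p :=
  Submodule.smul_mem _ _ (Submodule.sum_mem _ fun _ _ =>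
    Submodule.smul_mem _ _ (prod_mem_symPow _))

/-- The expansion of a multilinear form in the coordinates of its arguments. -/
theorem sum_coord_eq {p : ℕ} (F : MultilinearMap ℂ (fun _ : Fin p => U) ℂ) (x : Fin p → U) :
    ∑ I : Fin p → Fin (Module.finrank ℂ U), F (fun j => Module.finBasis ℂ U (I j)) *
      ∏ j, (Module.finBasis ℂ U).coord (I j) (x j) = F x := by
  conv_rhs => rw [show x = fun j => ∑ i, (Module.finBasis ℂ U).coord i (x j) •
    Module.finBasis ℂ U i from funext fun j => ((Module.finBasis ℂ U).sum_repr (x j)).symm]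
  simp only [F.map_sum, F.map_smul_univ, smul_eq_mul, mul_comm]

theorem symEval_symOfForm {p : ℕ} (F : MultilinearMap ℂ (fun _ : Fin p => U) ℂ) (u : U) :
    symEval u (symOfForm p F) = (p.factorial : ℂ)⁻¹ * F (fun _ => u) := by
  rw [← sum_coord_eq F]
  simp [symOfForm]

theorem IsSymmForm.eq_zero_of_symOfForm {p : ℕ} {F : MultilinearMap ℂ (fun _ : Fin p => U) ℂ}
    (hF : IsSymmForm F) (h : symOfForm p F = 0) : F = 0 := by
  refine hF.eq_zero_of_diag fun u => ?_
  have := symEval_symOfForm F u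
  rw [h, map_zero] at this
  simpa [Nat.factorial_ne_zero] using this.symm

/-- Every element of `S^p(U^*)` comes from a symmetric form; for a product of linear forms this
is its full polarization. -/
theorem exists_isSymmForm {p : ℕ} {s : SymmetricAlgebra ℂ (Module.Dual ℂ U)}
    (hs : s ∈ symPow (Module.Dual ℂ U) p) :
    ∃ F : MultilinearMap ℂ (fun _ : Fin p => U) ℂ, IsSymmForm F ∧ symOfForm p F = s := by
  refine symPow_induction (P := fun s => ∃ F : MultilinearMap ℂ (fun _ : Fin p => U) ℂ,
    IsSymmForm F ∧ symOfForm p F = s) ?_ ?_ ?_ ?_ hs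
  · intro f
    refine ⟨∑ σ : Equiv.Perm (Fin p), (MultilinearMap.mkPiAlgebra ℂ (Fin p) ℂ).compLinearMap
      fun j => f (σ j), fun τ x => ?_, symEval_injective fun u => ?_⟩
    · simp only [sum_apply, MultilinearMap.compLinearMap_apply,
        MultilinearMap.mkPiAlgebra_apply, Function.comp_apply]
      rw [← Equiv.sum_comp (Equiv.mulRight τ)]
      refine Finset.sum_congr rfl fun σ _ => ?_
      simp only [Equiv.coe_mulRight, Equiv.Perm.mul_apply]
      exact Equiv.prod_comp τ fun j => f (σ j) (x j)
    · rw [symEval_symOfForm]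
      simp only [sum_apply, MultilinearMap.compLinearMap_apply,
        MultilinearMap.mkPiAlgebra_apply, map_prod, symEval_ι]
      have : ∀ σ : Equiv.Perm (Fin p), ∏ j, f (σ j) u = ∏ j, f j u :=
        fun σ => Equiv.prod_comp σ fun j => f j u
      simp [this, Fintype.card_perm, Nat.factorial_ne_zero]
  · exact ⟨0, fun _ _ => rfl, map_zero _⟩
  · rintro _ _ ⟨F, hF, rfl⟩ ⟨G, hG, rfl⟩
    exact ⟨F + G, fun σ x => by simp [hF σ x, hG σ x], map_add _ _ _⟩
  · rintro c _ ⟨F, hF, rfl⟩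
    exact ⟨c • F, fun σ x => by simp [hF σ x], map_smul _ _ _⟩

theorem Derivation.map_finset_prod {A : Type*} [CommRing A] [Algebra ℂ A] (D : Derivation ℂ A A)
    {ι : Type*} [DecidableEq ι] (S : Finset ι) (f : ι → A) :
    D (∏ i ∈ S, f i) = ∑ i ∈ S, (∏ j ∈ S.erase i, f j) * D (f i) := by
  induction S using Finset.induction_on with
  | empty => simp
  | insert a S ha ih =>
    rw [Finset.prod_insert ha, Finset.sum_insert ha, D.leibniz, ih, Finset.erase_insert ha,
      smul_eq_mul, smul_eq_mul, Finset.mul_sum, add_comm]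
    congr 1
    refine Finset.sum_congr rfl fun i hi => ?_
    rw [Finset.erase_insert_of_ne (fun h : a = i => ha (h ▸ hi)), Finset.prod_insert (by simp [ha]),
      mul_assoc]

/-- The derivation of `S(U^*)` extending the transpose of `A` is the action of `A` on forms. -/
theorem symDer_symOfForm {p : ℕ} (A : U →ₗ[ℂ] U)
    (F : MultilinearMap ℂ (fun _ : Fin p => U) ℂ) :
    symDer A.dualMap (symOfForm p F) = symOfForm p (formDer A F) := by
  refine symEval_injective fun u => ?_
  rw [symEval_symOfForm, formDer_apply]
  rw [Finset.sum_congr rfl fun i _ => (sum_coord_eq F (Function.update (fun _ => u) i (A u))).symm,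
    Finset.sum_comm]
  change symEval u (symDer A.dualMap ((p.factorial : ℂ)⁻¹ • _)) = _
  rw [Derivation.map_smul, map_smul, map_sum, map_sum, smul_eq_mul]
  congr 1
  refine Finset.sum_congr rfl fun I _ => ?_
  rw [Derivation.map_smul, map_smul, smul_eq_mul, ← Finset.mul_sum, Derivation.map_finset_prod]
  congr 1
  simp only [map_sum, map_mul, map_prod, symDer_ι, symEval_ι]
  refine Finset.sum_congr rfl fun i _ => ?_
  rw [← Finset.mul_prod_erase _ _ (Finset.mem_univ i), mul_comm]
  congr 1
  · simp
  · exact Finset.prod_congr rfl fun j hj => by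
      rw [Function.update_of_ne (Finset.ne_of_mem_erase hj)]

theorem symEval_smul {p : ℕ} {s : SymmetricAlgebra ℂ (Module.Dual ℂ U)}
    (hs : s ∈ symPow (Module.Dual ℂ U) p) (t : ℂ) (u : U) :
    symEval (t • u) s = t ^ p * symEval u s := by
  obtain ⟨F, -, rfl⟩ := exists_isSymmForm hs
  rw [symEval_symOfForm, symEval_symOfForm, F.map_smul_univ (fun _ => t)]
  simp; ring

/-- The sum of the `S^p(U^*)` is direct: evaluate at `t u` and compare powers of `t`. -/
theorem symPow_eq_zero_of_sum (A : Finset ℕ) (s : ℕ → SymmetricAlgebra ℂ (Module.Dual ℂ U))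
    (hs : ∀ p, s p ∈ symPow (Module.Dual ℂ U) p) (h : ∑ p ∈ A, s p = 0) :
    ∀ p ∈ A, s p = 0 := by
  intro p hp
  refine symEval_injective fun u => ?_
  have hq : ∑ p ∈ A, Polynomial.monomial p (symEval u (s p)) = 0 := by
    refine Polynomial.funext fun t => ?_
    simp only [Polynomial.eval_finsetSum, Polynomial.eval_monomial, Polynomial.eval_zero]
    rw [← map_zero (symEval (t • u)), ← h, map_sum]
    exact Finset.sum_congr rfl fun q _ => by rw [symEval_smul (hs q), mul_comm]
  have := congrArg (fun f => Polynomial.coeff f p) hq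
  simpa [Polynomial.finsetSum_coeff, Polynomial.coeff_monomial, hp] using this

end SymDual

/-! ### Superderivations of the exterior algebra -/

theorem superSign_mul_self (a : ZMod 2) : superSign a * superSign a = 1 := by
  rcases zmod2_cases a with rfl | rfl <;> simp [superSign]

theorem superSign_add (a b : ZMod 2) : superSign (a + b) = superSign a * superSign b := by
  rcases zmod2_cases a with rfl | rfl <;> rcases zmod2_cases b with rfl | rfl <;>
    simp [superSign, zmod2_one_add_one]

section ExteriorAlgebra

variable {n : ℕ}

theorem involute_of_mem_lamPart {a : ZMod 2} {x : Lam n} (hx : x ∈ lamPart n a) :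
    CliffordAlgebra.involute x = superSign a • x := by
  rcases zmod2_cases a with rfl | rfl
  · rw [superSign_zero, one_smul]; exact CliffordAlgebra.involute_eq_of_mem_even hx
  · rw [superSign_one, neg_one_smul]; exact CliffordAlgebra.involute_eq_of_mem_odd hx

theorem ι_mem_lamPart (m : Fin n → ℂ) : ExteriorAlgebra.ι ℂ m ∈ lamPart n 1 :=
  CliffordAlgebra.ι_mem_evenOdd_one _ m

theorem one_mem_lamPart : (1 : Lam n) ∈ lamPart n 0 :=
  CliffordAlgebra.one_le_evenOdd_zero _ (Submodule.mem_one.2 ⟨1, map_one _⟩)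

theorem ι_mul_eq_involute_mul_ι (m : Fin n → ℂ) (x : Lam n) :
    ExteriorAlgebra.ι ℂ m * x = CliffordAlgebra.involute x * ExteriorAlgebra.ι ℂ m := by
  induction x using CliffordAlgebra.left_induction with
  | algebraMap r => rw [AlgHom.commutes]; exact (Algebra.commutes r _).symm
  | add x y hx hy => rw [mul_add, hx, hy, map_add, add_mul]
  | ι_mul x m' hx =>
    have h := ExteriorAlgebra.ι_add_mul_swap (R := ℂ) m m'
    rw [map_mul, CliffordAlgebra.involute_ι, mul_assoc, ← hx, ← mul_assoc, ← mul_assoc]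
    change ExteriorAlgebra.ι ℂ m * ExteriorAlgebra.ι ℂ m' * x =
      -ExteriorAlgebra.ι ℂ m' * ExteriorAlgebra.ι ℂ m * x
    rw [eq_neg_of_add_eq_zero_left h, neg_mul, neg_mul, neg_mul]

/-- Supercommutativity of the exterior algebra. -/
theorem lamPart_mul_comm {a b : ZMod 2} {x y : Lam n} (hx : x ∈ lamPart n a)
    (hy : y ∈ lamPart n b) : x * y = superSign (a * b) • (y * x) := by
  have hι : ∀ m, ExteriorAlgebra.ι ℂ m * y = superSign b • (y * ExteriorAlgebra.ι ℂ m) :=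
    fun m => by rw [ι_mul_eq_involute_mul_ι, involute_of_mem_lamPart hy, smul_mul_assoc]
  induction x, hx using CliffordAlgebra.evenOdd_induction with
  | range_ι_pow x h =>
    rcases zmod2_cases a with rfl | rfl
    · obtain ⟨r, rfl⟩ := Submodule.mem_one.mp h
      rw [zero_mul, superSign_zero, one_smul]
      exact Algebra.commutes r y
    · rw [ZMod.val_one, pow_one] at h
      obtain ⟨m, rfl⟩ := h
      rw [one_mul]
      exact hι m
  | add x x' _ _ hx hx' => rw [add_mul, mul_add, smul_add, hx, hx']
  | ι_mul_ι_mul m m' x _ hx =>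
    change ExteriorAlgebra.ι ℂ m * ExteriorAlgebra.ι ℂ m' * x * y =
      _ • (y * (ExteriorAlgebra.ι ℂ m * ExteriorAlgebra.ι ℂ m' * x))
    rw [mul_assoc, hx, mul_smul_comm, mul_assoc, ← mul_assoc _ y, hι, smul_mul_assoc,
      mul_smul_comm, ← mul_assoc, ← mul_assoc, hι, smul_mul_assoc, smul_mul_assoc, smul_smul,
      smul_smul, mul_assoc (superSign (a * b)), superSign_mul_self, mul_one]
    simp only [mul_assoc]

theorem lamDeg_mul {j k : ℤ} {x y : Lam n} (hx : x ∈ lamDeg n j) (hy : y ∈ lamDeg n k) :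
    x * y ∈ lamDeg n (j + k) := by
  cases j with
  | negSucc j => rw [show x = 0 from hx, zero_mul]; exact zero_mem _
  | ofNat j =>
    cases k with
    | negSucc k => rw [show y = 0 from hy, mul_zero]; exact zero_mem _
    | ofNat k =>
      change x * y ∈ LinearMap.range (ExteriorAlgebra.ι ℂ) ^ (j + k)
      rw [pow_add]
      exact Submodule.mul_mem_mul hx hy

theorem ι_mem_lamDeg (m : Fin n → ℂ) : ExteriorAlgebra.ι ℂ m ∈ lamDeg n 1 := by
  change _ ∈ LinearMap.range (ExteriorAlgebra.ι ℂ) ^ 1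
  rw [pow_one]
  exact ⟨m, rfl⟩

theorem lamDeg_of_neg {k : ℤ} (hk : k < 0) : lamDeg n k = ⊥ := by
  cases k with
  | ofNat k => exact absurd hk (not_lt.2 (Int.natCast_nonneg k))
  | negSucc k => rfl

theorem lamDeg_le_lamPart (k : ℤ) : lamDeg n k ≤ lamPart n (k : ZMod 2) := by
  cases k with
  | ofNat k =>
    exact le_iSup (fun k' : {k' : ℕ // (k' : ZMod 2) = ((Int.ofNat k : ℤ) : ZMod 2)} =>
      ⋀[ℂ]^(k' : ℕ) (Fin n → ℂ)) ⟨k, by simp⟩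
  | negSucc k => exact bot_le

theorem map_mem_lamPart {D : Module.End ℂ (Lam n)} {k : ℤ}
    (h : ∀ j : ℤ, ∀ x ∈ lamDeg n j, D x ∈ lamDeg n (k + j)) (b : ZMod 2) (x : Lam n)
    (hx : x ∈ lamPart n b) : D x ∈ lamPart n ((k : ZMod 2) + b) := by
  refine (iSup_le (a := (lamPart n ((k : ZMod 2) + b)).comap D) fun j y hy => ?_ :
    lamPart n b ≤ _) hx
  have := lamDeg_le_lamPart _ (h (j : ℕ) y hy)
  simpa [j.2] using this

/-- Two linear maps on `Λ(n)` agree if they agree on the homogeneous elements. -/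
theorem lam_ext {D E : Module.End ℂ (Lam n)}
    (h : ∀ k : ℕ, ∀ x ∈ ⋀[ℂ]^k (Fin n → ℂ), D x = E x) : D = E := by
  have h1 : (⊤ : Submodule ℂ (Lam n)) ≤ LinearMap.eqLocus D E := by
    rw [← CliffordAlgebra.iSup_ι_range_eq_top]
    exact iSup_le fun k x hx => h k x hx
  exact LinearMap.ext fun x => h1 (Submodule.mem_top (x := x))

/-- The contraction with a linear form `v`. -/
noncomputable def contr (v : Module.Dual ℂ (Fin n → ℂ)) : Module.End ℂ (Lam n) :=
  CliffordAlgebra.contractLeft v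

theorem contr_ι_mul (v : Module.Dual ℂ (Fin n → ℂ)) (m : Fin n → ℂ) (x : Lam n) :
    contr v (ExteriorAlgebra.ι ℂ m * x) = v m • x - ExteriorAlgebra.ι ℂ m * contr v x :=
  CliffordAlgebra.contractLeft_ι_mul _ _ _

theorem contr_ι (v : Module.Dual ℂ (Fin n → ℂ)) (m : Fin n → ℂ) :
    contr v (ExteriorAlgebra.ι ℂ m) = algebraMap ℂ (Lam n) (v m) :=
  CliffordAlgebra.contractLeft_ι _ _ _

theorem contr_algebraMap (v : Module.Dual ℂ (Fin n → ℂ)) (r : ℂ) :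
    contr v (algebraMap ℂ (Lam n) r) = 0 :=
  CliffordAlgebra.contractLeft_algebraMap _ _ _

theorem contr_contr (v : Module.Dual ℂ (Fin n → ℂ)) (x : Lam n) : contr v (contr v x) = 0 :=
  CliffordAlgebra.contractLeft_contractLeft _ _

theorem contr_mem_lamDeg (v : Module.Dual ℂ (Fin n → ℂ)) (j : ℤ) (x : Lam n)
    (hx : x ∈ lamDeg n j) : contr v x ∈ lamDeg n (-1 + j) := by
  cases j with
  | negSucc j => rw [show x = 0 from hx, map_zero]; exact zero_mem _
  | ofNat j =>
    induction j generalizing x with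
    | zero =>
      obtain ⟨r, rfl⟩ := Submodule.mem_one.mp (show x ∈ (1 : Submodule ℂ (Lam n)) by
        simpa [lamDeg] using hx)
      rw [contr_algebraMap]; exact zero_mem _
    | succ j ih =>
      have hx' : x ∈ LinearMap.range (ExteriorAlgebra.ι ℂ) *
          LinearMap.range (ExteriorAlgebra.ι ℂ : (Fin n → ℂ) →ₗ[ℂ] Lam n) ^ j := by
        rw [← pow_succ']; exact hx
      clear hx
      induction hx' using Submodule.mul_induction_on' with
      | mem_mul_mem a ha y hy =>
        obtain ⟨m, rfl⟩ := ha
        rw [contr_ι_mul]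
        refine sub_mem (Submodule.smul_mem _ _ ?_) ?_
        · have : (-1 : ℤ) + Int.ofNat (j + 1) = Int.ofNat j := by simp
          rw [this]; exact hy
        · have := lamDeg_mul (ι_mem_lamDeg m) (ih y hy)
          have e : (1 : ℤ) + (-1 + Int.ofNat j) = -1 + Int.ofNat (j + 1) := by simp
          rwa [e] at this
      | add x hx y hy ihx ihy =>
        rw [map_add]
        exact add_mem ihx ihy

/-- Contraction is an odd superderivation; `involute` is the parity automorphism. -/
theorem contr_mul (v : Module.Dual ℂ (Fin n → ℂ)) (x y : Lam n) :
    contr v (x * y) = contr v x * y + CliffordAlgebra.involute x * contr v y := by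
  induction x using CliffordAlgebra.left_induction with
  | algebraMap r =>
    have : contr v (algebraMap ℂ (Lam n) r) = 0 := contr_algebraMap v r
    change _ = contr v (algebraMap ℂ (Lam n) r) * y + _
    rw [this, zero_mul, zero_add, AlgHom.commutes]
    exact CliffordAlgebra.contractLeft_algebraMap_mul (d := v) r y
  | add x x' hx hx' => rw [add_mul, map_add, hx, hx', map_add, map_add, add_mul, add_mul]; abel
  | ι_mul x m hx =>
    change contr v (ExteriorAlgebra.ι ℂ m * x * y) = contr v (ExteriorAlgebra.ι ℂ m * x) * y + _
    rw [mul_assoc, contr_ι_mul, hx, contr_ι_mul, map_mul, CliffordAlgebra.involute_ι]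
    change _ = _ + -ExteriorAlgebra.ι ℂ m * _ * _
    simp only [sub_mul, smul_mul_assoc, mul_add, neg_mul, mul_assoc]
    abel

/-- The superderivation `g · contr v`. -/
noncomputable def mulContr (g : Lam n) (v : Module.Dual ℂ (Fin n → ℂ)) : Module.End ℂ (Lam n) :=
  LinearMap.mulLeft ℂ g * contr v

theorem mulContr_apply (g : Lam n) (v : Module.Dual ℂ (Fin n → ℂ)) (x : Lam n) :
    mulContr g v x = g * contr v x := rfl

theorem mulContr_ι (g : Lam n) (v : Module.Dual ℂ (Fin n → ℂ)) (m : Fin n → ℂ) :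
    mulContr g v (ExteriorAlgebra.ι ℂ m) = v m • g := by
  rw [mulContr_apply, contr_ι, Algebra.smul_def, Algebra.commutes]

theorem mulContr_mem_superDer {a : ZMod 2} {g : Lam n} (hg : g ∈ lamPart n a)
    (v : Module.Dual ℂ (Fin n → ℂ)) : mulContr g v ∈ superDer n (a + 1) := by
  have hc : ∀ b, ∀ x ∈ lamPart n b, contr v x ∈ lamPart n (1 + b) := fun b x hx => by
    simpa using map_mem_lamPart (k := -1) (contr_mem_lamDeg v) b x hx
  refine ⟨fun b x hx => ?_, fun b x hx c y hy => ?_⟩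
  · rw [add_assoc]; exact lamPart_mul hg (hc b x hx)
  · rw [mulContr_apply, contr_mul, involute_of_mem_lamPart hx, mul_add, mulContr_apply,
      mulContr_apply, mul_assoc, smul_mul_assoc, mul_smul_comm, ← mul_assoc g x,
      lamPart_mul_comm hg hx, smul_mul_assoc, smul_smul, mul_assoc, add_mul, one_mul,
      superSign_add, mul_comm (superSign b)]

/-- The Leibniz rule without the homogeneity assumption on the second factor. -/
theorem superDer_mul {a b : ZMod 2} {D : Module.End ℂ (Lam n)} (hD : D ∈ superDer n a)
    {x : Lam n} (hx : x ∈ lamPart n b) (y : Lam n) :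
    D (x * y) = D x * y + superSign (a * b) • (x * D y) := by
  obtain ⟨y, hy, z, hz, rfl⟩ := exists_lamPart_add y
  rw [mul_add, map_add, hD.2 b x hx _ y hy, hD.2 b x hx _ z hz, map_add, mul_add, mul_add,
    smul_add]
  abel

theorem superDer_one {a : ZMod 2} {D : Module.End ℂ (Lam n)} (hD : D ∈ superDer n a) :
    D 1 = 0 := by
  have h := superDer_mul hD one_mem_lamPart 1
  simpa [superSign_zero] using h

/-- A superderivation is determined by its values on the generators. -/
theorem superDer_ext {a : ZMod 2} {D E : Module.End ℂ (Lam n)} (hD : D ∈ superDer n a)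
    (hE : E ∈ superDer n a)
    (h : ∀ m, D (ExteriorAlgebra.ι ℂ m) = E (ExteriorAlgebra.ι ℂ m)) : D = E := by
  refine LinearMap.ext fun x => ?_
  induction x using CliffordAlgebra.left_induction with
  | algebraMap r =>
    rw [Algebra.algebraMap_eq_smul_one, map_smul, map_smul]
    exact congrArg (r • ·) ((superDer_one hD).trans (superDer_one hE).symm)
  | add x y hx hy => rw [map_add, map_add, hx, hy]
  | ι_mul x m hx =>
    change D (ExteriorAlgebra.ι ℂ m * x) = E (ExteriorAlgebra.ι ℂ m * x)
    rw [superDer_mul hD (ι_mem_lamPart m), superDer_mul hE (ι_mem_lamPart m), h, hx]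

/-- The `i`-th coordinate form on `ℂⁿ`. -/
noncomputable def coordForm (i : Fin n) : Module.Dual ℂ (Fin n → ℂ) := LinearMap.proj i

/-- Every superderivation is `∑ i, D(e_i) · ∂_i`, where `∂_i` is the contraction with the `i`-th
coordinate form. -/
theorem superDer_eq_sum {a : ZMod 2} {D : Module.End ℂ (Lam n)} (hD : D ∈ superDer n a) :
    D = ∑ i, mulContr (D (ExteriorAlgebra.ι ℂ (Pi.single i 1))) (coordForm i) := by
  refine superDer_ext hD (sum_mem fun i _ => ?_) fun m => ?_
  · have h := mulContr_mem_superDer (hD.1 _ _ (ι_mem_lamPart (Pi.single i 1))) (coordForm i)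
    rwa [add_assoc, zmod2_one_add_one, add_zero] at h
  · rw [LinearMap.sum_apply]
    simp only [mulContr_ι]
    conv_lhs => rw [← Finset.univ_sum_single m]
    rw [map_sum, map_sum]
    refine Finset.sum_congr rfl fun i _ => ?_
    rw [← map_smul, ← map_smul, ← Pi.single_smul]
    simp [coordForm]

end ExteriorAlgebra

/-! ### The grading of `W(n)`, rank one operators and the Euler field -/

/-- If `A³ = A` then every `D` is the sum of its components for the eigenvalues `1`, `-1`, `0`,
which are polynomials in `A` applied to `D`. -/
theorem exists_weights {M : Type*} [AddCommGroup M] [Module ℂ M] {A : M →ₗ[ℂ] M}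
    (hA : ∀ x, A (A (A x)) = A x) {N : Submodule ℂ M} (hN : ∀ x ∈ N, A x ∈ N) {D : M}
    (hD : D ∈ N) : ∃ x ∈ N, ∃ y ∈ N, ∃ z ∈ N, x + y + z = D ∧
      A x = (1 : ℂ) • x ∧ A y = (-1 : ℂ) • y ∧ A z = (0 : ℂ) • z := by
  refine ⟨(1 / 2 : ℂ) • (A (A D) + A D), N.smul_mem _ (add_mem (hN _ (hN _ hD)) (hN _ hD)),
    (1 / 2 : ℂ) • (A (A D) - A D), N.smul_mem _ (sub_mem (hN _ (hN _ hD)) (hN _ hD)),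
    D - A (A D), sub_mem hD (hN _ (hN _ hD)), ?_, ?_, ?_, ?_⟩
  · module
  · rw [map_smul, map_add, hA]; module
  · rw [map_smul, map_sub, hA]; module
  · rw [map_sub, hA]; module

/-- Stated for an abstract ambient module, since instance search through the subtype `W n` is
expensive. -/
theorem finite_and_free_submodule {M : Type*} [AddCommGroup M] [Module ℂ M] [Module.Finite ℂ M]
    (N : Submodule ℂ M) : Module.Finite ℂ N ∧ Module.Free ℂ N :=
  ⟨inferInstance, inferInstance⟩

namespace W

variable {n : ℕ}

theorem mulContr_mem_W {k : ℤ} {g : Lam n} (hg : g ∈ lamDeg n k)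
    (v : Module.Dual ℂ (Fin n → ℂ)) : mulContr g v ∈ W n :=
  superDer_le_W n _ (mulContr_mem_superDer (lamDeg_le_lamPart k hg) v)

theorem mulContr_mem_deg {k : ℤ} {g : Lam n} (hg : g ∈ lamDeg n k)
    (v : Module.Dual ℂ (Fin n → ℂ)) :
    (⟨mulContr g v, mulContr_mem_W hg v⟩ : W n) ∈ deg n (k - 1) := by
  refine ⟨?_, fun j x hx => ?_⟩
  · have h := mulContr_mem_superDer (lamDeg_le_lamPart k hg) v
    change mulContr g v ∈ superDer n _
    convert h using 1
    push_cast
    rw [sub_eq_add_neg]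
    congr 1
  · have h := lamDeg_mul hg (contr_mem_lamDeg v j x hx)
    rw [← add_assoc, ← sub_eq_add_neg] at h
    exact h

/-- `W(n)` is spanned by homogeneous elements of degree at least `-1`. -/
theorem mem_span_deg (D : W n) :
    D ∈ Submodule.span ℂ {D : W n | ∃ k : ℤ, -1 ≤ k ∧ D ∈ deg n k} := by
  set S := Submodule.span ℂ {D : W n | ∃ k : ℤ, -1 ≤ k ∧ D ∈ deg n k} with hS
  have key : ∀ (a : ZMod 2), superDer n a ≤ S.map (W n).subtype := by
    intro a D hD
    rw [superDer_eq_sum hD]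
    refine sum_mem fun i _ => ?_
    have h := hD.1 _ _ (ι_mem_lamPart (Pi.single i 1))
    generalize D (ExteriorAlgebra.ι ℂ (Pi.single i 1)) = g at h
    have h' : lamPart n (a + 1) ≤ (S.map (W n).subtype).comap
        (LinearMap.mulRight ℂ (contr (coordForm i)) ∘ₗ LinearMap.mul ℂ (Lam n)) := by
      refine iSup_le fun k x hx => ?_
      refine ⟨⟨mulContr x (coordForm i), mulContr_mem_W (k := (k : ℕ)) hx _⟩,
        Submodule.subset_span ⟨(k : ℕ) - 1, by omega, mulContr_mem_deg (k := (k : ℕ)) hx _⟩, ?_⟩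
      rfl
    exact h' h
  have h : W n ≤ S.map (W n).subtype := sup_le (key 0) (key 1)
  obtain ⟨E, hE, hDE⟩ := h D.2
  rwa [← Subtype.ext hDE]

theorem eq_zero_of_mem_deg {k : ℤ} (hk : k < -1) {D : W n} (hD : D ∈ deg n k) : D = 0 := by
  refine Subtype.ext (superDer_ext hD.1 (Submodule.zero_mem _) fun m => ?_)
  have h := hD.2 1 _ (ι_mem_lamDeg m)
  rw [lamDeg_of_neg (by omega)] at h
  exact h

/-- The supercommutator with an even element is the commutator. -/
theorem bracket_even {z : W n} (hz : z ∈ part n 0) (D : W n) :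
    (bracket n z D).1 = z.1 * D.1 - D.1 * z.1 := by
  obtain ⟨D0, h0, D1, h1, rfl⟩ := Submodule.mem_sup.1
    ((part_isCompl n).sup_eq_top ▸ Submodule.mem_top : D ∈ part n 0 ⊔ part n 1)
  rw [map_add, Submodule.coe_add, bracket_of_mem hz h0, bracket_of_mem hz h1]
  simp only [zero_mul, superSign_zero, one_smul, Submodule.coe_add, mul_add, add_mul]
  abel

theorem mem_part_zero {z : W n} (hz : z ∈ deg n 0) : z ∈ part n 0 := by
  simpa using hz.1

theorem mem_part_one {x : W n} (hx : x ∈ degPM n) : x ∈ part n 1 := by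
  have h : degPM n ≤ part n 1 :=
    sup_le (fun y hy => by simpa using hy.1) (fun y hy => by simpa using hy.1)
  exact h hx

/-- The operator `u · contr v` in `W(n)₀`, corresponding to the rank one endomorphism
`m ↦ v(m) u` of `ℂⁿ`. -/
noncomputable def rankOne (u : Fin n → ℂ) (v : Module.Dual ℂ (Fin n → ℂ)) : W n :=
  ⟨mulContr (ExteriorAlgebra.ι ℂ u) v, mulContr_mem_W (ι_mem_lamDeg u) v⟩

theorem rankOne_mem (u : Fin n → ℂ) (v : Module.Dual ℂ (Fin n → ℂ)) :
    rankOne u v ∈ deg n 0 := by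
  exact mulContr_mem_deg (ι_mem_lamDeg u) v

theorem rankOne_apply (u : Fin n → ℂ) (v : Module.Dual ℂ (Fin n → ℂ)) (x : Lam n) :
    (rankOne u v).1 x = ExteriorAlgebra.ι ℂ u * contr v x := rfl

theorem rankOne_mul_self {u : Fin n → ℂ} {v : Module.Dual ℂ (Fin n → ℂ)} (h : v u = 1) :
    (rankOne u v).1 * (rankOne u v).1 = (rankOne u v).1 := by
  refine LinearMap.ext fun x => ?_
  rw [Module.End.mul_apply, rankOne_apply, rankOne_apply, contr_ι_mul, contr_contr, h, one_smul,
    mul_zero, sub_zero]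

/-- The Euler vector field `∑ i, e_i ∂_i`, which acts on `Λ^k(n)` as `k`. -/
noncomputable def euler (n : ℕ) : W n := ∑ i, rankOne (Pi.single i 1) (coordForm i)

theorem euler_mem : euler n ∈ deg n 0 := sum_mem fun _ _ => rankOne_mem _ _

theorem euler_ι (m : Fin n → ℂ) :
    (euler n).1 (ExteriorAlgebra.ι ℂ m) = ExteriorAlgebra.ι ℂ m := by
  have h : (euler n).1 = ∑ i, (rankOne (Pi.single i 1) (coordForm i)).1 := by
    simp [euler]
  rw [h, LinearMap.sum_apply]
  conv_rhs => rw [← Finset.univ_sum_single m, map_sum]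
  refine Finset.sum_congr rfl fun i _ => ?_
  refine (mulContr_ι _ _ m).trans ?_
  rw [← map_smul, ← Pi.single_smul]
  simp [coordForm]

theorem euler_apply (k : ℕ) (x : Lam n) (hx : x ∈ ⋀[ℂ]^k (Fin n → ℂ)) :
    (euler n).1 x = (k : ℂ) • x := by
  have hE : (euler n).1 ∈ superDer n 0 := mem_part_zero euler_mem
  induction k generalizing x with
  | zero =>
    obtain ⟨r, rfl⟩ := Submodule.mem_one.mp (show x ∈ (1 : Submodule ℂ (Lam n)) by simpa using hx)
    rw [Algebra.algebraMap_eq_smul_one, map_smul, superDer_one hE]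
    simp
  | succ k ih =>
    have hx' : x ∈ LinearMap.range (ExteriorAlgebra.ι ℂ) *
        LinearMap.range (ExteriorAlgebra.ι ℂ : (Fin n → ℂ) →ₗ[ℂ] Lam n) ^ k := by
      rw [← pow_succ']; exact hx
    clear hx
    induction hx' using Submodule.mul_induction_on' with
    | mem_mul_mem a ha y hy =>
      obtain ⟨m, rfl⟩ := ha
      rw [superDer_mul hE (ι_mem_lamPart m), euler_ι, ih y hy, zero_mul, superSign_zero, one_smul,
        mul_smul_comm, Nat.cast_succ, add_smul, one_smul, add_comm]
    | add x hx y hy ihx ihy => rw [map_add, ihx, ihy, smul_add]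

theorem euler_apply_lamDeg (k : ℤ) (x : Lam n) (hx : x ∈ lamDeg n k) :
    (euler n).1 x = (k : ℂ) • x := by
  cases k with
  | ofNat k => simpa using euler_apply k x hx
  | negSucc k => rw [show x = 0 from hx, map_zero, smul_zero]

/-- The grading of `W(n)` is the eigenspace decomposition for the Euler field. -/
theorem bracket_euler {k : ℤ} {D : W n} (hD : D ∈ deg n k) :
    bracket n (euler n) D = (k : ℂ) • D := by
  refine Subtype.ext (lam_ext fun j x hx => ?_)
  rw [bracket_even (mem_part_zero euler_mem)]
  have h1 := euler_apply_lamDeg _ _ (hD.2 j x hx)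
  have h2 := euler_apply_lamDeg j x hx
  rw [LinearMap.sub_apply, Module.End.mul_apply, Module.End.mul_apply, h1, h2, map_smul,
    ← sub_smul]
  simp

/-- The bracket with a rank one idempotent has the eigenvalues `-1`, `0`, `1`. -/
theorem bracket_rankOne_cube {u : Fin n → ℂ} {v : Module.Dual ℂ (Fin n → ℂ)} (h : v u = 1)
    (D : W n) :
    bracket n (rankOne u v) (bracket n (rankOne u v) (bracket n (rankOne u v) D)) =
      bracket n (rankOne u v) D := by
  have hH := rankOne_mul_self h
  have hp := mem_part_zero (rankOne_mem u v)
  refine Subtype.ext ?_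
  rw [bracket_even hp, bracket_even hp, bracket_even hp]
  generalize (rankOne u v).1 = H at hH
  generalize D.1 = X
  have h1 : ∀ Y, H * (H * Y) = H * Y := fun Y => by rw [← mul_assoc, hH]
  simp only [mul_sub, sub_mul, mul_assoc, hH, h1]
  abel

/-- A nonzero element of degree `-1` is a contraction, hence has weight `-1` for a suitable rank
one idempotent. -/
theorem exists_rankOne {D : W n} (hD : D ∈ deg n (-1)) (h0 : D ≠ 0) :
    ∃ (u : Fin n → ℂ) (v : Module.Dual ℂ (Fin n → ℂ)), v u = 1 ∧
      bracket n (rankOne u v) D = (-1 : ℂ) • D := by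
  let v : Module.Dual ℂ (Fin n → ℂ) :=
    (ExteriorAlgebra.algebraMapInv (R := ℂ)).toLinearMap ∘ₗ D.1 ∘ₗ ExteriorAlgebra.ι ℂ
  have hv : D.1 = contr v := by
    have hD' : D.1 ∈ superDer n 1 := by
      have h : D ∈ part n 1 := by simpa using hD.1
      exact h
    have hc : contr v ∈ superDer n 1 := by
      have := mulContr_mem_superDer one_mem_lamPart v
      rw [zero_add] at this
      convert this using 1
      exact LinearMap.ext fun x => by rw [mulContr_apply, one_mul]
    refine superDer_ext hD' hc fun m => ?_
    rw [contr_ι]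
    have h := hD.2 1 _ (ι_mem_lamDeg m)
    obtain ⟨r, hr⟩ := Submodule.mem_one.mp
      (show D.1 (ExteriorAlgebra.ι ℂ m) ∈ (1 : Submodule ℂ (Lam n)) by simpa [lamDeg] using h)
    rw [← hr]
    congr 1
    change r = ExteriorAlgebra.algebraMapInv (D.1 (ExteriorAlgebra.ι ℂ m))
    rw [← hr]
    exact (ExteriorAlgebra.algebraMap_leftInverse _ r).symm
  have hv0 : v ≠ 0 := by
    rintro h
    refine h0 (Subtype.ext ?_)
    rw [hv, h]
    exact map_zero CliffordAlgebra.contractLeft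
  obtain ⟨w, hw⟩ : ∃ w, v w ≠ 0 := by
    by_contra! h
    exact hv0 (LinearMap.ext h)
  refine ⟨(v w)⁻¹ • w, v, by simp [hw], Subtype.ext (LinearMap.ext fun x => ?_)⟩
  rw [bracket_even (mem_part_zero (rankOne_mem _ _))]
  simp only [LinearMap.sub_apply, Module.End.mul_apply, hv, rankOne_apply, contr_contr, mul_zero,
    contr_ι_mul, sub_zero, zero_sub, Submodule.coe_smul, neg_smul, one_smul]
  simp [hw]

/-- `W(n)₀` is spanned by the rank one idempotents. -/
theorem mem_span_rankOne {z : W n} (hz : z ∈ deg n 0) :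
    z ∈ Submodule.span ℂ {z : W n | ∃ u v, v u = 1 ∧ z = rankOne u v} := by
  set S := Submodule.span ℂ {z : W n | ∃ u v, v u = 1 ∧ z = rankOne u v}
  have hS : ∀ u v, v u = 1 → rankOne u v ∈ S := fun u v h =>
    Submodule.subset_span ⟨u, v, h, rfl⟩
  have hadd : ∀ (u u' : Fin n → ℂ) (v : Module.Dual ℂ (Fin n → ℂ)),
      rankOne (u + u') v = rankOne u v + rankOne u' v := fun u u' v =>
    Subtype.ext (LinearMap.ext fun x => by simp [rankOne_apply, add_mul])
  -- `E_ij` is the difference of the idempotents `E_jj + E_ij` and `E_jj`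
  have hu : ∀ (u : Fin n → ℂ) (j : Fin n), rankOne u (coordForm j) ∈ S := by
    intro u j
    have h1 : rankOne u (coordForm j) = rankOne (u + Pi.single j (1 - u j)) (coordForm j) +
        (u j - 1) • rankOne (Pi.single j 1) (coordForm j) := by
      have h2 : (Pi.single j (1 - u j) : Fin n → ℂ) = (1 - u j) • Pi.single j 1 := by
        rw [← Pi.single_smul, smul_eq_mul, mul_one]
      rw [hadd, h2]
      refine Subtype.ext (LinearMap.ext fun x => ?_)
      simp only [Submodule.coe_add, Submodule.coe_smul, LinearMap.add_apply, LinearMap.smul_apply,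
        rankOne_apply, map_smul, smul_mul_assoc]
      module
    rw [h1]
    exact add_mem (hS _ _ (by simp [coordForm])) (S.smul_mem _ (hS _ _ (by simp [coordForm])))
  have hz' : z.1 ∈ superDer n 0 := mem_part_zero hz
  have h : ∀ j : Fin n, ∃ u, z.1 (ExteriorAlgebra.ι ℂ (Pi.single j 1)) = ExteriorAlgebra.ι ℂ u := by
    intro j
    have h := hz.2 1 _ (ι_mem_lamDeg (Pi.single j 1))
    have h' : z.1 (ExteriorAlgebra.ι ℂ (Pi.single j 1)) ∈
        LinearMap.range (ExteriorAlgebra.ι ℂ : (Fin n → ℂ) →ₗ[ℂ] Lam n) ^ 1 := h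
    rw [pow_one] at h'
    obtain ⟨u, hu⟩ := h'
    exact ⟨u, hu.symm⟩
  choose u hzu using h
  have hsum : z = ∑ j, rankOne (u j) (coordForm j) := by
    refine Subtype.ext ((superDer_eq_sum hz').trans ?_)
    simp only [hzu]
    simp [rankOne]
  rw [hsum]
  exact sum_mem fun j _ => hu _ _

instance : FiniteDimensional ℂ (Lam n) :=
  Module.Finite.of_basis (Pi.basisFun ℂ (Fin n)).ExteriorAlgebra

instance : Module.Finite ℂ (W n) := (finite_and_free_submodule (W n)).1

instance : Module.Finite ℂ (degPM n) := (finite_and_free_submodule (M := W n) (degPM n)).1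

instance : Module.Free ℂ (degPM n) := (finite_and_free_submodule (M := W n) (degPM n)).2

end W

/-! ### Weights and symmetry of relative cochains -/

namespace LieSuperalgebra

variable {L : Type*} [AddCommGroup L] [Module ℂ L] {𝔤 : LieSuperalgebra L} {𝔱 : 𝔤.Sub} {p : ℕ}

/-- A super-alternating form is unchanged when two odd arguments are exchanged: the signs from
moving past the arguments in between cancel. -/
theorem relCochain_swap {φ : Form L p} (hφ : φ ∈ 𝔤.relCochain 𝔱 p) (i j : Fin p) (x : Fin p → L)
    (e : Fin p → ZMod 2) (hx : ∀ k, x k ∈ 𝔤.part (e k)) (hi : e i = 1) (hj : e j = 1) :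
    φ (x ∘ Equiv.swap i j) = φ x := by
  wlog hij : i ≤ j generalizing i j
  · rw [Equiv.swap_comm]
    exact this j i hj hi (le_of_not_ge hij)
  have key : ∀ (m : ℕ) (j : Fin p) (x : Fin p → L) (e : Fin p → ZMod 2),
      (∀ k, x k ∈ 𝔤.part (e k)) → e i = 1 → e j = 1 → j.val = i.val + 1 + m →
      φ (x ∘ Equiv.swap i j) = φ x := by
    intro m
    induction m with
    | zero =>
      intro j x e hx hi hj hij
      have h := hφ.1 e x hx i j (by omega)
      rw [hi, hj, one_mul, superSign_one] at h
      rw [h]; ring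
    | succ m ih =>
      intro j x e hx hi hj hij
      let k : Fin p := ⟨j.val - 1, by omega⟩
      have hkj : j.val = k.val + 1 := by simp only [k]; omega
      have hik : k.val = i.val + 1 + m := by simp only [k]; omega
      have hne : i ≠ k := fun h => by have := congrArg Fin.val h; omega
      have hne' : i ≠ j := fun h => by have := congrArg Fin.val h; omega
      have hne'' : k ≠ j := fun h => by have := congrArg Fin.val h; omega
      -- `(i j) = (k j) (i k) (k j)`
      have hs : Equiv.swap i j = Equiv.swap k j * Equiv.swap i k * Equiv.swap k j := by
        rw [Equiv.swap_comm i j]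
        exact (Equiv.swap_mul_swap_mul_swap hne hne').symm
      have hx1 : ∀ l, (x ∘ Equiv.swap k j) l ∈ 𝔤.part ((e ∘ Equiv.swap k j) l) := fun l => hx _
      have hx2 : ∀ l, (x ∘ Equiv.swap k j ∘ Equiv.swap i k) l ∈
        𝔤.part ((e ∘ Equiv.swap k j ∘ Equiv.swap i k) l) := fun l => hx _
      have h1 := hφ.1 e x hx k j hkj
      have h2 := ih k _ _ hx1 (by simp [Equiv.swap_apply_of_ne_of_ne hne hne', hi])
        (by simp [hj]) hik
      have h3 := hφ.1 _ _ hx2 k j hkj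
      rw [hs, Equiv.Perm.coe_mul, Equiv.Perm.coe_mul]
      rw [← Function.comp_assoc, ← Function.comp_assoc]
      rw [← Function.comp_assoc] at h3
      rw [h2] at h3
      have e1 : (e ∘ Equiv.swap k j ∘ Equiv.swap i k) k = 1 := by
        simp [Equiv.swap_apply_of_ne_of_ne hne hne', hi]
      have e2 : (e ∘ Equiv.swap k j ∘ Equiv.swap i k) j = e k := by
        simp [Equiv.swap_apply_of_ne_of_ne hne'.symm hne''.symm]
      rw [e1, e2, one_mul] at h3
      rw [hj, mul_one, h3] at h1
      -- `x k` changes places with `x i` and with `x j`, both odd, and the two equal signs cancel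
      linear_combination (-1 : ℂ) * h1 -
        φ (((x ∘ Equiv.swap k j) ∘ Equiv.swap i k) ∘ Equiv.swap k j) * superSign_mul_self (e k)
  rcases hij.lt_or_eq with h | rfl
  · exact key (j.val - i.val - 1) j x e hx hi hj (by have := Fin.lt_def.1 h; omega)
  · simp

/-- Weights of an even element of `𝔱` acting on the arguments of a nonzero value add up to `0`. -/
theorem relCochain_weight {φ : Form L p} (hφ : φ ∈ 𝔤.relCochain 𝔱 p) {T : L}
    (hT : T ∈ 𝔱.carrier) (hT0 : T ∈ 𝔤.part 0) (x : Fin p → L) (e : Fin p → ZMod 2)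
    (hx : ∀ k, x k ∈ 𝔤.part (e k)) (w : Fin p → ℤ)
    (hw : ∀ k, 𝔤.bracket T (x k) = (w k : ℂ) • x k) (hne : ∑ k, w k ≠ 0) : φ x = 0 := by
  have h := hφ.2.2 0 T hT hT0 e x hx
  simp only [zero_mul, superSign_zero, one_mul, hw, φ.map_update_smul, Function.update_eq_self,
    smul_eq_mul, ← Finset.sum_mul] at h
  refine (mul_eq_zero.1 h).resolve_left ?_
  rw [← Int.cast_sum]
  exact_mod_cast hne

/-- The span of the homogeneous eigenvectors of `[T, ·]` with integral eigenvalue at most `c`. -/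
def lowWeights (𝔤 : LieSuperalgebra L) (T : L) (c : ℤ) : Submodule ℂ L :=
  Submodule.span ℂ {D | ∃ a, D ∈ 𝔤.part a ∧ ∃ w : ℤ, w ≤ c ∧ 𝔤.bracket T D = (w : ℂ) • D}

theorem mem_lowWeights {T D : L} {a : ZMod 2} (hD : D ∈ 𝔤.part a) {w c : ℤ} (hw : w ≤ c)
    (h : 𝔤.bracket T D = (w : ℂ) • D) : D ∈ 𝔤.lowWeights T c :=
  Submodule.subset_span ⟨a, hD, w, hw, h⟩

/-- A relative cochain vanishes if the arguments have weights bounded by numbers with negative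
sum. -/
theorem relCochain_lowWeights {φ : Form L p} (hφ : φ ∈ 𝔤.relCochain 𝔱 p) {T : L}
    (hT : T ∈ 𝔱.carrier) (hT0 : T ∈ 𝔤.part 0) (x : Fin p → L) (c : Fin p → ℤ)
    (hx : ∀ k, x k ∈ 𝔤.lowWeights T (c k)) (hc : ∑ k, c k < 0) : φ x = 0 := by
  refine φ.eq_zero_of_mem_span _ (fun y hy => ?_) x hx
  choose a ha w hw hb using hy
  exact relCochain_weight hφ hT hT0 y a ha w hb
    ((Finset.sum_le_sum fun k _ => hw k).trans_lt hc).ne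

theorem bracket_mem_lowWeights {T : L} (hT0 : T ∈ 𝔤.part 0) {c c' : ℤ} {D E : L}
    (hD : D ∈ 𝔤.lowWeights T c) (hE : E ∈ 𝔤.lowWeights T c') :
    𝔤.bracket D E ∈ 𝔤.lowWeights T (c + c') := by
  have h := Submodule.apply_mem_map₂ 𝔤.bracket hD hE
  rw [lowWeights, lowWeights, Submodule.map₂_span_span] at h
  refine Submodule.span_le.2 ?_ h
  rintro _ ⟨X, ⟨a, ha, w, hw, hX⟩, Y, ⟨b, hb, w', hw', hY⟩, rfl⟩
  refine mem_lowWeights (𝔤.bracket_mem ha hb) (add_le_add hw hw') ?_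
  rw [𝔤.jacobi hT0 ha hb, hX, hY, zero_mul, superSign_zero, one_smul, map_smul, map_smul,
    LinearMap.smul_apply, Int.cast_add, add_smul]

end LieSuperalgebra

/-! ### Relative cochains live on `𝔤₋₁ ⊕ 𝔤₁` -/

/-- If the space is the sum of eigenspaces `N k` of `A`, then there is a projection onto the sum of
some of them which kills the others. -/
theorem exists_proj_of_eigen {M : Type*} [AddCommGroup M] [Module ℂ M] (A : M →ₗ[ℂ] M)
    (N : ℤ → Submodule ℂ M) (hN : ∀ k, ∀ x ∈ N k, A x = (k : ℂ) • x)
    (htop : ∀ x, x ∈ ⨆ k, N k) (K : Set ℤ) (P : Submodule ℂ M) (hP : P = ⨆ k ∈ K, N k) :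
    ∃ π : M →ₗ[ℂ] P, (∀ x : P, π x = x) ∧ ∀ k ∉ K, ∀ x ∈ N k, π x = 0 := by
  have hind : iSupIndep N := by
    have h := (Module.End.eigenspaces_iSupIndep A).comp (Int.cast_injective (α := ℂ))
    exact h.mono fun k x hx => Module.End.mem_eigenspace_iff.2 (hN k x hx)
  have hc : IsCompl P (⨆ k ∈ Kᶜ, N k) := by
    rw [hP]
    refine ⟨hind.disjoint_biSup_biSup disjoint_compl_right, codisjoint_iff_le_sup.2 fun x _ => ?_⟩
    refine SetLike.le_def.1 (iSup_le fun k => ?_) (htop x)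
    by_cases hk : k ∈ K
    · exact (le_iSup₂_of_le (f := fun k (_ : k ∈ K) => N k) k hk le_rfl).trans le_sup_left
    · exact (le_iSup₂_of_le (f := fun k (_ : k ∈ Kᶜ) => N k) k hk le_rfl).trans le_sup_right
  exact ⟨P.projectionOnto _ hc, Submodule.projectionOnto_apply_left hc, fun k hk x hx =>
    Submodule.projectionOnto_apply_right hc
      ⟨x, le_iSup₂_of_le (f := fun k (_ : k ∈ Kᶜ) => N k) k hk le_rfl hx⟩⟩

namespace W

variable {n p : ℕ}

/-- For `T = u · contr v - E`, `E` the Euler field, with `v(u) = 1`, the elements of degree `k` have weights at most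
`1 - k`, and a given element of degree `-1` has weight `0` for a suitable such `T`. -/
theorem exists_lowWeights {x : W n} (hx : x ∈ deg n (-1)) :
    ∃ T ∈ deg n 0, x ∈ (lieSuperalgebra n).lowWeights T 0 ∧
      ∀ k : ℤ, ∀ D ∈ deg n k, D ∈ (lieSuperalgebra n).lowWeights T (1 - k) := by
  by_cases h0 : x = 0
  · refine ⟨(-1 : ℂ) • euler n, Submodule.smul_mem _ _ euler_mem, h0 ▸ Submodule.zero_mem _,
      fun k D hD => ?_⟩
    refine LieSuperalgebra.mem_lowWeights (𝔤 := lieSuperalgebra n) (w := -k) hD.1 (by omega) ?_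
    change bracket n ((-1 : ℂ) • euler n) D = _
    rw [map_smul, LinearMap.smul_apply, bracket_euler hD, smul_smul]
    congr 1
    push_cast; ring
  · obtain ⟨u, v, huv, hxw⟩ := exists_rankOne hx h0
    have hT : ∀ (k : ℤ) (D : W n), D ∈ deg n k → ∀ w : ℤ,
        bracket n (rankOne u v) D = (w : ℂ) • D →
        bracket n (rankOne u v + (-1 : ℂ) • euler n) D = ((w - k : ℤ) : ℂ) • D := by
      intro k D hD w hw
      rw [map_add, LinearMap.add_apply, hw, map_smul, LinearMap.smul_apply, bracket_euler hD,
        smul_smul, ← add_smul]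
      congr 1
      push_cast; ring
    refine ⟨rankOne u v + (-1 : ℂ) • euler n,
      add_mem (rankOne_mem u v) (Submodule.smul_mem _ _ euler_mem), ?_, fun k D hD => ?_⟩
    · exact LieSuperalgebra.mem_lowWeights (𝔤 := lieSuperalgebra n) hx.1 (by omega)
        (hT _ x hx (-1) (by simpa using hxw))
    · have hN : ∀ y ∈ deg n k, bracket n (rankOne u v) y ∈ deg n k := fun y hy => by
        simpa using bracket_mem_deg (rankOne_mem u v) hy
      obtain ⟨a, ha, b, hb, c, hc, rfl, ha', hb', hc'⟩ :=
        exists_weights (M := W n) (A := bracket n (rankOne u v)) (N := deg n k)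
          (bracket_rankOne_cube huv) hN hD
      refine add_mem (add_mem ?_ ?_) ?_
      · exact LieSuperalgebra.mem_lowWeights (𝔤 := lieSuperalgebra n) ha.1 (by omega)
          (hT _ a ha 1 (by simpa using ha'))
      · exact LieSuperalgebra.mem_lowWeights (𝔤 := lieSuperalgebra n) hb.1 (by omega)
          (hT _ b hb (-1) (hb'.trans (by push_cast; rfl)))
      · exact LieSuperalgebra.mem_lowWeights (𝔤 := lieSuperalgebra n) hc.1 (by omega)
          (hT _ c hc 0 (by simpa using hc'))

/-- By polarization the arguments of degree `-1` may be taken to be equal; then the weights under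
`T = u · contr v - E` are too low, since an argument of degree at least `2` has negative weight. -/
theorem relCochain_eq_zero_of_deg {φ : LieSuperalgebra.Form (W n) p}
    (hφ : φ ∈ (lieSuperalgebra n).relCochain (degZero n) p) {x : Fin p → W n} {k : Fin p → ℤ}
    (hx : ∀ j, x j ∈ deg n (k j)) {i : Fin p} (h1 : k i ≠ -1) (h2 : k i ≠ 1) : φ x = 0 := by
  by_cases h0 : ∃ j, k j = 0
  · obtain ⟨j, hj⟩ := h0
    exact hφ.2.1 x ⟨j, by have := hx j; rwa [hj] at this⟩
  by_cases hlt : ∃ j, k j < -1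
  · obtain ⟨j, hj⟩ := hlt
    exact φ.map_coord_zero j (eq_zero_of_mem_deg hj (hx j))
  push Not at h0 hlt
  -- `φ` as a form in the arguments of degree `-1` only
  let F : MultilinearMap ℂ (fun _ : {j // k j = -1} => deg n (-1)) ℂ :=
    (φ.domDomRestrict (fun j => k j = -1) fun j => x j).compLinearMap
      fun _ => (deg n (-1)).subtype
  have hF : ∀ y, F y = φ fun j => if h : k j = -1 then (y ⟨j, h⟩ : W n) else x j := fun y => rfl
  have hsymm : IsSymmForm F := by
    refine isSymmForm_of_swap fun a b y => ?_
    rw [hF, hF]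
    have hy : ∀ j, (if h : k j = -1 then (y ⟨j, h⟩ : W n) else x j) ∈ part n (k j : ZMod 2) := by
      intro j
      split_ifs with h
      · rw [h]; exact (y ⟨j, h⟩).2.1
      · exact (hx j).1
    rw [← LieSuperalgebra.relCochain_swap hφ a.1 b.1 _ (fun j => (k j : ZMod 2)) hy
      (by simp [a.2]) (by simp [b.2])]
    congr 1
    funext j
    by_cases hja : j = a.1
    · subst hja; simp [a.2, b.2]
    by_cases hjb : j = b.1
    · subst hjb; simp [a.2, b.2]
    simp only [Function.comp_apply, Equiv.swap_apply_of_ne_of_ne hja hjb]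
    split_ifs with h
    · rw [Equiv.swap_apply_of_ne_of_ne (fun e => hja (congrArg Subtype.val e))
        (fun e => hjb (congrArg Subtype.val e))]
    · rfl
  have hdiag : ∀ u, F (fun _ => u) = 0 := by
    intro u
    obtain ⟨T, hT, hu, hD⟩ := exists_lowWeights u.2
    rw [hF]
    refine LieSuperalgebra.relCochain_lowWeights hφ hT (mem_part_zero hT) _
      (fun j => if k j = -1 then 0 else 1 - k j) (fun j => ?_) ?_
    · split_ifs with h
      · exact hu
      · exact hD _ _ (hx j)
    · have hle : ∀ j, (if k j = -1 then 0 else 1 - k j) ≤ 0 := fun j => by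
        have := h0 j; have := hlt j
        split_ifs with h <;> omega
      refine lt_of_lt_of_eq (Finset.sum_lt_sum (fun j _ => hle j) ⟨i, Finset.mem_univ i, ?_⟩)
        Finset.sum_const_zero
      have := h0 i; have := hlt i
      rw [if_neg h1]; omega
  have := hF fun j => ⟨x j, by have := hx j; rwa [j.2] at this⟩
  rw [hsymm.eq_zero_of_diag hdiag, zero_apply] at this
  rw [this]
  congr 1
  funext j
  simp

/-- A relative cochain vanishes as soon as one argument has degree different from `-1` and `1`. -/
theorem relCochain_eq_zero {φ : LieSuperalgebra.Form (W n) p}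
    (hφ : φ ∈ (lieSuperalgebra n).relCochain (degZero n) p) (x : Fin p → W n) (i : Fin p)
    (k : ℤ) (h1 : k ≠ -1) (h2 : k ≠ 1) (hx : x i ∈ deg n k) : φ x = 0 := by
  refine φ.eq_zero_of_mem_span
    (fun j => {D | (∃ l : ℤ, D ∈ deg n l) ∧ (j = i → D ∈ deg n k)}) (fun y hy => ?_) x fun j => ?_
  · have h : ∀ j, ∃ l : ℤ, y j ∈ deg n l ∧ (j = i → l = k) := fun j => by
      by_cases hj : j = i
      · exact ⟨k, (hy j).2 hj, fun _ => rfl⟩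
      · obtain ⟨l, hl⟩ := (hy j).1
        exact ⟨l, hl, fun h => absurd h hj⟩
    choose l hl hli using h
    exact relCochain_eq_zero_of_deg hφ hl (i := i) (by rwa [hli i rfl]) (by rwa [hli i rfl])
  · by_cases hj : j = i
    · subst hj
      exact Submodule.subset_span ⟨⟨k, hx⟩, fun _ => hx⟩
    · refine SetLike.le_def.1 (Submodule.span_mono ?_) (mem_span_deg (x j))
      rintro D ⟨l, _, hl⟩
      exact ⟨⟨l, hl⟩, fun h => absurd h hj⟩

theorem exists_projPM (n : ℕ) : ∃ π : W n →ₗ[ℂ] degPM n, (∀ x : degPM n, π x = x) ∧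
    ∀ k : ℤ, k ≠ -1 → k ≠ 1 → ∀ x ∈ deg n k, π x = 0 := by
  obtain ⟨π, h1, h2⟩ := exists_proj_of_eigen (M := W n) (bracket n (euler n)) (deg n)
    (fun k x hx => bracket_euler hx) (fun x => by
      refine (Submodule.span_le.2 ?_ : _ ≤ ⨆ k, deg n k) (mem_span_deg x)
      rintro D ⟨k, -, hD⟩
      exact Submodule.mem_iSup_of_mem k hD) {-1, 1} (degPM n) (by rw [iSup_pair]; rfl)
  exact ⟨π, h1, fun k hk hk' x hx => h2 k (by simp [hk, hk']) x hx⟩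

/-- The projection of `W(n)` onto `𝔤₋₁ ⊕ 𝔤₁` which kills the other homogeneous parts. -/
noncomputable def projPM (n : ℕ) : W n →ₗ[ℂ] degPM n := (exists_projPM n).choose

theorem projPM_apply (x : degPM n) : projPM n x = x := (exists_projPM n).choose_spec.1 x

theorem projPM_eq_zero {k : ℤ} (h1 : k ≠ -1) (h2 : k ≠ 1) {x : W n} (hx : x ∈ deg n k) :
    projPM n x = 0 := (exists_projPM n).choose_spec.2 k h1 h2 x hx

/-- The restriction of a form to `𝔤₋₁ ⊕ 𝔤₁`. -/
noncomputable def restrPM (φ : LieSuperalgebra.Form (W n) p) :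
    MultilinearMap ℂ (fun _ : Fin p => degPM n) ℂ :=
  φ.compLinearMap fun _ => (degPM n).subtype

theorem restrPM_apply (φ : LieSuperalgebra.Form (W n) p) (x : Fin p → degPM n) :
    restrPM φ x = φ fun i => (x i : W n) := rfl

theorem restrPM_isSymmForm {φ : LieSuperalgebra.Form (W n) p}
    (hφ : φ ∈ (lieSuperalgebra n).relCochain (degZero n) p) : IsSymmForm (restrPM φ) :=
  isSymmForm_of_swap fun i j x => LieSuperalgebra.relCochain_swap hφ i j (fun i => (x i : W n))
    (fun _ => 1) (fun k => mem_part_one (x k).2) rfl rfl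

/-- A form which vanishes outside of `𝔤₋₁ ⊕ 𝔤₁` is determined by its restriction. -/
theorem apply_eq_restrPM {φ : LieSuperalgebra.Form (W n) p}
    (hφ : ∀ (x : Fin p → W n) (i : Fin p) (k : ℤ), k ≠ -1 → k ≠ 1 → x i ∈ deg n k → φ x = 0)
    (x : Fin p → W n) : φ x = restrPM φ fun i => projPM n (x i) := by
  have h : (φ - (restrPM φ).compLinearMap fun _ => projPM n) x = 0 := by
    refine MultilinearMap.eq_zero_of_mem_span _ (fun _ => {D : W n | ∃ k : ℤ, -1 ≤ k ∧ D ∈ deg n k})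
      (fun y hy => ?_) x fun j => mem_span_deg (x j)
    choose k _ hk using hy
    rw [sub_apply, MultilinearMap.compLinearMap_apply, restrPM_apply]
    by_cases hb : ∃ i, k i ≠ -1 ∧ k i ≠ 1
    · obtain ⟨i, h1, h2⟩ := hb
      rw [hφ y i (k i) h1 h2 (hk i), zero_sub, neg_eq_zero]
      exact φ.map_coord_zero i (by rw [projPM_eq_zero h1 h2 (hk i), Submodule.coe_zero])
    · push Not at hb
      rw [sub_eq_zero]
      congr 1
      funext i
      have hy : y i ∈ degPM n := by
        by_cases h1 : k i = -1
        · exact Submodule.mem_sup_left (by rw [← h1]; exact hk i)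
        · exact Submodule.mem_sup_right (by rw [← hb i h1]; exact hk i)
      exact (congrArg Subtype.val (projPM_apply ⟨y i, hy⟩)).symm
  rwa [sub_apply, sub_eq_zero] at h

end W

/-! ### The differential vanishes on relative cochains -/

/-- Moving the first argument of a symmetric form to the `m`-th position. -/
theorem IsSymmForm.cons_removeNth {q : ℕ} {U : Type*} [AddCommMonoid U] [Module ℂ U]
    {F : MultilinearMap ℂ (fun _ : Fin (q + 1) => U) ℂ} (hF : IsSymmForm F) (m : Fin (q + 1))
    (w : U) (y : Fin (q + 1) → U) :
    F (Fin.cons w (m.removeNth y)) = F (Function.update y m w) := by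
  rw [← hF m.cycleRange.symm (Function.update y m w)]
  congr 1
  funext l
  refine Fin.cases ?_ (fun l => ?_) l
  · simp
  · simp [Fin.removeNth]

theorem removeNth_succ_removeNth {q : ℕ} {α : Type*} (x : Fin (q + 2) → α) {i m : Fin (q + 1)}
    (h : i ≤ m) : i.removeNth (m.succ.removeNth x) = m.removeNth (i.castSucc.removeNth x) := by
  rw [Fin.removeNth_removeNth_eq_swap, Fin.predAbove_succ_of_le _ _ h,
    Fin.succAbove_of_castSucc_lt _ _ (Fin.castSucc_lt_succ_iff.2 h)]

namespace W

variable {n q : ℕ}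

/-- The endomorphism of `𝔤₋₁ ⊕ 𝔤₁` induced by the bracket with `D`. -/
noncomputable def bracketPM (D : W n) : degPM n →ₗ[ℂ] degPM n :=
  projPM n ∘ₗ (bracket n).flip D ∘ₗ (degPM n).subtype

theorem bracketPM_apply (D : W n) (u : degPM n) :
    bracketPM D u = projPM n (bracket n u D) := rfl

/-- The bracket with an even element is antisymmetric; the sign is written as a scalar so that it
passes through linear maps. -/
theorem bracket_even_comm {D x : W n} {a : ZMod 2} (hD : D ∈ part n 0) (hx : x ∈ part n a) :
    bracket n x D = (-1 : ℂ) • bracket n D x := by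
  have h := (lieSuperalgebra n).bracket_skew hx hD
  rw [mul_zero, superSign_zero, one_smul] at h
  exact h.trans (neg_one_smul ℂ (M := W n) _).symm

theorem bracketPM_degZero {z : W n} (hz : z ∈ deg n 0) (u : degPM n) :
    bracketPM z u = (-1 : ℂ) • adPM n ⟨z, hz⟩ u := by
  rw [bracketPM_apply, bracket_even_comm (mem_part_zero hz) (mem_part_one u.2), map_smul]
  congr 1
  exact projPM_apply (adPM n ⟨z, hz⟩ u)

/-- The action of `𝔤₀` on forms, for the restriction of a relative cochain to `𝔤₋₁ ⊕ 𝔤₁`. -/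
theorem formDer_restrPM_degZero {φ : LieSuperalgebra.Form (W n) q}
    (hφ : φ ∈ (lieSuperalgebra n).relCochain (degZero n) q) (z : deg n 0) :
    formDer (adPM n z) (restrPM φ) = 0 := by
  ext x
  rw [formDer_apply, zero_apply]
  have h := hφ.2.2 0 z.1 z.2 (mem_part_zero z.2) (fun _ => 1) (fun i => (x i : W n))
    (fun i => mem_part_one (x i).2)
  simp only [zero_mul, superSign_zero, one_mul] at h
  rw [← h]
  refine Finset.sum_congr rfl fun i _ => ?_
  rw [restrPM_apply]
  congr 1
  funext j
  rcases eq_or_ne j i with rfl | hj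
  · simp [adPM]; rfl
  · simp [hj]

/-- On the restriction of a relative cochain to `𝔤₋₁ ⊕ 𝔤₁` the bracket with an element of degree
`0` or `2` acts by zero: by invariance in degree `0`, by weights on the diagonal in degree `2`. -/
theorem formDer_bracketPM {φ : LieSuperalgebra.Form (W n) q}
    (hφ : φ ∈ (lieSuperalgebra n).relCochain (degZero n) q) {k : ℤ} (hk : k = 0 ∨ k = 2) {D : W n}
    (hD : D ∈ deg n k) : formDer (bracketPM D) (restrPM φ) = 0 := by
  refine ((restrPM_isSymmForm hφ).formDer _).eq_zero_of_diag fun u => ?_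
  rcases hk with rfl | rfl
  · have h := congrArg (fun F => F fun _ => u) (formDer_restrPM_degZero hφ ⟨D, hD⟩)
    simp only [zero_apply, formDer_apply] at h
    rw [formDer_apply]
    simp only [bracketPM_degZero hD, MultilinearMap.map_update_smul, ← Finset.smul_sum]
    rw [h, smul_zero]
  · rw [formDer_apply]
    refine Finset.sum_eq_zero fun i _ => ?_
    obtain ⟨y, hy, c, hc, hyc⟩ := Submodule.mem_sup.1 u.2
    obtain ⟨T, hT, hyT, hDT⟩ := exists_lowWeights hy
    have hu : (u : W n) ∈ (lieSuperalgebra n).lowWeights T 0 := by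
      have h1 := hDT 1 c hc
      rw [sub_self] at h1
      rw [← hyc]
      exact add_mem hyT h1
    have hb := LieSuperalgebra.bracket_mem_lowWeights (𝔤 := lieSuperalgebra n) (mem_part_zero hT) hu
      (hDT 2 D hD)
    have h0 : φ (Function.update (fun _ => (u : W n)) i (bracket n u D)) = 0 := by
      refine LieSuperalgebra.relCochain_lowWeights hφ hT (mem_part_zero hT) _
        (Function.update (fun _ => 0) i (-1)) (fun j => ?_) ?_
      · rcases eq_or_ne j i with rfl | hj
        · rw [Function.update_self, Function.update_self]
          exact hb
        · simpa [hj] using hu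
      · simp [Finset.sum_update_of_mem]
    rw [apply_eq_restrPM (relCochain_eq_zero hφ)] at h0
    rw [← h0]
    congr 1
    funext j
    rcases eq_or_ne j i with rfl | hj
    · simp [bracketPM_apply]
    · simp [hj, projPM_apply]

theorem sum_parity_lt {e : Fin q → ZMod 2} {i : Fin q} (h : ∀ k < i, e k = 1) :
    ∑ k ∈ Finset.univ.filter (· < i), e k = (i.val : ZMod 2) := by
  rw [Finset.sum_congr rfl fun k hk => h k (Finset.mem_filter.1 hk).2]
  rw [Finset.sum_const, show (Finset.univ.filter (· < i)) = Finset.Iio i by ext; simp,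
    Fin.card_Iio, nsmul_one]

/-- The terms of the differential vanish unless the arguments outside of the bracket have degree
`-1` or `1`, and so does the bracket. -/
theorem diff_term_eq_zero {φ : LieSuperalgebra.Form (W n) (q + 1)}
    (hφ : φ ∈ (lieSuperalgebra n).relCochain (degZero n) (q + 1)) {x : Fin (q + 2) → W n}
    {k : Fin (q + 2) → ℤ} (hx : ∀ j, x j ∈ deg n (k j)) {j : Fin (q + 2)} {i : Fin (q + 1)}
    (hij : i.castSucc < j)
    (h : (k i.castSucc + k j ≠ -1 ∧ k i.castSucc + k j ≠ 1) ∨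
      ∃ l, l ≠ i.castSucc ∧ l ≠ j ∧ k l ≠ -1 ∧ k l ≠ 1) :
    φ (Fin.cons (bracket n (x i.castSucc) (x j)) (i.removeNth (j.removeNth x))) = 0 := by
  rcases h with ⟨h1, h2⟩ | ⟨l, hli, hlj, h1, h2⟩
  · exact relCochain_eq_zero hφ _ 0 _ h1 h2 (by
      rw [Fin.cons_zero]; exact bracket_mem_deg (hx _) (hx _))
  · obtain ⟨l', rfl⟩ := Fin.exists_succAbove_eq hlj
    have hl' : l' ≠ i := by
      rintro rfl
      exact hli (Fin.succAbove_of_castSucc_lt _ _ hij)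
    obtain ⟨m, rfl⟩ := Fin.exists_succAbove_eq hl'
    exact relCochain_eq_zero hφ _ m.succ _ h1 h2 (by
      rw [Fin.cons_succ]; exact hx _)

/-- The value of a cochain in terms of its symmetric restriction, where the order is irrelevant. -/
theorem restrPM_cons {φ : LieSuperalgebra.Form (W n) (q + 1)}
    (hφ : φ ∈ (lieSuperalgebra n).relCochain (degZero n) (q + 1)) (w : W n) (m : Fin (q + 1))
    (y : Fin (q + 1) → W n) :
    φ (Fin.cons w (m.removeNth y)) =
      restrPM φ (Function.update (fun l => projPM n (y l)) m (projPM n w)) := by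
  rw [apply_eq_restrPM (relCochain_eq_zero hφ),
    ← IsSymmForm.cons_removeNth (restrPM_isSymmForm hφ)]
  congr 1
  funext l
  exact Fin.cases rfl (fun l => rfl) l

section

variable {φ : LieSuperalgebra.Form (W n) (q + 1)} {x : Fin (q + 2) → W n}
  {e : Fin (q + 2) → ZMod 2} {a : Fin (q + 2)}

/-- The term of the differential for a pair `(m, a)`, where `x a` is the only even argument. -/
theorem diff_term_left (hφ : φ ∈ (lieSuperalgebra n).relCochain (degZero n) (q + 1))
    (hpm : ∀ l ≠ a, x l ∈ degPM n) (hea : e a = 0) (hel : ∀ l ≠ a, e l = 1)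
    {m : Fin (q + 1)} (hm : m.castSucc < a) :
    superSign (LieSuperalgebra.diffExponent e m.castSucc a) *
        φ (Fin.cons (bracket n (x m.castSucc) (x a)) (m.removeNth (a.removeNth x))) =
      superSign (a.val : ZMod 2) * restrPM φ (Function.update
        (fun l => projPM n (a.removeNth x l)) m
        (bracketPM (x a) (projPM n (a.removeNth x m)))) := by
  have hs : LieSuperalgebra.diffExponent e m.castSucc a = (a.val : ZMod 2) := by
    have h := sum_parity_lt (e := e) (i := m.castSucc) fun l hl => hel l (hl.trans hm).ne
    rw [LieSuperalgebra.diffExponent, h, hea, hel _ hm.ne, one_mul, zero_mul, add_zero,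
      add_right_comm, CharTwo.add_self_eq_zero, zero_add]
  have hy : (projPM n (a.removeNth x m) : W n) = x m.castSucc := by
    have h := congrArg Subtype.val (projPM_apply ⟨_, hpm _ hm.ne⟩)
    rw [Fin.removeNth_apply, Fin.succAbove_of_castSucc_lt _ _ hm]
    exact h
  rw [hs, restrPM_cons hφ, bracketPM_apply, hy]

/-- The term of the differential for a pair `(a, m + 1)`, where `x a` is the only even
argument. -/
theorem diff_term_right (hφ : φ ∈ (lieSuperalgebra n).relCochain (degZero n) (q + 1))
    (hpm : ∀ l ≠ a, x l ∈ degPM n) (hea : e a = 0) (hel : ∀ l ≠ a, e l = 1)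
    (hxa : x a ∈ part n 0) {m i : Fin (q + 1)} (hi : i.castSucc = a) (hm : i.castSucc < m.succ) :
    superSign (LieSuperalgebra.diffExponent e i.castSucc m.succ) *
        φ (Fin.cons (bracket n (x i.castSucc) (x m.succ)) (i.removeNth (m.succ.removeNth x))) =
      superSign (a.val : ZMod 2) * restrPM φ (Function.update
        (fun l => projPM n (a.removeNth x l)) m
        (bracketPM (x a) (projPM n (a.removeNth x m)))) := by
  have him : m.succ ≠ a := by rw [← hi]; exact hm.ne'
  have hle : i ≤ m := Fin.castSucc_lt_succ_iff.1 hm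
  have hs : LieSuperalgebra.diffExponent e i.castSucc m.succ = (a.val : ZMod 2) + 1 := by
    have h : ∑ l ∈ Finset.univ.filter (· < m.succ), e l = (m.val : ZMod 2) := by
      have h' := sum_parity_lt (e := Function.update e a 1) (i := m.succ) fun l _ => by
        rcases eq_or_ne l a with rfl | h
        · simp
        · simp [h, hel l h]
      rw [Finset.sum_update_of_mem (by simpa [← hi] using hm), Finset.sdiff_singleton_eq_erase,
        Fin.val_succ, Nat.cast_succ, add_comm] at h'
      rw [← Finset.add_sum_erase _ _ (show a ∈ _ by simpa [← hi] using hm), hea, zero_add]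
      exact add_right_cancel h'
    rw [LieSuperalgebra.diffExponent, h, hi, hea, hel _ him, zero_mul, one_mul, add_zero,
      add_zero, Fin.val_succ, Nat.cast_succ, add_assoc, add_right_comm _ (1 : ZMod 2),
      CharTwo.add_self_eq_zero, zero_add]
  have hr : i.removeNth (m.succ.removeNth x) = m.removeNth (a.removeNth x) := by
    rw [← hi]
    exact removeNth_succ_removeNth x hle
  have hy : (projPM n (a.removeNth x m) : W n) = x m.succ := by
    have h := congrArg Subtype.val (projPM_apply ⟨_, hpm _ him⟩)
    rw [Fin.removeNth_apply, Fin.succAbove_of_lt_succ _ _ (hi ▸ hm)]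
    exact h
  have hb : projPM n (bracket n (x a) (x m.succ)) =
      (-1 : ℂ) • projPM n (bracket n (x m.succ) (x a)) := by
    rw [bracket_even_comm hxa (mem_part_one (hpm _ him)), (projPM n).map_smul, smul_smul]
    norm_num
  have hv := restrPM_cons hφ (bracket n (x a) (x m.succ)) m (a.removeNth x)
  rw [hb, MultilinearMap.map_update_smul, ← hr, smul_eq_mul] at hv
  have hR : bracketPM (x a) (projPM n (a.removeNth x m)) =
      projPM n (bracket n (x m.succ) (x a)) := by
    rw [bracketPM_apply, hy]
  rw [hR, hs, superSign_add, superSign_one]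
  subst hi
  refine (congrArg _ hv).trans ?_
  ring

set_option maxHeartbeats 600000 in
/-- If `x a` has degree `0` or `2` and the other arguments have degree `-1` or `1`, then up to a
common sign the differential is `∑ m, φ (…, [x m, x a], …)`. -/
theorem diff_sum_eq_zero (hφ : φ ∈ (lieSuperalgebra n).relCochain (degZero n) (q + 1))
    {k : Fin (q + 2) → ℤ} (hx : ∀ j, x j ∈ deg n (k j)) (ha : k a ≠ -1 ∧ k a ≠ 1)
    (ha' : k a = 0 ∨ k a = 2) (hl : ∀ l ≠ a, k l = -1 ∨ k l = 1)
    (hek : ∀ j, e j = (k j : ZMod 2)) :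
    ∑ j : Fin (q + 2), ∑ i ∈ Finset.univ.filter (fun i : Fin (q + 1) => i.castSucc < j),
      superSign (LieSuperalgebra.diffExponent e i.castSucc j) *
        φ (Fin.cons (bracket n (x i.castSucc) (x j)) (i.removeNth (j.removeNth x))) = 0 := by
  have hea : e a = 0 := by
    rw [hek]
    rcases ha' with h | h <;> rw [h] <;> decide
  have hel : ∀ l ≠ a, e l = 1 := fun l h => by
    rw [hek]
    rcases hl l h with h | h <;> rw [h] <;> decide
  have hpm : ∀ l ≠ a, x l ∈ degPM n := fun l h => by
    have := hx l
    rcases hl l h with h | h <;> rw [h] at this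
    · exact Submodule.mem_sup_left this
    · exact Submodule.mem_sup_right this
  have hxa : x a ∈ part n 0 := by
    rw [← hea, hek]
    exact (hx a).1
  have hG0 := congrArg (fun F => F fun l => projPM n (a.removeNth x l))
    (formDer_bracketPM hφ ha' (hx a))
  simp only [formDer_apply, zero_apply] at hG0
  have h3 : ∀ m i : Fin (q + 1), i.castSucc ≠ a → i.castSucc < a.succAbove m →
      φ (Fin.cons (bracket n (x i.castSucc) (x (a.succAbove m)))
        (i.removeNth ((a.succAbove m).removeNth x))) = 0 := fun m i hi hm =>
    diff_term_eq_zero hφ hx hm (Or.inr ⟨a, hi.symm, (Fin.succAbove_ne a m).symm, ha⟩)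
  rw [Fin.sum_univ_succAbove _ a, Finset.sum_congr rfl fun m hm =>
      diff_term_left hφ hpm hea hel (Finset.mem_filter.1 hm).2,
    ← mul_zero (superSign (a.val : ZMod 2)), ← hG0, Finset.mul_sum, Finset.sum_filter,
    ← Finset.sum_add_distrib]
  refine Finset.sum_congr rfl fun m _ => ?_
  by_cases hm : m.castSucc < a
  · rw [if_pos hm, Finset.sum_eq_zero, add_zero]
    intro i hi
    have hi' := (Finset.mem_filter.1 hi).2
    refine mul_eq_zero_of_right _ (h3 m i (fun h => ?_) hi')
    rw [Fin.succAbove_of_castSucc_lt _ _ hm, h] at hi'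
    exact lt_asymm hm hi'
  · have hm' : a < m.succ := Fin.le_castSucc_iff.1 (not_lt.1 hm)
    have ham : a.succAbove m = m.succ := Fin.succAbove_of_lt_succ _ _ hm'
    have hlast : a ≠ Fin.last _ := (hm'.trans_le (Fin.le_last _)).ne
    have hca : (a.castPred hlast).castSucc = a := Fin.castSucc_castPred _ _
    rw [if_neg hm, zero_add, Finset.sum_eq_single (a.castPred hlast)]
    · rw [ham]
      exact diff_term_right hφ hpm hea hel hxa hca (by rwa [hca])
    · intro i hi hne
      refine mul_eq_zero_of_right _ (h3 m i (fun h => hne ?_) (Finset.mem_filter.1 hi).2)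
      rw [← Fin.castSucc_inj, h, hca]
    · intro h
      exact absurd (Finset.mem_filter.2 ⟨Finset.mem_univ _, by rwa [hca, ham]⟩) h

end

/-- The differentials of the relative cochain complex vanish: a term for which the bracket and the
remaining arguments all have degree `-1` or `1` exists only in the situation of
`diff_sum_eq_zero`. -/
theorem d_eq_zero {p : ℕ} {φ : LieSuperalgebra.Form (W n) p}
    (hφ : φ ∈ (lieSuperalgebra n).relCochain (degZero n) p) :
    (lieSuperalgebra n).d p φ = 0 := by
  cases p with
  | zero => rfl
  | succ q =>
  ext x
  rw [zero_apply]
  refine MultilinearMap.eq_zero_of_mem_span _ (fun _ => {D : W n | ∃ k : ℤ, -1 ≤ k ∧ D ∈ deg n k})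
    (fun x hx => ?_) x fun j => mem_span_deg (x j)
  choose k hk hx using hx
  rw [LieSuperalgebra.d_apply _ _ (e := fun j => (k j : ZMod 2)) fun j => (hx j).1]
  by_cases hbad : ∃ a, (k a ≠ -1 ∧ k a ≠ 1) ∧ (k a = 0 ∨ k a = 2) ∧
      ∀ l ≠ a, k l = -1 ∨ k l = 1
  · obtain ⟨a, ha, ha', hl⟩ := hbad
    exact diff_sum_eq_zero hφ hx ha ha' hl fun _ => rfl
  · refine Finset.sum_eq_zero fun j _ => Finset.sum_eq_zero fun i hi => ?_
    have hij := (Finset.mem_filter.1 hi).2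
    refine mul_eq_zero_of_right _ (diff_term_eq_zero hφ hx hij ?_)
    by_contra! hcon
    obtain ⟨h1, h2⟩ := hcon
    apply hbad
    have hi' := hk i.castSucc
    have hj' := hk j
    by_cases hki : k i.castSucc = -1 ∨ k i.castSucc = 1
    · refine ⟨j, by omega, by omega, fun l hl => ?_⟩
      by_cases hli : l = i.castSucc
      · rwa [hli]
      · have := h2 l hli hl
        omega
    · refine ⟨i.castSucc, by omega, by omega, fun l hl => ?_⟩
      by_cases hlj : l = j
      · subst hlj
        omega
      · have := h2 l hl hlj
        omega

end W

/-! ### The cohomology ring as a ring of invariants -/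

section SymDer

variable {M : Type*} [AddCommGroup M] [Module ℂ M]

/-- A derivation of a symmetric algebra is determined by its values on generators. -/
theorem symDer_unique {f : M →ₗ[ℂ] M}
    {D : Derivation ℂ (SymmetricAlgebra ℂ M) (SymmetricAlgebra ℂ M)}
    (h : ∀ m, D (SymmetricAlgebra.ι ℂ M m) = SymmetricAlgebra.ι ℂ M (f m)) : D = symDer f := by
  refine Derivation.ext fun s => ?_
  induction s using SymmetricAlgebra.induction with
  | algebraMap r => rw [Derivation.map_algebraMap, Derivation.map_algebraMap]
  | ι m => rw [h, symDer_ι]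
  | add s t hs ht => rw [map_add, map_add, hs, ht]
  | mul s t hs ht => rw [Derivation.leibniz, Derivation.leibniz, hs, ht]

theorem symDer_neg (f : M →ₗ[ℂ] M) : symDer (-f) = -symDer f :=
  (symDer_unique fun m => by
    rw [Derivation.neg_apply, symDer_ι, LinearMap.neg_apply, map_neg]).symm

theorem mem_symDerInvariants_neg {I : Type*} {f : I → M →ₗ[ℂ] M} {s : SymmetricAlgebra ℂ M} :
    s ∈ symDerInvariants (fun i => -f i) ↔ ∀ i, symDer (f i) s = 0 := by
  refine forall_congr' fun i => ?_
  rw [symDer_neg, Derivation.neg_apply, neg_eq_zero]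

end SymDer

section SymOfForm

variable {U : Type*} [AddCommMonoid U] [Module ℂ U] [Module.Finite ℂ U] [Module.Free ℂ U]
  {p q : ℕ}

theorem symDer_symOfForm_eq_zero {F : MultilinearMap ℂ (fun _ : Fin p => U) ℂ}
    (hF : IsSymmForm F) {A : U →ₗ[ℂ] U} :
    symDer A.dualMap (symOfForm p F) = 0 ↔ formDer A F = 0 := by
  rw [symDer_symOfForm]
  exact ⟨fun h => (hF.formDer _).eq_zero_of_symOfForm h, fun h => by rw [h, map_zero]⟩

/-- The normalization of `symOfForm` by factorials turns the sum over all shuffles into the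
product. -/
theorem symOfForm_shuffle {F : MultilinearMap ℂ (fun _ : Fin p => U) ℂ}
    {G : MultilinearMap ℂ (fun _ : Fin q => U) ℂ}
    {H : MultilinearMap ℂ (fun _ : Fin (p + q) => U) ℂ}
    (h : ∀ u, H (fun _ => u) = ∑ _S : {S : Finset (Fin (p + q)) // S.card = p},
      F (fun _ => u) * G (fun _ => u)) :
    symOfForm (p + q) H = symOfForm p F * symOfForm q G := by
  refine symEval_injective fun u => ?_
  rw [map_mul, symEval_symOfForm, symEval_symOfForm, symEval_symOfForm, h]
  have hc : Fintype.card {S : Finset (Fin (p + q)) // S.card = p} = (p + q).choose p := by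
    rw [Fintype.card_finset_len, Fintype.card_fin]
  rw [Finset.sum_const, Finset.card_univ, hc, nsmul_eq_mul,
    ← Nat.add_choose_mul_factorial_mul_factorial p q, ← Nat.choose_symm_add]
  have h1 : (p.factorial : ℂ) ≠ 0 := Nat.cast_ne_zero.2 p.factorial_ne_zero
  have h2 : (q.factorial : ℂ) ≠ 0 := Nat.cast_ne_zero.2 q.factorial_ne_zero
  have h3 : (((p + q).choose p : ℕ) : ℂ) ≠ 0 :=
    Nat.cast_ne_zero.2 (Nat.choose_pos (Nat.le_add_right p q)).ne'
  push_cast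
  field_simp

end SymOfForm

/-- A symmetric form takes the same value on two enumerations of the same arguments. -/
theorem IsSymmForm.comp_eq_of_range_eq {U : Type*} [AddCommMonoid U] [Module ℂ U] {p : ℕ}
    {ι : Type*} {F : MultilinearMap ℂ (fun _ : Fin p => U) ℂ} (hF : IsSymmForm F) (x : ι → U)
    {f g : Fin p → ι} (hf : Function.Injective f) (hg : Function.Injective g)
    (h : Set.range f = Set.range g) : F (x ∘ f) = F (x ∘ g) := by
  let σ : Equiv.Perm (Fin p) := (Equiv.ofInjective f hf).trans
    ((Equiv.setCongr h).trans (Equiv.ofInjective g hg).symm)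
  have hσ : ∀ i, g (σ i) = f i := fun i => by
    have := Equiv.apply_ofInjective_symm hg ((Equiv.setCongr h) (Equiv.ofInjective f hf i))
    exact this
  rw [← hF σ (x ∘ g)]
  congr 1
  funext i
  simp [hσ]

/-- The sum over all shuffles of the product of two symmetric forms is symmetric. -/
theorem sum_shuffle_comp_perm {U : Type*} [AddCommMonoid U] [Module ℂ U] {p q : ℕ}
    {F : MultilinearMap ℂ (fun _ : Fin p => U) ℂ} (hF : IsSymmForm F)
    {G : MultilinearMap ℂ (fun _ : Fin q => U) ℂ} (hG : IsSymmForm G) (x : Fin (p + q) → U)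
    (τ : Equiv.Perm (Fin (p + q))) :
    ∑ S : {S : Finset (Fin (p + q)) // S.card = p},
      F ((x ∘ τ) ∘ S.1.orderEmbOfFin S.2) *
        G ((x ∘ τ) ∘ S.1ᶜ.orderEmbOfFin (LieSuperalgebra.card_compl_of_card S.2)) =
    ∑ S : {S : Finset (Fin (p + q)) // S.card = p},
      F (x ∘ S.1.orderEmbOfFin S.2) *
        G (x ∘ S.1ᶜ.orderEmbOfFin (LieSuperalgebra.card_compl_of_card S.2)) := by
  let E : {S : Finset (Fin (p + q)) // S.card = p} ≃ {S : Finset (Fin (p + q)) // S.card = p} :=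
    (Equiv.finsetCongr τ).subtypeEquiv fun S => by simp
  have hE : ∀ S, (E S).1 = S.1.map τ.toEmbedding := fun S => rfl
  refine Eq.trans ?_ (Equiv.sum_comp E fun S : {S : Finset (Fin (p + q)) // S.card = p} =>
    F (x ∘ S.1.orderEmbOfFin S.2) *
      G (x ∘ S.1ᶜ.orderEmbOfFin (LieSuperalgebra.card_compl_of_card S.2)))
  refine Finset.sum_congr rfl fun S _ => ?_
  have hc : (E S).1ᶜ = S.1ᶜ.map τ.toEmbedding := by
    ext i
    simp [hE]
  congr 1
  · refine hF.comp_eq_of_range_eq x (f := τ ∘ S.1.orderEmbOfFin S.2)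
      (τ.injective.comp (RelEmbedding.injective _)) (RelEmbedding.injective _) ?_
    rw [Set.range_comp, Finset.range_orderEmbOfFin, Finset.range_orderEmbOfFin, hE]
    simp
  · refine hG.comp_eq_of_range_eq x
      (f := τ ∘ S.1ᶜ.orderEmbOfFin (LieSuperalgebra.card_compl_of_card S.2))
      (τ.injective.comp (RelEmbedding.injective _)) (RelEmbedding.injective _) ?_
    rw [Set.range_comp, Finset.range_orderEmbOfFin, Finset.range_orderEmbOfFin, hc]
    simp

namespace W

variable {n p q : ℕ}

theorem projPM_of_even {x : W n} (hx : x ∈ part n 0) : projPM n x = 0 := by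
  have h : ∀ D : W n, projPM n ((lieSuperalgebra n).proj 0 D) = 0 := by
    intro D
    have hD := mem_span_deg D
    induction hD using Submodule.span_induction with
    | mem D hD =>
      obtain ⟨k, -, hD⟩ := hD
      have h := parityProj_of_mem (L := W n) (part_isCompl n) hD.1 0
      rw [show (lieSuperalgebra n).proj 0 D = _ from h]
      split_ifs with hk
      · refine projPM_eq_zero (k := k) ?_ ?_ hD
        · rintro rfl; revert hk; decide
        · rintro rfl; revert hk; decide
      · exact map_zero _
    | zero => rw [map_zero, map_zero]
    | add D E _ _ hD hE => rw [map_add, map_add, hD, hE, add_zero]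
    | smul c D _ hD => rw [map_smul, map_smul, hD, smul_zero]
  have h' := parityProj_of_mem (L := W n) (part_isCompl n) hx 0
  rw [if_pos rfl] at h'
  rw [← h']
  exact h x

theorem projPM_bracket (z : deg n 0) (x : W n) :
    projPM n (bracket n z x) = adPM n z (projPM n x) := by
  refine LinearMap.eqOn_span' (f := projPM n ∘ₗ bracket n z.1) (g := adPM n z ∘ₗ projPM n) ?_ (mem_span_deg x)
  rintro D ⟨k, -, hD⟩
  change projPM n (bracket n z D) = adPM n z (projPM n D)
  by_cases hk : k ≠ -1 ∧ k ≠ 1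
  · have hb := bracket_mem_deg z.2 hD
    rw [zero_add] at hb
    rw [projPM_eq_zero hk.1 hk.2 hD, projPM_eq_zero hk.1 hk.2 hb]
    exact (adPM n z).map_zero.symm
  · have hD' : D ∈ degPM n := by
      by_cases h1 : k = -1
      · exact Submodule.mem_sup_left (by rw [← h1]; exact hD)
      · exact Submodule.mem_sup_right (by rw [show (1 : ℤ) = k by omega]; exact hD)
    have h1 : projPM n D = ⟨D, hD'⟩ := projPM_apply ⟨D, hD'⟩
    rw [h1]
    exact projPM_apply (adPM n z ⟨D, hD'⟩)

/-- A symmetric `𝔤₀`-invariant form on `𝔤₋₁ ⊕ 𝔤₁`, extended by zero, is a relative cochain. -/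
theorem extend_mem_relCochain {F : MultilinearMap ℂ (fun _ : Fin p => degPM n) ℂ}
    (hF : IsSymmForm F) (hinv : ∀ z : deg n 0, formDer (adPM n z) F = 0) :
    F.compLinearMap (fun _ => projPM n) ∈ (lieSuperalgebra n).relCochain (degZero n) p := by
  refine ⟨fun e x hx i j hij => ?_, fun x ⟨i, hi⟩ => ?_, fun a z hz hza e x hx => ?_⟩
  · by_cases h : e i = 1 ∧ e j = 1
    · rw [h.1, h.2, one_mul, superSign_one, neg_one_mul, neg_neg]
      exact (hF (Equiv.swap i j) fun l => projPM n (x l)).symm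
    · have h' : ∃ l, (l = i ∨ l = j) ∧ e l = 0 := by
        rcases zmod2_cases (e i) with h1 | h1
        · exact ⟨i, Or.inl rfl, h1⟩
        · rcases zmod2_cases (e j) with h2 | h2
          · exact ⟨j, Or.inr rfl, h2⟩
          · exact absurd ⟨h1, h2⟩ h
      obtain ⟨l, hl, hel⟩ := h'
      have h0 : projPM n (x l) = 0 := projPM_of_even (hel ▸ hx l)
      have h1 : F.compLinearMap (fun _ => projPM n) x = 0 := F.map_coord_zero l h0
      have h2 : F.compLinearMap (fun _ => projPM n) (x ∘ Equiv.swap i j) = 0 :=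
        F.map_coord_zero (Equiv.swap i j l) (by simpa using h0)
      rw [h1, h2, mul_zero, neg_zero]
  · exact F.map_coord_zero i (projPM_eq_zero (by norm_num) (by norm_num) hi)
  · rcases zmod2_cases a with rfl | rfl
    · have h := congrArg (fun F => F fun i => projPM n (x i)) (hinv ⟨z, hz⟩)
      simp only [formDer_apply, zero_apply] at h
      rw [← h]
      refine Finset.sum_congr rfl fun i _ => ?_
      rw [zero_mul, superSign_zero, one_mul, MultilinearMap.compLinearMap_apply]
      congr 1
      funext j
      rcases eq_or_ne j i with rfl | hj
      · rw [Function.update_self, Function.update_self]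
        exact projPM_bracket ⟨z, hz⟩ (x j)
      · rw [Function.update_of_ne hj, Function.update_of_ne hj]
    · have hz0 : z = 0 := by
        have := Submodule.disjoint_def.1 (part_isCompl n).disjoint z (mem_part_zero hz) hza
        exact this
      refine Finset.sum_eq_zero fun i _ => mul_eq_zero_of_right _ ?_
      refine MultilinearMap.map_coord_zero _ i ?_
      rw [Function.update_self, hz0]
      exact LinearMap.map_zero₂ (bracket n) (x i)

theorem restrPM_extend (F : MultilinearMap ℂ (fun _ : Fin p => degPM n) ℂ) :
    restrPM (F.compLinearMap fun _ => projPM n) = F := by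
  ext x
  rw [restrPM_apply, MultilinearMap.compLinearMap_apply]
  congr 1
  funext i
  exact projPM_apply (x i)

theorem restrPM_injective {φ ψ : LieSuperalgebra.Form (W n) p}
    (hφ : ∀ (x : Fin p → W n) (i : Fin p) (k : ℤ), k ≠ -1 → k ≠ 1 → x i ∈ deg n k → φ x = 0)
    (hψ : ∀ (x : Fin p → W n) (i : Fin p) (k : ℤ), k ≠ -1 → k ≠ 1 → x i ∈ deg n k → ψ x = 0)
    (h : restrPM φ = restrPM ψ) : φ = ψ := by
  ext x
  rw [apply_eq_restrPM hφ, apply_eq_restrPM hψ, h]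

theorem mem_lieInvariants {s : SymPM n} :
    s ∈ lieInvariants n ↔ ∀ z : deg n 0, symDer (adPM n z).dualMap s = 0 :=
  mem_symDerInvariants_neg

theorem symOfForm_mem_lieInvariants {F : MultilinearMap ℂ (fun _ : Fin p => degPM n) ℂ}
    (hF : IsSymmForm F) :
    symOfForm p F ∈ lieInvariants n ↔ ∀ z : deg n 0, formDer (adPM n z) F = 0 :=
  mem_lieInvariants.trans (forall_congr' fun _ => symDer_symOfForm_eq_zero hF)

/-! ### Cup products -/

/-- Like its factors, the cup product vanishes outside of `𝔤₋₁ ⊕ 𝔤₁`. -/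
theorem cup_eq_zero {φ : LieSuperalgebra.Form (W n) p} {ψ : LieSuperalgebra.Form (W n) q}
    (hφ : φ ∈ (lieSuperalgebra n).relCochain (degZero n) p)
    (hψ : ψ ∈ (lieSuperalgebra n).relCochain (degZero n) q) (x : Fin (p + q) → W n)
    (i : Fin (p + q)) (k : ℤ) (h1 : k ≠ -1) (h2 : k ≠ 1) (hx : x i ∈ deg n k) :
    (lieSuperalgebra n).cup φ ψ x = 0 := by
  rw [LieSuperalgebra.cup, sum_apply]
  refine Finset.sum_eq_zero fun e _ => ?_
  rw [LieSuperalgebra.homPart, MultilinearMap.compLinearMapₗ_apply,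
    MultilinearMap.compLinearMap_apply, sum_apply]
  refine Finset.sum_eq_zero fun S _ => ?_
  rw [smul_apply, LieSuperalgebra.splitTerm_apply]
  have hi : (lieSuperalgebra n).proj (e i) (x i) ∈ deg n k := by
    have h := parityProj_of_mem (L := W n) (part_isCompl n) hx.1 (e i)
    rw [show (lieSuperalgebra n).proj (e i) (x i) = _ from h]
    split_ifs
    · exact hx
    · exact Submodule.zero_mem _
  refine smul_eq_zero_of_right _ ?_
  by_cases hS : i ∈ S.1
  · obtain ⟨l, rfl⟩ : ∃ l, S.1.orderEmbOfFin S.2 l = i := by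
      rw [← Set.mem_range, Finset.range_orderEmbOfFin]; exact hS
    rw [relCochain_eq_zero hφ _ l k h1 h2 hi, zero_mul]
  · obtain ⟨l, rfl⟩ : ∃ l, S.1ᶜ.orderEmbOfFin (LieSuperalgebra.card_compl_of_card S.2) l = i := by
      rw [← Set.mem_range, Finset.range_orderEmbOfFin]; simpa using hS
    rw [relCochain_eq_zero hψ _ l k h1 h2 hi, mul_zero]

/-- On odd arguments all signs in the cup product are `1`. -/
theorem restrPM_cup (φ : LieSuperalgebra.Form (W n) p) (ψ : LieSuperalgebra.Form (W n) q)
    (x : Fin (p + q) → degPM n) :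
    restrPM ((lieSuperalgebra n).cup φ ψ) x = ∑ S : {S : Finset (Fin (p + q)) // S.card = p},
      restrPM φ (x ∘ S.1.orderEmbOfFin S.2) *
        restrPM ψ (x ∘ S.1ᶜ.orderEmbOfFin (LieSuperalgebra.card_compl_of_card S.2)) := by
  refine (LieSuperalgebra.cup_apply (lieSuperalgebra n) φ ψ (x := fun i => (x i : W n))
    (e := fun _ => 1) fun i => mem_part_one (x i).2).trans ?_
  refine Finset.sum_congr rfl fun S _ => ?_
  have h : LieSuperalgebra.shuffleExponent (fun _ => 1) S.1 = 0 := by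
    simp [LieSuperalgebra.shuffleExponent, zmod2_one_add_one]
  rw [h, superSign_zero, one_mul]
  rfl

theorem restrPM_cup_isSymmForm {φ : LieSuperalgebra.Form (W n) p}
    {ψ : LieSuperalgebra.Form (W n) q}
    (hφ : φ ∈ (lieSuperalgebra n).relCochain (degZero n) p)
    (hψ : ψ ∈ (lieSuperalgebra n).relCochain (degZero n) q) :
    IsSymmForm (restrPM ((lieSuperalgebra n).cup φ ψ)) := by
  intro τ x
  rw [restrPM_cup, restrPM_cup]
  exact sum_shuffle_comp_perm (restrPM_isSymmForm hφ) (restrPM_isSymmForm hψ) x τ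

theorem symOfForm_restrPM_cup (φ : LieSuperalgebra.Form (W n) p)
    (ψ : LieSuperalgebra.Form (W n) q) :
    symOfForm (p + q) (restrPM ((lieSuperalgebra n).cup φ ψ)) =
      symOfForm p (restrPM φ) * symOfForm q (restrPM ψ) :=
  symOfForm_shuffle fun u => restrPM_cup φ ψ fun _ => u

theorem symOfForm_restrPM_mem {φ : LieSuperalgebra.Form (W n) p}
    (hφ : φ ∈ (lieSuperalgebra n).relCochain (degZero n) p) :
    symOfForm p (restrPM φ) ∈ lieInvariants n :=
  (symOfForm_mem_lieInvariants (restrPM_isSymmForm hφ)).2 (formDer_restrPM_degZero hφ)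

/-- The cup product is the extension by zero of its restriction to `𝔤₋₁ ⊕ 𝔤₁`, and the restriction is
symmetric and invariant. -/
theorem cup_mem_relCochain {φ : LieSuperalgebra.Form (W n) p} {ψ : LieSuperalgebra.Form (W n) q}
    (hφ : φ ∈ (lieSuperalgebra n).relCochain (degZero n) p)
    (hψ : ψ ∈ (lieSuperalgebra n).relCochain (degZero n) q) :
    (lieSuperalgebra n).cup φ ψ ∈ (lieSuperalgebra n).relCochain (degZero n) (p + q) := by
  have hs := restrPM_cup_isSymmForm hφ hψ
  have hm : symOfForm (p + q) (restrPM ((lieSuperalgebra n).cup φ ψ)) ∈ lieInvariants n := by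
    rw [symOfForm_restrPM_cup]
    exact mul_mem (symOfForm_restrPM_mem hφ) (symOfForm_restrPM_mem hψ)
  have hmem := extend_mem_relCochain hs ((symOfForm_mem_lieInvariants hs).1 hm)
  rwa [← restrPM_injective (cup_eq_zero hφ hψ) (relCochain_eq_zero hmem)
    (restrPM_extend _).symm] at hmem

end W

/-! ### The cohomology ring -/

namespace LieSuperalgebra

variable {L : Type*} [AddCommGroup L] [Module ℂ L] {𝔤 : LieSuperalgebra L} {𝔱 : 𝔤.Sub}

theorem mem_relCocycle_of_d_eq_zero
    (hd : ∀ (p : ℕ), ∀ φ ∈ 𝔤.relCochain 𝔱 p, 𝔤.d p φ = 0) {p : ℕ} {φ : Form L p}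
    (hφ : φ ∈ 𝔤.relCochain 𝔱 p) : φ ∈ 𝔤.relCocycle 𝔱 p :=
  ⟨hφ, hd p φ hφ⟩

theorem relCoboundary_eq_bot (hd : ∀ (p : ℕ), ∀ φ ∈ 𝔤.relCochain 𝔱 p, 𝔤.d p φ = 0) (p : ℕ) :
    𝔤.relCoboundary 𝔱 p = ⊥ := by
  cases p with
  | zero => rfl
  | succ p =>
    refine (Submodule.eq_bot_iff _).2 ?_
    rintro _ ⟨φ, hφ, rfl⟩
    exact hd p φ hφ

/-- If the differentials vanish, linear maps on cochains induce maps on cohomology. -/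
theorem exists_relCohomology_map {X : Type*} [AddCommGroup X] [Module ℂ X]
    (hd : ∀ (p : ℕ), ∀ φ ∈ 𝔤.relCochain 𝔱 p, 𝔤.d p φ = 0) (g : ∀ p, Form L p →ₗ[ℂ] X)
    (hg : ∀ (p : ℕ), ∀ φ ∈ 𝔤.relCochain 𝔱 p, g p φ = 0 → φ = 0) :
    ∃ f : ∀ p, 𝔤.RelCohomology 𝔱 p →ₗ[ℂ] X,
      (∀ p φ (hφ : φ ∈ 𝔤.relCocycle 𝔱 p), f p (Submodule.Quotient.mk ⟨φ, hφ⟩) = g p φ) ∧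
      ∀ p, Function.Injective (f p) := by
  have hB : ∀ p, (𝔤.relCoboundary 𝔱 p).submoduleOf (𝔤.relCocycle 𝔱 p) ≤
      LinearMap.ker (g p ∘ₗ (𝔤.relCocycle 𝔱 p).subtype) := by
    intro p φ hφ
    have h : φ.1 ∈ 𝔤.relCoboundary 𝔱 p := hφ
    rw [relCoboundary_eq_bot hd] at h
    have h0 : φ.1 = 0 := h
    change g p φ.1 = 0
    rw [h0, map_zero]
  refine ⟨fun p => Submodule.liftQ _ _ (hB p), fun p φ hφ => rfl, fun p => ?_⟩
  rw [← LinearMap.ker_eq_bot, Submodule.eq_bot_iff]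
  intro c hc
  induction c using Submodule.Quotient.induction_on with
  | H φ =>
    have h0 : φ = 0 := Subtype.ext (hg p φ.1 φ.2.1 hc)
    rw [h0]
    exact Submodule.Quotient.mk_zero _

end LieSuperalgebra

section

variable {U : Type*} [AddCommMonoid U] [Module ℂ U] [Module.Finite ℂ U] [Module.Free ℂ U]

/-- Injective maps into the homogeneous parts `S^p(U^*)` whose images span a subalgebra `N` assemble to
an isomorphism from the direct sum onto `N`. -/
theorem exists_linearEquiv_directSum {H : ℕ → Type*} [∀ p, AddCommGroup (H p)]
    [∀ p, Module ℂ (H p)] (f : ∀ p, H p →ₗ[ℂ] SymmetricAlgebra ℂ (Module.Dual ℂ U))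
    (hinj : ∀ p, Function.Injective (f p)) (hdeg : ∀ p c, f p c ∈ symPow (Module.Dual ℂ U) p)
    (N : Subalgebra ℂ (SymmetricAlgebra ℂ (Module.Dual ℂ U))) (hN : ∀ p c, f p c ∈ N)
    (hsurj : ∀ s ∈ N, s ∈ ⨆ p, LinearMap.range (f p)) :
    ∃ Φ : (⨁ p, H p) ≃ₗ[ℂ] N, ∀ p c,
      (Φ (DirectSum.lof ℂ ℕ H p c) : SymmetricAlgebra ℂ (Module.Dual ℂ U)) = f p c := by
  classical
  let g : (⨁ p, H p) →ₗ[ℂ] N := DirectSum.toModule ℂ ℕ N fun p =>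
    LinearMap.codRestrict (Subalgebra.toSubmodule N) (f p) (hN p)
  have hg : ∀ p c, (g (DirectSum.lof ℂ ℕ H p c) : SymmetricAlgebra ℂ (Module.Dual ℂ U)) = f p c :=
    fun p c => by simp only [g, DirectSum.toModule_lof]; rfl
  have hsum : ∀ c, (g c : SymmetricAlgebra ℂ (Module.Dual ℂ U)) =
      ∑ p ∈ DFinsupp.support c, f p (c p) := fun c => by
    conv_lhs => rw [← DirectSum.sum_support_of c]
    rw [map_sum, AddSubmonoidClass.coe_finsetSum]
    exact Finset.sum_congr rfl fun p _ => hg p (c p)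
  have hbij : Function.Bijective g := by
    constructor
    · rw [← LinearMap.ker_eq_bot, Submodule.eq_bot_iff]
      intro c hc
      have h0 : ∑ p ∈ DFinsupp.support c, f p (c p) = 0 := by
        rw [← hsum, LinearMap.mem_ker.1 hc]; rfl
      have := symPow_eq_zero_of_sum _ (fun p => f p (c p)) (fun p => hdeg p _) h0
      refine DFinsupp.ext fun p => ?_
      by_cases hp : p ∈ DFinsupp.support c
      · exact hinj p ((this p hp).trans (map_zero _).symm)
      · exact DFinsupp.notMem_support_iff.1 hp
    · rintro ⟨s, hs⟩
      obtain ⟨t, ht, hts⟩ := (Submodule.mem_iSup_iff_exists_finsupp _ _).1 (hsurj s hs)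
      choose c hc using ht
      refine ⟨∑ p ∈ t.support, DirectSum.lof ℂ ℕ H p (c p), Subtype.ext ?_⟩
      rw [map_sum, AddSubmonoidClass.coe_finsetSum]
      refine Eq.trans ?_ hts
      exact Finset.sum_congr rfl fun p _ => (hg p (c p)).trans (hc p)
  exact ⟨LinearEquiv.ofBijective g hbij, hg⟩

/-- The homogeneous components of an element of `S(U^*)` killed by the derivations extending the
transposes of the maps `A i` come from symmetric forms killed by the `A i`. -/
theorem exists_sum_symOfForm {I : Type*} (A : I → U →ₗ[ℂ] U)
    {s : SymmetricAlgebra ℂ (Module.Dual ℂ U)} (hs : ∀ i, symDer (A i).dualMap s = 0) :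
    ∃ (T : Finset ℕ) (F : ∀ p, MultilinearMap ℂ (fun _ : Fin p => U) ℂ),
      (∀ p, IsSymmForm (F p)) ∧ (∀ p ∈ T, ∀ i, formDer (A i) (F p) = 0) ∧
      ∑ p ∈ T, symOfForm p (F p) = s := by
  obtain ⟨t, ht, hts⟩ := (Submodule.mem_iSup_iff_exists_finsupp _ _).1 (exists_sum_symPow s)
  choose F hF hFt using fun p => exists_isSymmForm (ht p)
  have hsum : ∑ p ∈ t.support, symOfForm p (F p) = s := by
    rw [← hts, Finsupp.sum]
    exact Finset.sum_congr rfl fun p _ => hFt p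
  refine ⟨t.support, F, hF, fun p hp i => ?_, hsum⟩
  rw [← symDer_symOfForm_eq_zero (hF p)]
  refine symPow_eq_zero_of_sum t.support (fun p => symDer (A i).dualMap (symOfForm p (F p)))
    (fun p => ?_) ?_ p hp
  · rw [symDer_symOfForm]
    exact symOfForm_mem p _
  · rw [← map_sum, hsum, hs]

/-- If the differentials vanish and the relative cochains are identified, multiplicatively, with the
homogeneous elements of a subalgebra `N` of `S(U^*)`, then the cohomology ring is isomorphic to `N`.
The hypothesis `hsurj` asks for the homogeneous components of elements of `N`. -/
theorem LieSuperalgebra.exists_relCohomology_equiv {L : Type*} [AddCommGroup L] [Module ℂ L]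
    {𝔤 : LieSuperalgebra L} {𝔱 : 𝔤.Sub}
    (hd : ∀ (p : ℕ), ∀ φ ∈ 𝔤.relCochain 𝔱 p, 𝔤.d p φ = 0)
    (g : ∀ p, Form L p →ₗ[ℂ] SymmetricAlgebra ℂ (Module.Dual ℂ U))
    (hg : ∀ (p : ℕ), ∀ φ ∈ 𝔤.relCochain 𝔱 p, g p φ = 0 → φ = 0)
    (hdeg : ∀ p φ, g p φ ∈ symPow (Module.Dual ℂ U) p)
    (N : Subalgebra ℂ (SymmetricAlgebra ℂ (Module.Dual ℂ U)))
    (hN : ∀ (p : ℕ), ∀ φ ∈ 𝔤.relCochain 𝔱 p, g p φ ∈ N)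
    (hsurj : ∀ s ∈ N, ∃ (T : Finset ℕ) (φ : ∀ p, Form L p),
      (∀ p ∈ T, φ p ∈ 𝔤.relCochain 𝔱 p) ∧ ∑ p ∈ T, g p (φ p) = s)
    (hone : g 0 (oneForm L) = 1)
    (hcup : ∀ (p q : ℕ) (φ : Form L p) (ψ : Form L q), φ ∈ 𝔤.relCochain 𝔱 p →
      ψ ∈ 𝔤.relCochain 𝔱 q →
        𝔤.cup φ ψ ∈ 𝔤.relCochain 𝔱 (p + q) ∧ g (p + q) (𝔤.cup φ ψ) = g p φ * g q ψ) :
    ∃ Φ : (⨁ p, 𝔤.RelCohomology 𝔱 p) ≃ₗ[ℂ] N,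
      Φ (𝔤.cohomClass 𝔱 (oneForm L) (𝔤.oneForm_mem 𝔱)) = 1 ∧
      (∀ (p q : ℕ) (φ : Form L p) (ψ : Form L q) (hφ : φ ∈ 𝔤.relCocycle 𝔱 p)
        (hψ : ψ ∈ 𝔤.relCocycle 𝔱 q), ∃ h : 𝔤.cup φ ψ ∈ 𝔤.relCocycle 𝔱 (p + q),
          Φ (𝔤.cohomClass 𝔱 (𝔤.cup φ ψ) h) =
            Φ (𝔤.cohomClass 𝔱 φ hφ) * Φ (𝔤.cohomClass 𝔱 ψ hψ)) ∧
      ∀ (p : ℕ) (c : 𝔤.RelCohomology 𝔱 p),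
        (Φ (DirectSum.lof ℂ ℕ (fun p => 𝔤.RelCohomology 𝔱 p) p c) :
          SymmetricAlgebra ℂ (Module.Dual ℂ U)) ∈ symPow (Module.Dual ℂ U) p := by
  obtain ⟨f, hf, hinj⟩ := exists_relCohomology_map hd g hg
  have hfdeg : ∀ p c, f p c ∈ symPow (Module.Dual ℂ U) p := fun p c => by
    induction c using Submodule.Quotient.induction_on with
    | H φ => exact (hf p φ.1 φ.2).symm ▸ hdeg p φ.1
  have hfN : ∀ p c, f p c ∈ N := fun p c => by
    induction c using Submodule.Quotient.induction_on with
    | H φ => exact (hf p φ.1 φ.2).symm ▸ hN p φ.1 φ.2.1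
  obtain ⟨Φ, hΦ⟩ := exists_linearEquiv_directSum
    (H := fun p => 𝔤.RelCohomology 𝔱 p) f hinj hfdeg N hfN fun s hs => by
    obtain ⟨T, φ, hφ, rfl⟩ := hsurj s hs
    refine Submodule.sum_mem _ fun p hp => Submodule.mem_iSup_of_mem p ?_
    exact ⟨_, hf p (φ p) ⟨hφ p hp, hd p _ (hφ p hp)⟩⟩
  have hclass : ∀ (p : ℕ) (φ : Form L p) (hφ : φ ∈ 𝔤.relCocycle 𝔱 p),
      (Φ (𝔤.cohomClass 𝔱 φ hφ) : SymmetricAlgebra ℂ (Module.Dual ℂ U)) = g p φ :=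
    fun p φ hφ => (hΦ p _).trans (hf p φ hφ)
  refine ⟨Φ, Subtype.ext ((hclass 0 _ _).trans hone), fun p q φ ψ hφ hψ => ?_,
    fun p c => (hΦ p c).symm ▸ hfdeg p c⟩
  obtain ⟨hmem, hmul⟩ := hcup p q φ ψ hφ.1 hψ.1
  refine ⟨mem_relCocycle_of_d_eq_zero hd hmem, Subtype.ext ?_⟩
  rw [hclass, hmul, ← hclass p φ hφ, ← hclass q ψ hψ]
  rfl

end

namespace W

variable {n p q : ℕ}

/-- The element of `S^p((𝔤₋₁ ⊕ 𝔤₁)^*)` given by the restriction of a `p`-linear form. -/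
noncomputable def cochainMap (n p : ℕ) : LieSuperalgebra.Form (W n) p →ₗ[ℂ] SymPM n :=
  symOfForm p ∘ₗ MultilinearMap.compLinearMapₗ fun _ => (degPM n).subtype

theorem cochainMap_oneForm (n : ℕ) : cochainMap n 0 (LieSuperalgebra.oneForm (W n)) = 1 := by
  refine symEval_injective fun u => ?_
  rw [map_one]
  refine (symEval_symOfForm _ u).trans ?_
  rw [Nat.factorial_zero, Nat.cast_one, inv_one, one_mul]
  rfl

theorem eq_zero_of_cochainMap {φ : LieSuperalgebra.Form (W n) p}
    (hφ : φ ∈ (lieSuperalgebra n).relCochain (degZero n) p) (h : cochainMap n p φ = 0) :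
    φ = 0 :=
  restrPM_injective (relCochain_eq_zero hφ) (fun _ _ _ _ _ _ => rfl)
    ((restrPM_isSymmForm hφ).eq_zero_of_symOfForm h)

/-- Every invariant is a sum of elements coming from relative cochains. -/
theorem exists_sum_cochainMap {s : SymPM n} (hs : s ∈ lieInvariants n) :
    ∃ (T : Finset ℕ) (φ : ∀ p, LieSuperalgebra.Form (W n) p),
      (∀ p ∈ T, φ p ∈ (lieSuperalgebra n).relCochain (degZero n) p) ∧
      ∑ p ∈ T, cochainMap n p (φ p) = s := by
  obtain ⟨T, F, hF, hinv, hsum⟩ := exists_sum_symOfForm _ (mem_lieInvariants.1 hs)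
  refine ⟨T, fun p => (F p).compLinearMap fun _ => projPM n,
    fun p hp => extend_mem_relCochain (hF p) (hinv p hp), ?_⟩
  rw [← hsum]
  exact Finset.sum_congr rfl fun p _ => congrArg (symOfForm p) (restrPM_extend (F p))

end W

/-! ### Semisimple one-parameter groups acting on a symmetric algebra -/

/-- If `s` is a sum of common eigenvectors `s_k` of `A` and `B` for the eigenvalues `α k` and `β k`,
where `α` is injective, then `A s = α k₀ s` forces `s = s_{k₀}`. -/
theorem eigen_of_eigen {V : Type*} [AddCommGroup V] [Module ℂ V] {A B : Module.End ℂ V}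
    {α β : ℤ → ℂ} (hα : Function.Injective α) {E : ℤ → Submodule ℂ V}
    (hA : ∀ k, ∀ x ∈ E k, A x = α k • x) (hB : ∀ k, ∀ x ∈ E k, B x = β k • x) {s : V}
    (hs : s ∈ ⨆ k, E k) {k₀ : ℤ} (h : A s = α k₀ • s) : B s = β k₀ • s := by
  have hle : (⨆ k, E k) ≤ E k₀ ⊔ ⨆ (k) (_ : k ≠ k₀), E k := iSup_le fun k => by
    by_cases hk : k = k₀
    · rw [hk]; exact le_sup_left
    · exact (le_iSup₂_of_le (f := fun k (_ : k ≠ k₀) => E k) k hk le_rfl).trans le_sup_right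
  obtain ⟨x, hx, y, hy, rfl⟩ := Submodule.mem_sup.1 (hle hs)
  have hy1 : y ∈ A.eigenspace (α k₀) := by
    rw [Module.End.mem_eigenspace_iff]
    rw [map_add, hA _ _ hx, smul_add] at h
    exact add_left_cancel h
  have hy2 : y ∈ ⨆ (k) (_ : k ≠ k₀), A.eigenspace (α k) :=
    SetLike.le_def.1 (iSup₂_mono fun k _ x hx => Module.End.mem_eigenspace_iff.2 (hA k x hx)) hy
  have hy0 : y = 0 := Submodule.disjoint_def.1
    ((Module.End.eigenspaces_iSupIndep A).comp hα k₀) y hy1 hy2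
  rw [hy0, add_zero, hB _ _ hx]

section SymEigen

variable {M : Type*} [AddCommGroup M] [Module ℂ M]

theorem symMap_ι (f : M →ₗ[ℂ] M) (m : M) :
    symMap f (SymmetricAlgebra.ι ℂ M m) = SymmetricAlgebra.ι ℂ M (f m) := by
  simp [symMap]

theorem symMap_comp (f g : M →ₗ[ℂ] M) (s : SymmetricAlgebra ℂ M) :
    symMap (f ∘ₗ g) s = symMap f (symMap g s) := by
  have h : symMap (f ∘ₗ g) = (symMap f).comp (symMap g) :=
    SymmetricAlgebra.algHom_ext (LinearMap.ext fun m => by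
      change symMap (f ∘ₗ g) (SymmetricAlgebra.ι ℂ M m) =
        symMap f (symMap g (SymmetricAlgebra.ι ℂ M m))
      rw [symMap_ι, symMap_ι, symMap_ι, LinearMap.comp_apply])
  exact congrArg (fun g => g s) h

theorem symMap_id (s : SymmetricAlgebra ℂ M) : symMap (LinearMap.id : M →ₗ[ℂ] M) s = s := by
  have h : symMap (LinearMap.id : M →ₗ[ℂ] M) = AlgHom.id ℂ _ :=
    SymmetricAlgebra.algHom_ext (LinearMap.ext fun m => symMap_ι LinearMap.id m)
  exact congrArg (fun g => g s) h

theorem symDer_add (f g : M →ₗ[ℂ] M) : symDer (f + g) = symDer f + symDer g :=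
  (symDer_unique fun m => by
    rw [Derivation.add_apply, symDer_ι, symDer_ι, LinearMap.add_apply, map_add]).symm

theorem symDer_smul (c : ℂ) (f : M →ₗ[ℂ] M) : symDer (c • f) = c • symDer f :=
  (symDer_unique fun m => by
    rw [Derivation.smul_apply, symDer_ι, LinearMap.smul_apply, map_smul]).symm

/-- The elements of `S(M)` of weight `k` for the infinitesimal action of `f` and the action of `g`,
where `g` plays the role of `t ^ f`. -/
noncomputable def symWeight (f g : M →ₗ[ℂ] M) (t : ℂ) (k : ℤ) :
    Submodule ℂ (SymmetricAlgebra ℂ M) :=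
  Module.End.eigenspace (symDer f).toLinearMap (k : ℂ) ⊓
    Module.End.eigenspace (symMap g).toLinearMap (t ^ k)

theorem mem_symWeight {f g : M →ₗ[ℂ] M} {t : ℂ} {k : ℤ} {s : SymmetricAlgebra ℂ M} :
    s ∈ symWeight f g t k ↔ symDer f s = (k : ℂ) • s ∧ symMap g s = t ^ k • s := by
  rw [symWeight, Submodule.mem_inf, Module.End.mem_eigenspace_iff, Module.End.mem_eigenspace_iff]
  rfl

theorem mul_mem_symWeight {f g : M →ₗ[ℂ] M} {t : ℂ} (ht : t ≠ 0) {k l : ℤ}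
    {a b : SymmetricAlgebra ℂ M} (ha : a ∈ symWeight f g t k) (hb : b ∈ symWeight f g t l) :
    a * b ∈ symWeight f g t (k + l) := by
  rw [mem_symWeight] at *
  constructor
  · rw [Derivation.leibniz, ha.1, hb.1, smul_eq_mul, smul_eq_mul, mul_smul_comm, mul_smul_comm,
      mul_comm b a, ← add_smul, add_comm]
    push_cast
    rfl
  · rw [map_mul, ha.2, hb.2, smul_mul_smul_comm, zpow_add₀ ht]

variable {f g : M →ₗ[ℂ] M} {t : ℂ}

/-- If `f` has the weights `1`, `-1`, `0` and `g` acts by `t`, `t⁻¹`, `1` on the weight spaces, then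
`S(M)` is the sum of the common weight spaces. -/
theorem mem_iSup_symWeight (ht : t ≠ 0) (hf : ∀ m, f (f (f m)) = f m)
    (hg : ∀ m, g m = m + ((t - t⁻¹) / 2) • f m + ((t + t⁻¹) / 2 - 1) • f (f m))
    (s : SymmetricAlgebra ℂ M) : s ∈ ⨆ k, symWeight f g t k := by
  induction s using SymmetricAlgebra.induction with
  | algebraMap r =>
    refine Submodule.mem_iSup_of_mem 0 (mem_symWeight.2 ⟨?_, ?_⟩)
    · rw [Derivation.map_algebraMap, Int.cast_zero, zero_smul]
    · rw [AlgHom.commutes, zpow_zero, one_smul]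
  | ι m =>
    obtain ⟨x, -, y, -, z, -, rfl, hx, hy, hz⟩ :=
      exists_weights hf (N := ⊤) (fun _ _ => Submodule.mem_top) (Submodule.mem_top (x := m))
    rw [map_add, map_add]
    refine add_mem (add_mem ?_ ?_) ?_
    · refine Submodule.mem_iSup_of_mem 1 (mem_symWeight.2 ⟨?_, ?_⟩)
      · rw [symDer_ι, hx, map_smul, Int.cast_one]
      · rw [symMap_ι, hg, hx, map_smul, hx, ← map_smul, zpow_one]
        congr 1; module
    · refine Submodule.mem_iSup_of_mem (-1) (mem_symWeight.2 ⟨?_, ?_⟩)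
      · rw [symDer_ι, hy, map_smul, Int.cast_neg, Int.cast_one]
      · rw [symMap_ι, hg, hy, map_smul, hy, ← map_smul, zpow_neg_one]
        congr 1; module
    · refine Submodule.mem_iSup_of_mem 0 (mem_symWeight.2 ⟨?_, ?_⟩)
      · rw [symDer_ι, hz, map_smul, Int.cast_zero]
      · rw [symMap_ι, hg, hz, map_smul, hz, ← map_smul, zpow_zero]
        congr 1; module
  | add s t hs ht => exact add_mem hs ht
  | mul a b ha hb =>
    have := Submodule.mul_mem_mul ha hb
    rw [Submodule.iSup_mul] at this
    simp only [Submodule.mul_iSup] at this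
    refine SetLike.le_def.1 (iSup_le fun k => iSup_le fun l => ?_) this
    refine (Submodule.mul_le.2 fun a ha b hb => ?_ : _ ≤ symWeight f g t (k + l)).trans
      (le_iSup _ (k + l))
    exact mul_mem_symWeight ht ha hb

theorem symMap_eq_self_of_symDer (ht : t ≠ 0) (hf : ∀ m, f (f (f m)) = f m)
    (hg : ∀ m, g m = m + ((t - t⁻¹) / 2) • f m + ((t + t⁻¹) / 2 - 1) • f (f m))
    {s : SymmetricAlgebra ℂ M} (h : symDer f s = 0) : symMap g s = s := by
  have := eigen_of_eigen (A := (symDer f).toLinearMap) (B := (symMap g).toLinearMap)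
    (α := fun k => (k : ℂ)) (β := fun k => t ^ k) Int.cast_injective
    (fun k x hx => (mem_symWeight.1 hx).1) (fun k x hx => (mem_symWeight.1 hx).2)
    (mem_iSup_symWeight ht hf hg s) (k₀ := 0) (by simpa using h)
  simpa using this

/-- The value `t = 2` suffices, since the powers `2 ^ k` are pairwise distinct. -/
theorem symDer_eq_zero_of_symMap (hf : ∀ m, f (f (f m)) = f m)
    (hg : ∀ m, g m = m + ((2 - 2⁻¹ : ℂ) / 2) • f m + ((2 + 2⁻¹ : ℂ) / 2 - 1) • f (f m))
    {s : SymmetricAlgebra ℂ M} (h : symMap g s = s) : symDer f s = 0 := by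
  have hinj : Function.Injective fun k : ℤ => (2 : ℂ) ^ k := by
    have h2 : Function.Injective fun k : ℤ => (2 : ℝ) ^ k :=
      zpow_right_injective₀ (by norm_num) (by norm_num)
    intro k l hkl
    have h : (2 : ℂ) ^ k = 2 ^ l := hkl
    have h' := congrArg norm h
    rw [norm_zpow, norm_zpow, Complex.norm_ofNat] at h'
    exact h2 h'
  have := eigen_of_eigen (A := (symMap g).toLinearMap) (B := (symDer f).toLinearMap)
    (β := fun k => (k : ℂ)) (α := fun k => (2 : ℂ) ^ k) hinj
    (fun k x hx => (mem_symWeight.1 hx).2) (fun k x hx => (mem_symWeight.1 hx).1)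
    (mem_iSup_symWeight two_ne_zero hf hg s) (k₀ := 0) (by simpa using h)
  simpa using this

end SymEigen

/-! ### The group `GL(n)` -/

/-- The automorphism of `ℂⁿ` which is `t` on the image of the rank one idempotent `m ↦ v(m) u` and
`1` on its kernel. -/
noncomputable def rankOneGL {V : Type*} [AddCommGroup V] [Module ℂ V] {u : V}
    {v : Module.Dual ℂ V} (h : v u = 1) {t : ℂ} (ht : t ≠ 0) :
    LinearMap.GeneralLinearGroup ℂ V where
  val := 1 + (t - 1) • v.smulRight u
  inv := 1 + (t⁻¹ - 1) • v.smulRight u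
  val_inv := LinearMap.ext fun m => by
    simp only [Module.End.mul_apply, LinearMap.add_apply, Module.End.one_apply,
      LinearMap.smul_apply, LinearMap.smulRight_apply, map_add, map_smul, h]
    match_scalars <;> field_simp
    ring
  inv_val := LinearMap.ext fun m => by
    simp only [Module.End.mul_apply, LinearMap.add_apply, Module.End.one_apply,
      LinearMap.smul_apply, LinearMap.smulRight_apply, map_add, map_smul, h]
    match_scalars <;> field_simp
    ring

theorem rankOneGL_apply {V : Type*} [AddCommGroup V] [Module ℂ V] {u : V}
    {v : Module.Dual ℂ V} (h : v u = 1) {t : ℂ} (ht : t ≠ 0) (m : V) :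
    (rankOneGL h ht).val m = m + ((t - 1) * v m) • u := by
  simp [rankOneGL, mul_smul]

theorem rankOneGL_inv {V : Type*} [AddCommGroup V] [Module ℂ V] {u : V}
    {v : Module.Dual ℂ V} (h : v u = 1) {t : ℂ} (ht : t ≠ 0) :
    (rankOneGL h ht)⁻¹ = rankOneGL h (inv_ne_zero ht) := Units.ext rfl

/-- `GL(n)` is generated by the automorphisms `rankOneGL`: they contain the diagonal matrices with
a single entry different from `1`, and every transvection is a product of two of them. -/
theorem GL_induction {n : ℕ} {Q : LinearMap.GeneralLinearGroup ℂ (Fin n → ℂ) → Prop}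
    (h1 : Q 1) (hmul : ∀ A B, Q A → Q B → Q (A * B))
    (hrank : ∀ (u : Fin n → ℂ) (v : Module.Dual ℂ (Fin n → ℂ)) (h : v u = 1) (t : ℂ) (ht : t ≠ 0),
      Q (rankOneGL h ht)) (A : LinearMap.GeneralLinearGroup ℂ (Fin n → ℂ)) : Q A := by
  let P : Matrix (Fin n) (Fin n) ℂ → Prop := fun M =>
    ∃ B : LinearMap.GeneralLinearGroup ℂ (Fin n → ℂ), B.val = Matrix.toLin' M ∧ Q B
  have hP : ∀ M N, P M → P N → P (M * N) := by
    rintro M N ⟨B, hB, hQB⟩ ⟨C, hC, hQC⟩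
    refine ⟨B * C, ?_, hmul B C hQB hQC⟩
    rw [Matrix.toLin'_mul, ← hB, ← hC]
    rfl
  have hc : ∀ j : Fin n, coordForm j (Pi.single j 1 : Fin n → ℂ) = 1 := fun j => by
    simp [coordForm]
  have hdiag : ∀ (D : Fin n → ℂ), (∀ i, D i ≠ 0) → P (Matrix.diagonal D) := by
    intro D hD
    have key : ∀ S : Finset (Fin n), P (Matrix.diagonal fun i => if i ∈ S then D i else 1) := by
      intro S
      induction S using Finset.induction_on with
      | empty => exact ⟨1, by simp [Module.End.one_eq_id], h1⟩
      | insert a S ha ih =>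
        have hs : P (Matrix.diagonal fun i => if i = a then D i else 1) := by
          refine ⟨rankOneGL (hc a) (hD a), LinearMap.ext fun m => ?_, hrank _ _ _ _ _⟩
          rw [rankOneGL_apply, Matrix.toLin'_apply]
          funext i
          rw [Matrix.mulVec_diagonal]
          by_cases hi : i = a
          · subst hi
            simp [coordForm]
            ring
          · simp [hi, coordForm]
        have := hP _ _ hs ih
        rw [Matrix.diagonal_mul_diagonal] at this
        have he : (fun i => if i ∈ insert a S then D i else 1) =
            fun i => (if i = a then D i else 1) * if i ∈ S then D i else 1 := by
          funext i
          by_cases hi : i = a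
          · subst hi; simp [ha]
          · simp [hi]
        rw [he]
        exact this
    simpa using key Finset.univ
  have htrans : ∀ s : Matrix.TransvectionStruct (Fin n) ℂ, P s.toMatrix := by
    intro s
    have hu : coordForm s.j (Pi.single s.j 1 + (2 * s.c) • Pi.single s.i 1 : Fin n → ℂ) = 1 := by
      simp [coordForm, s.hij.symm]
    refine ⟨rankOneGL hu two_ne_zero * rankOneGL (hc s.j) (inv_ne_zero two_ne_zero),
      LinearMap.ext fun m => ?_, hmul _ _ (hrank _ _ _ _ _) (hrank _ _ _ _ _)⟩
    rw [Units.val_mul, Module.End.mul_apply, rankOneGL_apply, rankOneGL_apply, Matrix.toLin'_apply,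
      Matrix.TransvectionStruct.toMatrix, Matrix.transvection, Matrix.add_mulVec, Matrix.one_mulVec,
      map_add, map_smul, hc]
    have hs : (Matrix.single s.i s.j s.c).mulVec m = (s.c * m s.j) • Pi.single s.i 1 := by
      funext i
      simp [Matrix.single_mulVec, Function.update_apply, Pi.single_apply]
    rw [hs]
    simp only [coordForm, LinearMap.proj_apply, smul_eq_mul]
    module
  obtain ⟨B, hB, hQB⟩ : P (LinearMap.toMatrix' A.val) := by
    refine Matrix.diagonal_transvection_induction_of_det_ne_zero P _ ?_ (fun D hD => ?_) htrans
      fun M N _ _ => hP M N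
    · rw [LinearMap.det_toMatrix']
      exact (LinearMap.isUnit_det A.val A.isUnit).ne_zero
    · rw [Matrix.det_diagonal] at hD
      exact hdiag D fun i => Finset.prod_ne_zero_iff.1 hD i (Finset.mem_univ i)
  rw [Matrix.toLin'_toMatrix'] at hB
  rwa [← Units.ext hB]

/-! ### Invariants of `𝔤₀` and of `G₀` -/

section Transpose

variable {U : Type*} [AddCommMonoid U] [Module ℂ U] {A B : U →ₗ[ℂ] U} {t : ℂ}
  {s : SymmetricAlgebra ℂ (Module.Dual ℂ U)}

theorem dualMap_cube (hA : ∀ x, A (A (A x)) = A x) (φ : Module.Dual ℂ U) :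
    A.dualMap (A.dualMap (A.dualMap φ)) = A.dualMap φ :=
  LinearMap.ext fun x => congrArg φ (hA x)

/-- The formula of `W.AdPM_rankOneGL` passes to the dual space. -/
theorem dualMap_torus {a b : ℂ} (hB : ∀ x, B x = x + a • A x + b • A (A x))
    (φ : Module.Dual ℂ U) :
    B.dualMap φ = φ + a • A.dualMap φ + b • A.dualMap (A.dualMap φ) :=
  LinearMap.ext fun x => by simp [hB]

theorem symDer_dualMap_zero (hA : ∀ x, A x = 0) : symDer A.dualMap s = 0 := by
  have h : A = 0 := LinearMap.ext hA
  have h' : symDer A.dualMap = 0 := (symDer_unique fun m => by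
    rw [h, Derivation.zero_apply, LinearMap.dualMap_apply', LinearMap.comp_zero, map_zero]).symm
  rw [h', Derivation.zero_apply]

theorem symDer_dualMap_add {C : U →ₗ[ℂ] U} (h : ∀ x, C x = A x + B x)
    (hA : symDer A.dualMap s = 0) (hB : symDer B.dualMap s = 0) : symDer C.dualMap s = 0 := by
  have hC : C.dualMap = A.dualMap + B.dualMap :=
    LinearMap.ext fun φ => LinearMap.ext fun x => by simp [h]
  rw [hC, symDer_add, Derivation.add_apply, hA, hB, add_zero]

theorem symDer_dualMap_smul {c : ℂ} (h : ∀ x, B x = c • A x)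
    (hA : symDer A.dualMap s = 0) : symDer B.dualMap s = 0 := by
  have hB : B.dualMap = c • A.dualMap :=
    LinearMap.ext fun φ => LinearMap.ext fun x => by simp [h]
  rw [hB, symDer_smul, Derivation.smul_apply, hA, smul_zero]

theorem symMap_dualMap_id (h : ∀ x, A x = x) : symMap A.dualMap s = s := by
  have hA : A = LinearMap.id := LinearMap.ext h
  rw [hA, LinearMap.dualMap_id, symMap_id]

theorem symMap_dualMap_comp {C : U →ₗ[ℂ] U} (h : ∀ x, C x = A (B x))
    (hA : symMap A.dualMap s = s) (hB : symMap B.dualMap s = s) : symMap C.dualMap s = s := by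
  have hC : C = A ∘ₗ B := LinearMap.ext h
  rw [hC, ← LinearMap.dualMap_comp_dualMap, symMap_comp, hA, hB]

end Transpose

/-- Conjugation by `1 + (t - 1) H` for an idempotent `H`, in terms of the commutator with `H`. -/
theorem conj_idempotent {E : Type*} [Ring E] [Algebra ℂ E] (H D : E) {t : ℂ} (ht : t ≠ 0)
    (hH : H * H = H) :
    (1 + (t - 1) • H) * D * (1 + (t⁻¹ - 1) • H) =
      D + ((t - t⁻¹) / 2) • (H * D - D * H) +
        ((t + t⁻¹) / 2 - 1) • (H * (H * D - D * H) - (H * D - D * H) * H) := by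
  have h1 : H * (H * D) = H * D := by rw [← mul_assoc, hH]
  simp only [add_mul, mul_add, mul_sub, sub_mul, one_mul, mul_one, smul_mul_assoc, mul_smul_comm,
    mul_assoc, hH, h1]
  match_scalars <;> field_simp <;> ring

namespace W

variable {n : ℕ} {u : Fin n → ℂ} {v : Module.Dual ℂ (Fin n → ℂ)}

/-- On `Λ(n)` the automorphism is still `1 + (t - 1) H`, as `ι u` squares to zero. -/
theorem lamMap_rankOneGL (h : v u = 1) {t : ℂ} (ht : t ≠ 0) :
    lamMap (rankOneGL h ht) = 1 + (t - 1) • (rankOne u v).1 := by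
  refine LinearMap.ext fun x => ?_
  induction x using CliffordAlgebra.left_induction with
  | algebraMap r =>
    have h1 : lamMap (rankOneGL h ht) (algebraMap ℂ (Lam n) r) = algebraMap ℂ (Lam n) r :=
      AlgHom.commutes (ExteriorAlgebra.map (rankOneGL h ht).val) r
    refine h1.trans ?_
    change _ = algebraMap ℂ (Lam n) r +
      (t - 1) • (ExteriorAlgebra.ι ℂ u * contr v (algebraMap ℂ (Lam n) r))
    rw [contr_algebraMap, mul_zero, smul_zero, add_zero]
  | add x y hx hy => rw [map_add, map_add, hx, hy]
  | ι_mul x m hx =>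
    change lamMap (rankOneGL h ht) (ExteriorAlgebra.ι ℂ m * x) =
      (1 + (t - 1) • (rankOne u v).1) (ExteriorAlgebra.ι ℂ m * x)
    have h1 : lamMap (rankOneGL h ht) (ExteriorAlgebra.ι ℂ m) =
        ExteriorAlgebra.ι ℂ m + ((t - 1) * v m) • ExteriorAlgebra.ι ℂ u :=
      (ExteriorAlgebra.map_apply_ι _ m).trans (by rw [rankOneGL_apply, map_add, map_smul])
    have h2 : ExteriorAlgebra.ι ℂ u * ExteriorAlgebra.ι ℂ u = 0 := ExteriorAlgebra.ι_sq_zero u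
    have h3 : ExteriorAlgebra.ι ℂ u * ExteriorAlgebra.ι ℂ m =
        -(ExteriorAlgebra.ι ℂ m * ExteriorAlgebra.ι ℂ u) :=
      eq_neg_of_add_eq_zero_left (ExteriorAlgebra.ι_add_mul_swap u m)
    rw [lamMap_mul, hx, h1]
    simp only [LinearMap.add_apply, LinearMap.smul_apply, Module.End.one_apply, rankOne_apply,
      contr_ι_mul, add_mul, mul_add, mul_sub, smul_mul_assoc, mul_smul_comm, ← mul_assoc, h2, h3,
      neg_mul, zero_mul]
    module

/-- On the weight spaces of the rank one idempotent for the weights `1`, `-1`, `0` the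
automorphism `rankOneGL` acts by `t`, `t⁻¹`, `1`. -/
theorem AdPM_rankOneGL (h : v u = 1) {t : ℂ} (ht : t ≠ 0) (x : degPM n) :
    AdPM (rankOneGL h ht) x = x + ((t - t⁻¹) / 2) • adPM n ⟨rankOne u v, rankOne_mem u v⟩ x +
      ((t + t⁻¹) / 2 - 1) • adPM n ⟨rankOne u v, rankOne_mem u v⟩
        (adPM n ⟨rankOne u v, rankOne_mem u v⟩ x) := by
  have hp := mem_part_zero (rankOne_mem u v)
  refine Subtype.ext (Subtype.ext ?_)
  change lamMap (rankOneGL h ht) * x.1.1 * lamMap (rankOneGL h ht)⁻¹ =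
    x.1.1 + ((t - t⁻¹) / 2) • (bracket n (rankOne u v) x.1).1 +
      ((t + t⁻¹) / 2 - 1) • (bracket n (rankOne u v) (bracket n (rankOne u v) x.1)).1
  rw [rankOneGL_inv, lamMap_rankOneGL, lamMap_rankOneGL,
    bracket_even hp (bracket n (rankOne u v) x.1), bracket_even hp x.1]
  exact conj_idempotent _ _ ht (rankOne_mul_self h)

theorem adPM_rankOne_cube (h : v u = 1) (x : degPM n) :
    adPM n ⟨rankOne u v, rankOne_mem u v⟩ (adPM n ⟨rankOne u v, rankOne_mem u v⟩
      (adPM n ⟨rankOne u v, rankOne_mem u v⟩ x)) = adPM n ⟨rankOne u v, rankOne_mem u v⟩ x :=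
  Subtype.ext (bracket_rankOne_cube h x.1)

theorem symMap_AdPM_of_symDer (h : v u = 1) {t : ℂ} (ht : t ≠ 0) {s : SymPM n}
    (hs : symDer (adPM n ⟨rankOne u v, rankOne_mem u v⟩).dualMap s = 0) :
    symMap (AdPM (rankOneGL h ht)).dualMap s = s :=
  symMap_eq_self_of_symDer ht (dualMap_cube (adPM_rankOne_cube h))
    (dualMap_torus (AdPM_rankOneGL h ht)) hs

theorem symDer_adPM_of_symMap (h : v u = 1) {s : SymPM n}
    (hs : symMap (AdPM (rankOneGL h two_ne_zero)).dualMap s = s) :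
    symDer (adPM n ⟨rankOne u v, rankOne_mem u v⟩).dualMap s = 0 :=
  symDer_eq_zero_of_symMap (dualMap_cube (adPM_rankOne_cube h))
    (dualMap_torus (AdPM_rankOneGL h two_ne_zero)) hs

theorem lamMap_comp (A B : LinearMap.GeneralLinearGroup ℂ (Fin n → ℂ)) :
    lamMap (A * B) = lamMap A * lamMap B :=
  LinearMap.ext fun x =>
    (congrArg (fun f => f x) (ExteriorAlgebra.map_comp_map B.val A.val)).symm

theorem AdPM_mul (A B : LinearMap.GeneralLinearGroup ℂ (Fin n → ℂ)) (x : degPM n) :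
    AdPM (A * B) x = AdPM A (AdPM B x) := by
  refine Subtype.ext (Subtype.ext ?_)
  change lamMap (A * B) * x.1.1 * lamMap (A * B)⁻¹ =
    lamMap A * (lamMap B * x.1.1 * lamMap B⁻¹) * lamMap A⁻¹
  rw [mul_inv_rev, lamMap_comp, lamMap_comp]
  simp only [mul_assoc]

theorem AdPM_one (x : degPM n) :
    AdPM (1 : LinearMap.GeneralLinearGroup ℂ (Fin n → ℂ)) x = x := by
  refine Subtype.ext (Subtype.ext ?_)
  have h : lamMap (1 : LinearMap.GeneralLinearGroup ℂ (Fin n → ℂ)) = 1 :=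
    congrArg AlgHom.toLinearMap (ExteriorAlgebra.map_id (R := ℂ) (M := Fin n → ℂ))
  change lamMap 1 * x.1.1 * lamMap 1⁻¹ = x.1.1
  rw [inv_one, h, one_mul, mul_one]

theorem lieInvariants_le_groupInvariants : lieInvariants n ≤ groupInvariants n := by
  intro s hs
  rw [mem_lieInvariants] at hs
  have key : ∀ A : LinearMap.GeneralLinearGroup ℂ (Fin n → ℂ), symMap (AdPM A).dualMap s = s := by
    -- the set of automorphisms fixing `s` is closed under products
    exact GL_induction (symMap_dualMap_id AdPM_one) (fun A B => symMap_dualMap_comp (AdPM_mul A B))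
      fun u v h t ht => symMap_AdPM_of_symDer h ht (hs _)
  exact fun A => key A⁻¹

theorem groupInvariants_le_lieInvariants : groupInvariants n ≤ lieInvariants n := by
  intro s hs
  have hs' : ∀ A : LinearMap.GeneralLinearGroup ℂ (Fin n → ℂ), symMap (AdPM A).dualMap s = s :=
    fun A => by
      have h : symMap (AdPM A⁻¹⁻¹).dualMap s = s := hs A⁻¹
      rwa [inv_inv] at h
  rw [mem_lieInvariants]
  have key : ∀ z : W n, z ∈ Submodule.span ℂ {z : W n | ∃ u v, v u = 1 ∧ z = rankOne u v} →
      ∃ h : z ∈ deg n 0, symDer (adPM n ⟨z, h⟩).dualMap s = 0 := by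
    intro z hz
    induction hz using Submodule.span_induction with
    | mem z hz =>
      obtain ⟨u, v, h, rfl⟩ := hz
      exact ⟨rankOne_mem u v, symDer_adPM_of_symMap h (hs' _)⟩
    | zero => exact ⟨Submodule.zero_mem _, symDer_dualMap_zero fun x =>
        Subtype.ext (LinearMap.map_zero₂ (bracket n) x.1)⟩
    | add z w _ _ hz hw =>
      obtain ⟨hz, hz'⟩ := hz
      obtain ⟨hw, hw'⟩ := hw
      exact ⟨Submodule.add_mem _ hz hw, symDer_dualMap_add
        (A := adPM n ⟨z, hz⟩) (B := adPM n ⟨w, hw⟩) (fun x =>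
        Subtype.ext (LinearMap.map_add₂ (bracket n) z w x.1)) hz' hw'⟩
    | smul c z _ hz =>
      obtain ⟨hz, hz'⟩ := hz
      exact ⟨Submodule.smul_mem _ c hz, symDer_dualMap_smul
        (A := adPM n ⟨z, hz⟩) (c := c) (fun x =>
        Subtype.ext (LinearMap.map_smul₂ (bracket n) c z x.1)) hz'⟩
  exact fun z => (key z.1 (mem_span_rankOne z.2)).choose_spec

end W

theorem mainTheorem3 (n : ℕ) (hn : 2 ≤ n) :
    -- the differentials of the relative cochain complex vanish
    (∀ (p : ℕ), ∀ φ ∈ (W.lieSuperalgebra n).relCochain (W.degZero n) p,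
      (W.lieSuperalgebra n).d p φ = 0) ∧
    -- only the pieces of degree `-1` and `1` contribute to the relative cochains
    (∀ (p : ℕ), ∀ φ ∈ (W.lieSuperalgebra n).relCochain (W.degZero n) p,
      ∀ (x : Fin p → W n) (i : Fin p) (k : ℤ), k ≠ -1 → k ≠ 1 → x i ∈ W.deg n k → φ x = 0) ∧
    -- the relative cohomology ring is isomorphic to the invariant ring, as a graded algebra
    (∃ Φ : (⨁ p, (W.lieSuperalgebra n).RelCohomology (W.degZero n) p) ≃ₗ[ℂ] W.lieInvariants n,
      Φ ((W.lieSuperalgebra n).cohomClass (W.degZero n) (LieSuperalgebra.oneForm (W n))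
        ((W.lieSuperalgebra n).oneForm_mem (W.degZero n))) = 1 ∧
      (∀ (p q : ℕ) (φ : LieSuperalgebra.Form (W n) p) (ψ : LieSuperalgebra.Form (W n) q)
        (hφ : φ ∈ (W.lieSuperalgebra n).relCocycle (W.degZero n) p)
        (hψ : ψ ∈ (W.lieSuperalgebra n).relCocycle (W.degZero n) q),
        ∃ h : (W.lieSuperalgebra n).cup φ ψ ∈ (W.lieSuperalgebra n).relCocycle (W.degZero n) (p + q),
          Φ ((W.lieSuperalgebra n).cohomClass (W.degZero n) ((W.lieSuperalgebra n).cup φ ψ) h) =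
            Φ ((W.lieSuperalgebra n).cohomClass (W.degZero n) φ hφ) *
              Φ ((W.lieSuperalgebra n).cohomClass (W.degZero n) ψ hψ)) ∧
      (∀ (p : ℕ) (c : (W.lieSuperalgebra n).RelCohomology (W.degZero n) p),
        (Φ (DirectSum.lof ℂ ℕ (fun p => (W.lieSuperalgebra n).RelCohomology (W.degZero n) p) p c) :
          W.SymPM n) ∈ W.symDeg n p)) ∧
    W.lieInvariants n = W.groupInvariants n := by
  exact ⟨fun p φ hφ => W.d_eq_zero hφ, fun p φ hφ => W.relCochain_eq_zero hφ,
    LieSuperalgebra.exists_relCohomology_equiv (fun _ _ hφ => W.d_eq_zero hφ) (W.cochainMap n)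
      (fun _ _ hφ h => W.eq_zero_of_cochainMap hφ h) (fun p φ => symOfForm_mem p (W.restrPM φ))
      (W.lieInvariants n) (fun _ _ hφ => W.symOfForm_restrPM_mem hφ)
      (fun _ hs => W.exists_sum_cochainMap hs) (W.cochainMap_oneForm n)
      (fun _ _ φ ψ hφ hψ => ⟨W.cup_mem_relCochain hφ hψ, W.symOfForm_restrPM_cup φ ψ⟩),
    le_antisymm W.lieInvariants_le_groupInvariants W.groupInvariants_le_lieInvariants⟩
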